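/- **Conventions.** A function on a convex set $U\subseteq\mathbb R^n$ is *difference-convex* ($DC$) if it is the difference of two continuous convex functions on $U$; it is *locally $DC$* if each point of its domain has a convex neighborhood on which it is $DC$. $W^{2,1}$ is the Sobolev space of integrable functions with integrable weak derivatives up to order two, and $W^{2,1}_{\mathrm{loc}}$ is its local version. A vector- or matrix-valued map belongs to one of these classes if all its real components do. Let $\operatorname{Herm}(d)$ be the real vector space of complex $d\times d$ Hermitian matrices. A *system of the eigenvalues* of a map $A$ with values in $\operatorname{Herm}(d)$ is a map $\lambda=(\lambda_1,\dots,\lambda_d)$ on the same domain with values in $\mathbb R^d$ such that, at each point $t$, $\lambda_1(t),\dots,\lambda_d(t)$ are the eigenvalues of $A(t)$ with multiplicities, in some order. **Theorem.** Let $A:\mathbb R\to\operatorname{Herm}(d)$ be a curve of Hermitian matrices of class $DC\cap W^{2,1}_{\mathrm{loc}}$ on $\mathbb R$. 1. Any differentiable system $\lambda=(\lambda_1,\dots,\lambda_d)$ of the eigenvalues of $A$ is actually of class $$\lambda\in C^1(\mathbb R,\mathbb R^d)\cap DC(\mathbb R,\mathbb R^d)\cap W^{2,1}_{\mathrm{loc}}(\mathbb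 R,\mathbb R^d).$$ 2. If $A$ is additionally of class $C^1$, then there exists a differentiable (thus $C^1$) system $\lambda=(\lambda_1,\dots,\lambda_d)$ of the eigenvalues of $A$. 3. The result is uniform in the following sense. Let $I\subseteq\mathbb R$ be a nonempty bounded open interval, let $k\ge 0$, and let $U$ be an open neighborhood of the closure of $I^{1+k}$ in $\mathbb R^{1+k}$. Suppose that $A:U\to\operatorname{Herm}(d)$ is such that - $A$ is locally $DC$ on $U$, - $A(\cdot,r)\in C^1(\overline I,\operatorname{Herm}(d))\cap W^{2,1}(I,\operatorname{Herm}(d))$ for all $r\in\overline I^{\,k}$. Assume that, for each $r\in\overline I^{\,k}$, a $C^1$-system $\lambda(\cdot,r)$ on $\overline I$ of the eigenvalues of $A(\cdot,r)$ is fixed. Then the family $\lambda(\cdot,r)$, $r\in\overline I^{\,k}$, is bounded in $C^1(\overline I,\mathbb R^d)$, and there is a non-negative $L^1$-function $m:I^k\to\mathbb R_{\ge 0}$ such that $$\|\lambda(\cdot,r)\|_{W^{2,1}(I,\mathbb R^d)}\le m(r)\quad\text{for a.e. } r\in I^k.$$ -/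

import Mathlib

open scoped ContDiff

/-- `f` is difference-convex (DC) on the convex set `U`: on `U` it is the difference of two
continuous convex functions (`ConvexOn` contains the convexity of `U`). -/
def DCOn {E : Type*} [AddCommGroup E] [Module ℝ E] [TopologicalSpace E]
    (U : Set E) (f : E → ℝ) : Prop :=
  ∃ g h : E → ℝ, ContinuousOn g U ∧ ConvexOn ℝ U g ∧ ContinuousOn h U ∧ ConvexOn ℝ U h ∧
    ∀ x ∈ U, f x = g x - h x

/-- `f` is locally difference-convex on `U`: each point of `U` has a convex neighborhood (in `U`)
on which `f` is difference-convex. -/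
def LocallyDCOn {E : Type*} [AddCommGroup E] [Module ℝ E] [TopologicalSpace E]
    (U : Set E) (f : E → ℝ) : Prop :=
  ∀ x ∈ U, ∃ V ∈ nhdsWithin x U, V ⊆ U ∧ Convex ℝ V ∧ DCOn V f

/-- On the open set `Ω ⊆ ℝ`, the locally integrable function `v` is the weak (distributional)
derivative of order `n` of the locally integrable function `u`. -/
def HasWeakDeriv (n : ℕ) (Ω : Set ℝ) (u v : ℝ → ℝ) : Prop :=
  MeasureTheory.LocallyIntegrableOn u Ω ∧ MeasureTheory.LocallyIntegrableOn v Ω ∧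
    ∀ φ : ℝ → ℝ, ContDiff ℝ ∞ φ → HasCompactSupport φ → tsupport φ ⊆ Ω →
      ∫ x in Ω, u x * iteratedDeriv n φ x = (-1) ^ n * ∫ x in Ω, v x * φ x

/-- The Sobolev class `W^{2,1}(Ω)` on an open set `Ω ⊆ ℝ`. -/
def MemW21 (Ω : Set ℝ) (u : ℝ → ℝ) : Prop :=
  ∃ v w : ℝ → ℝ, HasWeakDeriv 1 Ω u v ∧ HasWeakDeriv 2 Ω u w ∧
    MeasureTheory.IntegrableOn u Ω ∧ MeasureTheory.IntegrableOn v Ω ∧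
      MeasureTheory.IntegrableOn w Ω

/-- The local Sobolev class `W^{2,1}_loc(Ω)` on an open set `Ω ⊆ ℝ`: the function and its weak
derivatives up to order two are locally integrable (which `HasWeakDeriv` contains). -/
def MemW21Loc (Ω : Set ℝ) (u : ℝ → ℝ) : Prop :=
  ∃ v w : ℝ → ℝ, HasWeakDeriv 1 Ω u v ∧ HasWeakDeriv 2 Ω u w

/-- The Sobolev norm `‖u‖_{L¹(Ω)} + ‖u'‖_{L¹(Ω)} + ‖u''‖_{L¹(Ω)}` on an open set `Ω ⊆ ℝ`, with values
in `[0, ∞]`. Weak derivatives are unique up to null sets, so the infimum is over equal values; it is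
`∞` if the weak derivatives do not exist, so that the norm is finite exactly on `W^{2,1}(Ω)`. -/
noncomputable def W21norm (Ω : Set ℝ) (u : ℝ → ℝ) : ENNReal :=
  ⨅ (v : ℝ → ℝ) (w : ℝ → ℝ) (_ : HasWeakDeriv 1 Ω u v ∧ HasWeakDeriv 2 Ω u w),
    (∫⁻ x in Ω, ‖u x‖ₑ) + (∫⁻ x in Ω, ‖v x‖ₑ) + ∫⁻ x in Ω, ‖w x‖ₑ

/-- A matrix-valued map belongs to a class `P` of real functions if all its components, that is, the
real and imaginary parts of its entries, do. -/
def Componentwise {X : Type*} {d : ℕ} (P : (X → ℝ) → Prop)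
    (A : X → Matrix (Fin d) (Fin d) ℂ) : Prop :=
  ∀ i j, P (fun x => (A x i j).re) ∧ P (fun x => (A x i j).im)

/-- `v` lists the eigenvalues of `M`, with multiplicities and in some order. -/
def IsEigenvalueTuple {d : ℕ} (M : Matrix (Fin d) (Fin d) ℂ) (v : Fin d → ℝ) : Prop :=
  M.charpoly = ∏ j, (Polynomial.X - Polynomial.C (v j : ℂ))

/-! Everything rests on first order perturbation theory at a point. Eigenbases of `A t` lie in a
compact group, so they converge along ultrafilters `t → t₀`; the limit diagonalizes `A t₀` together
with the compressions of `A' t₀` to its eigenspaces, and the compressed eigenvalues are the limits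
of the difference quotients (`exists_limit_diagonalizesJet`). Hence the unordered tuple of pairs
(eigenvalue, derivative) is determined by the pair of `A t` and `A' t`. For a `C¹` curve this tuple
varies continuously, and a continuous parameterization of it (`exists_continuous_selection`) is a
`C¹` system.

For the second order regularity let `W` dominate the variation of `A'`, let `Ψ` be a second
primitive of `W`, and consider the sum of all `|λ_i - λ_l|`, the spread. The spread plus `e λ_j`,
`|e| ≤ 1`, is a weighted sum of eigenvalues with weights ordered like the eigenvalues. By Birkhoff
and rearrangement it is at least the same weighted sum of the diagonal entries of `A t` in any
orthonormal basis. With an eigenbasis at `t₀` those entries are the first order Taylor polynomials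
up to the Taylor remainder of `Ψ`. So spread + `e λ_j` + const · `Ψ` has a line of support at every
point and is convex (`convexOn_spread_add`). Taking `e = ±1` shows that `λ_j` is DC, and the right
derivative of spread + const · `Ψ` is one monotone majorant for the variation of all `λ_j'`
(`exists_majorant`).

Bounded variation of `λ_j'` becomes absolute continuity by the Banach-Zarecki theorem once `λ_j'`
maps null sets to null sets. Sort the points by the set `S` of indices whose eigenvalue equals `λ_j`
there. Isolated points of such a class are countable in number. At an accumulation point all `λ_i'`,
`i ∈ S`, agree, so `λ_j'` is the mean of the derivatives over the cluster; the sum of a separated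
cluster is, up to a quadratic error, the trace of a fixed compression of `A`, so its derivative is
locally dominated by an integral (`exists_local_domination`).

All these bounds are explicit in terms of bounds for `A`, `A'` in the sup norm and `A''` in `L¹`. A
locally DC function has such bounds uniformly on its slices over a compact set, since near each
point it is a difference of Lipschitz convex functions (`LocallyDCOn.exists_slice_bound`). This
gives the uniform statement, with constant `m`. -/

/-- The unitary matrix `U` diagonalizes `A`, with the eigenvalue `v j` belonging to the column `j`. -/
def Diagonalizes {d : ℕ} (U A : Matrix (Fin d) (Fin d) ℂ) (v : Fin d → ℝ) : Prop :=
  U.conjTranspose * U = 1 ∧ A * U = U * Matrix.diagonal (fun j => (v j : ℂ))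

/-- The columns of `U` are an eigenbasis of `A` which diagonalizes the compressions of `B` to the
eigenspaces of `A`; these have the eigenvalues `m`. -/
def DiagonalizesJet {d : ℕ} (U A B : Matrix (Fin d) (Fin d) ℂ) (v m : Fin d → ℝ) : Prop :=
  Diagonalizes U A v ∧
    ∀ i j, v i = v j → (U.conjTranspose * B * U) i j = if i = j then (m i : ℂ) else 0

/-! ### Eigenbases of a Hermitian matrix and of a first order jet -/

section LinearAlgebra

open Matrix Filter Topology

variable {d : ℕ} {U V A B : Matrix (Fin d) (Fin d) ℂ} {v w m n : Fin d → ℝ}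

theorem Diagonalizes.mul_conjTranspose (h : Diagonalizes U A v) : U * Uᴴ = 1 :=
  mul_eq_one_comm.mp h.1

theorem Diagonalizes.conjTranspose_mul_mul (h : Diagonalizes U A v) :
    Uᴴ * A * U = diagonal (fun j => (v j : ℂ)) := by
  rw [Matrix.mul_assoc, h.2, ← Matrix.mul_assoc, h.1, Matrix.one_mul]

theorem Diagonalizes.conjTranspose_mul (h : Diagonalizes U A v) :
    Uᴴ * A = diagonal (fun j => (v j : ℂ)) * Uᴴ := by
  rw [← h.conjTranspose_mul_mul, Matrix.mul_assoc, h.mul_conjTranspose, Matrix.mul_one]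

theorem Diagonalizes.isEigenvalueTuple (h : Diagonalizes U A v) : IsEigenvalueTuple A v := by
  have hA : A = U * (diagonal (fun j => (v j : ℂ)) * Uᴴ) := by
    rw [← h.conjTranspose_mul, ← Matrix.mul_assoc, h.mul_conjTranspose, Matrix.one_mul]
  unfold IsEigenvalueTuple
  rw [hA, charpoly_mul_comm, Matrix.mul_assoc, h.1, Matrix.mul_one, charpoly_diagonal]

theorem exists_diagonalizes_eigenvalues (hA : A.IsHermitian) :
    ∃ U, Diagonalizes U A hA.eigenvalues := by
  refine ⟨(hA.eigenvectorUnitary : Matrix (Fin d) (Fin d) ℂ), ?_, ?_⟩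
  · exact Unitary.coe_star_mul_self hA.eigenvectorUnitary
  · have h : A = (hA.eigenvectorUnitary : Matrix (Fin d) (Fin d) ℂ) *
        diagonal (fun j => (hA.eigenvalues j : ℂ)) * star _ := hA.spectral_theorem
    calc _ = ((hA.eigenvectorUnitary : Matrix (Fin d) (Fin d) ℂ) *
        diagonal (fun j => (hA.eigenvalues j : ℂ)) * star _) * hA.eigenvectorUnitary :=
          congrArg (· * (hA.eigenvectorUnitary : Matrix (Fin d) (Fin d) ℂ)) h
      _ = _ := by rw [Matrix.mul_assoc, Unitary.coe_star_mul_self, Matrix.mul_one]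

/-- Equal multisets of values have fibres of equal cardinality, and bijections between the fibres
glue to a permutation. -/
theorem exists_perm_of_map_univ_eq {α β : Type*} [Fintype α] [DecidableEq β] {f g : α → β}
    (h : Multiset.map f Finset.univ.val = Multiset.map g Finset.univ.val) :
    ∃ σ : Equiv.Perm α, f = g ∘ σ := by
  classical
  have hc : ∀ c, Nonempty ({a // f a = c} ≃ {a // g a = c}) := fun c => by
    refine ⟨Fintype.equivOfCardEq ?_⟩
    have := congrArg (Multiset.count c) h
    rw [Multiset.count_map, Multiset.count_map] at this
    simpa [Fintype.card_subtype, eq_comm, Finset.card_def] using this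
  have e := fun c => (hc c).some
  exact ⟨Equiv.ofFiberEquiv e, funext fun a => (Equiv.ofFiberEquiv_map e a).symm⟩

theorem Diagonalizes.comp_perm (h : Diagonalizes U A v) (σ : Equiv.Perm (Fin d)) :
    Diagonalizes (U.submatrix id σ) A (v ∘ σ) := by
  constructor
  · rw [conjTranspose_submatrix, ← submatrix_mul _ _ _ _ _ Function.bijective_id, h.1]
    simp
  · have h1 : A * U.submatrix id σ = (A * U).submatrix id σ := by
      ext i j; simp [Matrix.mul_apply]
    rw [h1, h.2]
    ext i j
    simp [Matrix.mul_diagonal]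

theorem IsEigenvalueTuple.exists_perm (hv : IsEigenvalueTuple A v) (hw : IsEigenvalueTuple A w) :
    ∃ σ : Equiv.Perm (Fin d), v = w ∘ σ := by
  have h : (∏ j, (Polynomial.X - Polynomial.C (v j : ℂ))) =
      ∏ j, (Polynomial.X - Polynomial.C (w j : ℂ)) := hv.symm.trans hw
  have key : ∀ u : Fin d → ℝ, (∏ j, (Polynomial.X - Polynomial.C (u j : ℂ))).roots =
      Multiset.map (fun j => (u j : ℂ)) Finset.univ.val := fun u => by
    have := Polynomial.roots_multiset_prod_X_sub_C
      (Multiset.map (fun j => (u j : ℂ)) Finset.univ.val)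
    rw [Multiset.map_map] at this
    exact this
  have h2 : Multiset.map (fun j => (v j : ℂ)) Finset.univ.val =
      Multiset.map (fun j => (w j : ℂ)) Finset.univ.val := by
    rw [← key v, ← key w, h]
  obtain ⟨σ, hσ⟩ := exists_perm_of_map_univ_eq h2
  refine ⟨σ, funext fun j => ?_⟩
  have := congrFun hσ j
  simpa using this

theorem IsEigenvalueTuple.exists_diagonalizes (hA : A.IsHermitian) (hv : IsEigenvalueTuple A v) :
    ∃ U, Diagonalizes U A v := by
  obtain ⟨U, hU⟩ := exists_diagonalizes_eigenvalues hA
  obtain ⟨σ, rfl⟩ := hv.exists_perm hU.isEigenvalueTuple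
  exact ⟨_, hU.comp_perm σ⟩

theorem DiagonalizesJet.re_diag (h : DiagonalizesJet U A B v m) (j : Fin d) :
    ((Uᴴ * B * U) j j).re = m j := by
  rw [h.2 j j rfl]; simp

theorem norm_entry_le_one (hU : Uᴴ * U = 1) (i j : Fin d) : ‖U i j‖ ≤ 1 :=
  entry_norm_bound_of_unitary (mem_unitaryGroup_iff'.mpr hU) i j

theorem isCompact_unitary (d : ℕ) :
    IsCompact {U : Matrix (Fin d) (Fin d) ℂ | Uᴴ * U = 1} := by
  have hK : IsCompact (Set.univ.pi fun _ : Fin d => Set.univ.pi fun _ : Fin d =>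
      Metric.closedBall (0 : ℂ) 1) :=
    isCompact_univ_pi fun _ => isCompact_univ_pi fun _ => isCompact_closedBall _ _
  refine IsCompact.of_isClosed_subset (s := (Set.univ.pi fun _ : Fin d => Set.univ.pi
    fun _ : Fin d => Metric.closedBall (0 : ℂ) 1)) hK ?_ ?_
  · have hc : Continuous fun U : Matrix (Fin d) (Fin d) ℂ => Uᴴ * U :=
      continuous_id.matrix_conjTranspose.matrix_mul continuous_id
    exact isClosed_eq hc continuous_const
  · intro U hU i _ j _
    simpa using norm_entry_le_one hU i j

/-- Eigenvalue-derivative pairs of different eigenbases agree where the bases are not orthogonal. -/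
theorem DiagonalizesJet.eq_of_ne_zero (hU : DiagonalizesJet U A B v m)
    (hV : DiagonalizesJet V A B w n) {i j : Fin d} (h : (Uᴴ * V) i j ≠ 0) :
    v i = w j ∧ m i = n j := by
  have key : ∀ i j, (Uᴴ * V) i j ≠ 0 → v i = w j := fun i j h => by
    have e : Uᴴ * A * V = Uᴴ * (A * V) := Matrix.mul_assoc _ _ _
    rw [hU.1.conjTranspose_mul, Matrix.mul_assoc, hV.1.2, ← Matrix.mul_assoc Uᴴ] at e
    have e := congrFun (congrFun e i) j
    rw [diagonal_mul, mul_diagonal, mul_comm] at e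
    exact_mod_cast mul_left_cancel₀ h e
  have hvw := key i j h
  refine ⟨hvw, ?_⟩
  -- The overlap matrix intertwines the two compressions of `B`. In the entry `(i, j)` each sum
  -- collapses to one term: a nonzero overlap forces equal eigenvalues of `A`, and within one
  -- eigenspace the compression of `B` is diagonal.
  have e : Uᴴ * B * U * (Uᴴ * V) = Uᴴ * V * (Vᴴ * B * V) := by
    calc _ = Uᴴ * B * (U * Uᴴ) * V := by simp only [Matrix.mul_assoc]
      _ = Uᴴ * (V * Vᴴ) * B * V := by
        rw [hU.1.mul_conjTranspose, hV.1.mul_conjTranspose]; simp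
      _ = _ := by simp only [Matrix.mul_assoc]
  have e := congrFun (congrFun e i) j
  rw [Matrix.mul_apply, Matrix.mul_apply, Finset.sum_eq_single i, Finset.sum_eq_single j,
    hU.2 i i rfl, hV.2 j j rfl, if_pos rfl, if_pos rfl, mul_comm] at e
  · exact_mod_cast mul_left_cancel₀ h e
  · intro k _ hk
    by_cases h0 : (Uᴴ * V) i k = 0
    · rw [h0, zero_mul]
    · rw [hV.2 k j ((key i k h0).symm.trans hvw), if_neg hk, mul_zero]
  · simp
  · intro k _ hk
    by_cases h0 : (Uᴴ * V) k j = 0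
    · rw [h0, mul_zero]
    · rw [hU.2 i k (hvw.trans (key k j h0).symm), if_neg hk.symm, zero_mul]
  · simp

/-- The overlap matrix of the two bases is invertible, so some term of the Leibniz expansion of its
determinant is nonzero. Its permutation meets only nonzero overlaps, where the pairs coincide. -/
theorem DiagonalizesJet.exists_perm (hU : DiagonalizesJet U A B v m)
    (hV : DiagonalizesJet V A B w n) :
    ∃ σ : Equiv.Perm (Fin d), ∀ j, w j = v (σ j) ∧ n j = m (σ j) := by
  have hW : (Uᴴ * V).det ≠ 0 := by
    have : Uᴴ * V * (Vᴴ * U) = 1 := by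
      calc _ = Uᴴ * (V * Vᴴ) * U := by simp only [Matrix.mul_assoc]
        _ = 1 := by rw [hV.1.mul_conjTranspose, Matrix.mul_one, hU.1.1]
    exact ((isUnit_iff_isUnit_det _).mp (IsUnit.of_mul_eq_one _ this)).ne_zero
  rw [det_apply] at hW
  obtain ⟨σ, -, hσ⟩ := Finset.exists_ne_zero_of_sum_ne_zero hW
  refine ⟨σ, fun j => ?_⟩
  have h0 : (Uᴴ * V) (σ j) j ≠ 0 := fun h0 => hσ (by
    rw [Finset.prod_eq_zero (f := fun i => (Uᴴ * V) (σ i) i) (Finset.mem_univ j) h0, smul_zero])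
  obtain ⟨h1, h2⟩ := hU.eq_of_ne_zero hV h0
  exact ⟨h1.symm, h2.symm⟩

theorem matrix_tendsto_of_entries {ι : Type*} {l : Filter ι} {M : ι → Matrix (Fin d) (Fin d) ℂ}
    {N : Matrix (Fin d) (Fin d) ℂ} (h : ∀ i j, Tendsto (fun t => M t i j) l (𝓝 (N i j))) :
    Tendsto M l (𝓝 N) :=
  tendsto_pi_nhds.mpr fun i => tendsto_pi_nhds.mpr fun j => h i j

theorem matrix_tendsto_entry {ι : Type*} {l : Filter ι} {M : ι → Matrix (Fin d) (Fin d) ℂ}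
    {N : Matrix (Fin d) (Fin d) ℂ} (h : Tendsto M l (𝓝 N)) (i j : Fin d) :
    Tendsto (fun t => M t i j) l (𝓝 (N i j)) :=
  tendsto_pi_nhds.mp (tendsto_pi_nhds.mp h i) j

theorem matrix_tendsto_mul {ι : Type*} {l : Filter ι} {M M' : ι → Matrix (Fin d) (Fin d) ℂ}
    {N N' : Matrix (Fin d) (Fin d) ℂ} (h : Tendsto M l (𝓝 N)) (h' : Tendsto M' l (𝓝 N')) :
    Tendsto (fun t => M t * M' t) l (𝓝 (N * N')) := by
  refine matrix_tendsto_of_entries fun i j => ?_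
  simp only [Matrix.mul_apply]
  exact tendsto_finsetSum _ fun k _ => (matrix_tendsto_entry h i k).mul (matrix_tendsto_entry h' k j)

theorem matrix_tendsto_conjTranspose {ι : Type*} {l : Filter ι}
    {M : ι → Matrix (Fin d) (Fin d) ℂ} {N : Matrix (Fin d) (Fin d) ℂ} (h : Tendsto M l (𝓝 N)) :
    Tendsto (fun t => (M t)ᴴ) l (𝓝 Nᴴ) :=
  ((continuous_id.matrix_conjTranspose).tendsto N).comp h

/-- Limits of eigenbases of a differentiable curve diagonalize its jet, and the eigenvalues have
the corresponding first order expansion. -/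
theorem exists_limit_diagonalizesJet {A : ℝ → Matrix (Fin d) (Fin d) ℂ} {t₀ : ℝ}
    (hA : ∀ i j, HasDerivAt (fun t => A t i j) (B i j) t₀)
    (G : Ultrafilter ℝ) (hG : (G : Filter ℝ) ≤ 𝓝[≠] t₀)
    {U : ℝ → Matrix (Fin d) (Fin d) ℂ} {v : ℝ → Fin d → ℝ}
    (hU : ∀ᶠ t in G, Diagonalizes (U t) (A t) (v t)) :
    ∃ (U₀ : Matrix (Fin d) (Fin d) ℂ) (c m : Fin d → ℝ), DiagonalizesJet U₀ (A t₀) B c m ∧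
      Tendsto U G (𝓝 U₀) ∧ (∀ j, Tendsto (fun t => v t j) G (𝓝 (c j))) ∧
      ∀ j, Tendsto (fun t => (v t j - c j) / (t - t₀)) G (𝓝 (m j)) := by
  have hG0 : (G : Filter ℝ) ≤ 𝓝 t₀ := hG.trans nhdsWithin_le_nhds
  have hne : ∀ᶠ t in (G : Filter ℝ), t ≠ t₀ := hG self_mem_nhdsWithin
  obtain ⟨U₀, hU₀, hlim⟩ := (isCompact_unitary d).ultrafilter_le_nhds' (G.map U)
    (hU.mono fun t ht => ht.1)
  have hUl : Tendsto U G (𝓝 U₀) := hlim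
  have hAl : Tendsto A G (𝓝 (A t₀)) := matrix_tendsto_of_entries fun i j =>
    ((hA i j).continuousAt.tendsto).mono_left hG0
  have hDl : Tendsto (fun t => (U t)ᴴ * A t * U t) G (𝓝 (U₀ᴴ * A t₀ * U₀)) :=
    matrix_tendsto_mul (matrix_tendsto_mul (matrix_tendsto_conjTranspose hUl) hAl) hUl
  set c : Fin d → ℝ := fun j => ((U₀ᴴ * A t₀ * U₀) j j).re with hc
  have hvl : ∀ j, Tendsto (fun t => v t j) G (𝓝 (c j)) := fun j => by
    refine ((Complex.continuous_re.tendsto _).comp (matrix_tendsto_entry hDl j j)).congr' ?_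
    filter_upwards [hU] with t ht
    simp [ht.conjTranspose_mul_mul]
  have hdiag : Diagonalizes U₀ (A t₀) c := by
    refine ⟨hU₀, ?_⟩
    have h1 : Tendsto (fun t => A t * U t) G (𝓝 (A t₀ * U₀)) := matrix_tendsto_mul hAl hUl
    have h2 : Tendsto (fun t => U t * diagonal (fun j => (v t j : ℂ))) G
        (𝓝 (U₀ * diagonal (fun j => (c j : ℂ)))) := by
      refine matrix_tendsto_mul hUl (matrix_tendsto_of_entries fun i j => ?_)
      by_cases hij : i = j
      · subst hij
        simpa [Function.comp_def] using (Complex.continuous_ofReal.tendsto _).comp (hvl i)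
      · simp [hij]
    exact tendsto_nhds_unique (h1.congr' (hU.mono fun t ht => ht.2)) h2
  have hVl : Tendsto (fun t => U₀ᴴ * U t) G (𝓝 1) := by
    rw [← hU₀]; exact matrix_tendsto_mul tendsto_const_nhds hUl
  have hBl : Tendsto (fun t => U₀ᴴ * (((t - t₀)⁻¹ : ℝ) • (A t - A t₀)) * U t) G
      (𝓝 (U₀ᴴ * B * U₀)) := by
    refine matrix_tendsto_mul (matrix_tendsto_mul tendsto_const_nhds (matrix_tendsto_of_entries fun i j => ?_)) hUl
    have := (hasDerivAt_iff_tendsto_slope.mp (hA i j)).mono_left hG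
    simpa [slope_fun_def] using this
  -- Sandwiching `A t - A t₀` between a limit eigenvector and an eigenvector at `t` produces the
  -- eigenvalue difference times the overlap. Since the overlaps tend to the identity matrix, the
  -- diagonal entries give convergence of the quotients.
  have hBe : ∀ᶠ t in (G : Filter ℝ), ∀ i j, (U₀ᴴ * (((t - t₀)⁻¹ : ℝ) • (A t - A t₀)) * U t) i j =
      (((v t j - c i) / (t - t₀) : ℝ) : ℂ) * (U₀ᴴ * U t) i j := by
    filter_upwards [hU] with t ht i j
    have e : U₀ᴴ * (A t - A t₀) * U t = U₀ᴴ * U t * diagonal (fun j => (v t j : ℂ)) -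
        diagonal (fun j => (c j : ℂ)) * (U₀ᴴ * U t) := by
      rw [Matrix.mul_sub, Matrix.sub_mul, hdiag.conjTranspose_mul, Matrix.mul_assoc, ht.2,
        Matrix.mul_assoc, Matrix.mul_assoc]
    rw [Matrix.mul_smul, Matrix.smul_mul, e]
    simp only [Matrix.smul_apply, Matrix.sub_apply, mul_diagonal, diagonal_mul, Complex.real_smul]
    push_cast
    ring
  have hq : ∀ j, Tendsto (fun t => (v t j - c j) / (t - t₀)) G (𝓝 ((U₀ᴴ * B * U₀) j j).re) := by
    intro j
    have h1 := matrix_tendsto_entry hVl j j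
    rw [one_apply_eq] at h1
    have h2 : Tendsto (fun t => (((v t j - c j) / (t - t₀) : ℝ) : ℂ)) G
        (𝓝 ((U₀ᴴ * B * U₀) j j)) := by
      have h3 := (matrix_tendsto_entry hBl j j).div h1 one_ne_zero
      rw [div_one] at h3
      refine h3.congr' ?_
      filter_upwards [hBe, h1.eventually_ne one_ne_zero] with t ht h0
      simp only [Pi.div_apply]
      rw [ht, mul_div_assoc, div_self h0, mul_one]
    exact (Complex.continuous_re.tendsto _).comp h2
  refine ⟨U₀, c, fun j => ((U₀ᴴ * B * U₀) j j).re, ⟨hdiag, fun i j hij => ?_⟩, hUl, hvl, hq⟩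
  -- Inside one eigenspace `c i = c j`, so the entry `(i, j)` is the convergent quotient of index
  -- `j` times an overlap that tends to `0` off the diagonal.
  have h1 : Tendsto (fun t => (((v t j - c j) / (t - t₀) : ℝ) : ℂ) * (U₀ᴴ * U t) i j) G
      (𝓝 ((((U₀ᴴ * B * U₀) j j).re : ℂ) * (1 : Matrix (Fin d) (Fin d) ℂ) i j)) :=
    ((Complex.continuous_ofReal.tendsto _).comp (hq j)).mul (matrix_tendsto_entry hVl i j)
  have h2 := (matrix_tendsto_entry hBl i j).congr' (hBe.mono fun t ht => by rw [ht i j, hij])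
  rw [tendsto_nhds_unique h2 h1]
  by_cases h : i = j
  · subst h; simp
  · simp [h]

/-- The segment `A + t • B` realizes the jet, and a limit of its eigenbases as `t → 0` is as
required. -/
theorem exists_diagonalizesJet (hA : A.IsHermitian) (hB : B.IsHermitian) :
    ∃ U v m, DiagonalizesJet U A B v m := by
  have hH : ∀ t : ℝ, (A + t • B).IsHermitian := fun t => by
    refine hA.add ?_
    rw [IsHermitian, conjTranspose_smul, hB, star_trivial]
  choose U hU using fun t => exists_diagonalizes_eigenvalues (hH t)
  obtain ⟨U₀, c, m, h, -⟩ := exists_limit_diagonalizesJet (A := fun t : ℝ => A + t • B) (B := B)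
    (t₀ := 0) (fun i j => by
      simpa using ((hasDerivAt_id (0 : ℝ)).smul_const (B i j)).const_add (A i j)) (Ultrafilter.of (𝓝[≠] 0)) (Ultrafilter.of_le _)
    (U := U) (v := fun t => (hH t).eigenvalues) (Filter.Eventually.of_forall hU)
  exact ⟨U₀, c, m, by simpa using h⟩

end LinearAlgebra

/-! ### Differentiable eigenvalue systems and their jets -/

section DifferentiableSystems

open Matrix Filter Topology

variable {d : ℕ} {A A' : ℝ → Matrix (Fin d) (Fin d) ℂ} {ev ev' : Fin d → ℝ → ℝ}

/-- A differentiable system of eigenvalues and its derivatives come from one eigenbasis. -/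
theorem exists_diagonalizesJet_of_hasDerivAt {t₀ : ℝ} {B : Matrix (Fin d) (Fin d) ℂ}
    {e' : Fin d → ℝ}
    (hA : ∀ i j, HasDerivAt (fun t => A t i j) (B i j) t₀)
    (hd : ∀ᶠ t in 𝓝 t₀, ∃ U, Diagonalizes U (A t) (fun j => ev j t))
    (hev : ∀ j, HasDerivAt (ev j) (e' j) t₀) :
    ∃ U, DiagonalizesJet U (A t₀) B (fun j => ev j t₀) e' := by
  obtain ⟨G, hG⟩ := Ultrafilter.exists_le (𝓝[≠] t₀)
  have hG0 : (G : Filter ℝ) ≤ 𝓝 t₀ := hG.trans nhdsWithin_le_nhds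
  choose! U hU using fun t (h : ∃ U, Diagonalizes U (A t) (fun j => ev j t)) => h
  obtain ⟨U₀, c, m, h, -, hc, hm⟩ := exists_limit_diagonalizesJet hA G hG (U := U)
    (v := fun t j => ev j t) ((hd.filter_mono hG0).mono fun t ht => hU t ht)
  have hc' : c = fun j => ev j t₀ := funext fun j =>
    tendsto_nhds_unique (hc j) ((hev j).continuousAt.tendsto.mono_left hG0)
  subst hc'
  have hm' : m = e' := funext fun j => by
    refine tendsto_nhds_unique (hm j) (((hasDerivAt_iff_tendsto_slope.mp (hev j)).mono_left
      hG).congr fun t => ?_)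
    rw [slope_def_field]
  subst hm'
  exact ⟨U₀, h⟩

/-- The derivatives of a differentiable system of eigenvalues of a `C¹` curve are continuous. -/
theorem continuousAt_deriv_of_diagonalizesJet {t₀ : ℝ}
    (hA : ∀ i j, HasDerivAt (fun t => A t i j) (A' t₀ i j) t₀)
    (hA' : ∀ i j, ContinuousAt (fun t => A' t i j) t₀)
    (hd : ∀ᶠ t in 𝓝 t₀, ∃ U, DiagonalizesJet U (A t) (A' t) (fun j => ev j t) (fun j => ev' j t))
    (hev : ∀ j, HasDerivAt (ev j) (ev' j t₀) t₀) (j : Fin d) :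
    ContinuousAt (ev' j) t₀ := by
  rw [continuousAt_iff_punctured_nhds, tendsto_iff_ultrafilter]
  intro G hG
  have hG0 : (G : Filter ℝ) ≤ 𝓝 t₀ := hG.trans nhdsWithin_le_nhds
  choose! U hU using fun t (h : ∃ U, DiagonalizesJet U (A t) (A' t) (fun j => ev j t)
    (fun j => ev' j t)) => h
  have hUG : ∀ᶠ t in (G : Filter ℝ), DiagonalizesJet (U t) (A t) (A' t) (fun j => ev j t)
    (fun j => ev' j t) := (hd.filter_mono hG0).mono fun t ht => hU t ht
  obtain ⟨U₀, c, m, h, hl, hc, hm⟩ := exists_limit_diagonalizesJet hA G hG (U := U)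
    (v := fun t j => ev j t) (hUG.mono fun t ht => ht.1)
  have hc' : c = fun j => ev j t₀ := funext fun j =>
    tendsto_nhds_unique (hc j) ((hev j).continuousAt.tendsto.mono_left hG0)
  subst hc'
  have hm' : m j = ev' j t₀ := by
    refine tendsto_nhds_unique (hm j) (((hasDerivAt_iff_tendsto_slope.mp (hev j)).mono_left
      hG).congr fun t => ?_)
    rw [slope_def_field]
  have hAl : Tendsto A' G (𝓝 (A' t₀)) := matrix_tendsto_of_entries fun i j =>
    (hA' i j).tendsto.mono_left hG0
  -- At each `t` the derivative is a diagonal entry of `A' t` in an eigenbasis. These bases converge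
  -- along `G`, and in the limit basis that entry is the limit of difference quotients at `t₀`.
  have hlim := (Complex.continuous_re.tendsto _).comp (matrix_tendsto_entry
    (matrix_tendsto_mul (matrix_tendsto_mul (matrix_tendsto_conjTranspose hl) hAl) hl) j j)
  rw [h.re_diag, hm'] at hlim
  exact hlim.congr' (hUG.mono fun t ht => ht.re_diag j)

end DifferentiableSystems

/-! ### Continuous parameterization of curves of unordered tuples -/

section PathLifting

open Filter Topology

variable {d : ℕ} {E : Type*} [PseudoMetricSpace E]

theorem exists_bestMatch (x y : Fin d → E) :
    ∃ σ : Equiv.Perm (Fin d), ∀ τ : Equiv.Perm (Fin d), dist x (y ∘ σ) ≤ dist x (y ∘ τ) :=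
  Finite.exists_min _

/-- A permutation which matches the tuples `x` and `y` with the least possible distance. -/
noncomputable def bestMatch (x y : Fin d → E) : Equiv.Perm (Fin d) := (exists_bestMatch x y).choose

theorem dist_bestMatch_le (x y : Fin d → E) (τ : Equiv.Perm (Fin d)) :
    dist x (y ∘ bestMatch x y) ≤ dist x (y ∘ τ) :=
  (exists_bestMatch x y).choose_spec τ

/-- Follow a curve of unordered tuples along a sequence of times, matching each tuple optimally
with the one before. -/
noncomputable def greedyPath (x : ℝ → Fin d → E) (s : ℕ → ℝ) : ℕ → Fin d → E
  | 0 => x (s 0)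
  | k + 1 => x (s (k + 1)) ∘ bestMatch (greedyPath x s k) (x (s (k + 1)))

theorem exists_greedyPath_eq (x : ℝ → Fin d → E) (s : ℕ → ℝ) (k : ℕ) :
    ∃ σ : Equiv.Perm (Fin d), greedyPath x s k = x (s k) ∘ σ := by
  cases k with
  | zero => exact ⟨1, rfl⟩
  | succ k => exact ⟨_, rfl⟩

/-- Finitely many positive distances have a positive lower bound. The conclusion is distance zero,
as `E` is only pseudometric. -/
theorem exists_separation (x : Fin d → E) :
    ∃ δ > 0, ∀ i j, dist (x i) (x j) < δ → dist (x i) (x j) = 0 := by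
  classical
  obtain ⟨δ, hδ, h⟩ : ∃ δ > 0, ∀ p : Fin d × Fin d, dist (x p.1) (x p.2) < δ →
      dist (x p.1) (x p.2) = 0 := by
    have : ∀ p : Fin d × Fin d, ∀ᶠ δ : ℝ in 𝓝[>] 0, dist (x p.1) (x p.2) < δ →
        dist (x p.1) (x p.2) = 0 := fun p => by
      rcases (dist_nonneg (x := x p.1) (y := x p.2)).eq_or_lt with h | h
      · exact Eventually.of_forall fun δ _ => h.symm
      · filter_upwards [Ioo_mem_nhdsGT h] with δ hδ h'
        exact absurd h' hδ.2.le.not_gt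
    have h := (eventually_all.mpr this).and self_mem_nhdsWithin
    obtain ⟨δ, h1, h2⟩ := h.exists
    exact ⟨δ, h2, h1⟩
  exact ⟨δ, hδ, fun i j => h (i, j)⟩

/-- As long as the tuples stay matched up to `η` with a fixed tuple, which is `4 * η`-separated, the
greedy path moves by at most `2 * η`. -/
theorem dist_greedyPath_le {x : ℝ → Fin d → E} {z : Fin d → E} {η : ℝ} (hη : 0 < η)
    (hz : ∀ i j, dist (z i) (z j) < 8 * η → dist (z i) (z j) = 0) {s : ℕ → ℝ} {k : ℕ} {l : ℕ}
    (h : ∀ i, k ≤ i → i ≤ k + l → ∃ σ : Equiv.Perm (Fin d), dist (x (s i)) (z ∘ σ) < η) :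
    dist (greedyPath x s k) (greedyPath x s (k + l)) < 2 * η := by
  have hσ : ∀ i, k ≤ i → i ≤ k + l → ∃ σ : Equiv.Perm (Fin d),
      dist (greedyPath x s i) (z ∘ σ) < η := fun i h1 h2 => by
    obtain ⟨σ, h⟩ := h i h1 h2
    obtain ⟨τ, hτ⟩ := exists_greedyPath_eq x s i
    refine ⟨σ * τ, ?_⟩
    rw [hτ, dist_pi_lt_iff hη]
    exact fun j => (dist_le_pi_dist (x (s i)) (z ∘ σ) (τ j)).trans_lt h
  obtain ⟨σ₀, h₀⟩ := hσ k le_rfl (Nat.le_add_right _ _)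
  have key : ∀ n ≤ l, dist (greedyPath x s (k + n)) (z ∘ σ₀) < η := by
    intro n
    induction n with
    | zero => exact fun _ => h₀
    | succ n ih =>
      intro hn
      have ih := ih (by omega)
      obtain ⟨σ, h1⟩ := hσ (k + (n + 1)) (by omega) (by omega)
      -- The greedy choice is at least as good as the competitor `τ⁻¹ * σ₀`, which places the next
      -- tuple within `η` of `z ∘ σ₀`.
      have hstep : dist (greedyPath x s (k + n)) (greedyPath x s (k + (n + 1))) < 2 * η := by
        obtain ⟨τ, hτ⟩ := h (k + (n + 1)) (by omega) (by omega)
        have hle : dist (greedyPath x s (k + n)) (greedyPath x s (k + (n + 1))) ≤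
          dist (greedyPath x s (k + n)) (x (s (k + (n + 1))) ∘ (τ⁻¹ * σ₀ : Equiv.Perm (Fin d))) :=
            dist_bestMatch_le _ _ _
        have : dist (x (s (k + (n + 1))) ∘ (τ⁻¹ * σ₀ : Equiv.Perm (Fin d))) (z ∘ σ₀) < η := by
          rw [dist_pi_lt_iff hη]
          intro j
          have := (dist_le_pi_dist (x (s (k + (n + 1)))) (z ∘ τ) ((τ⁻¹ * σ₀) j)).trans_lt hτ
          simpa using this
        have := dist_triangle_right (greedyPath x s (k + n))
          (x (s (k + (n + 1))) ∘ (τ⁻¹ * σ₀ : Equiv.Perm (Fin d))) (z ∘ σ₀)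
        linarith
      rw [dist_pi_lt_iff hη] at ih h1 ⊢
      rw [dist_pi_lt_iff (by linarith)] at hstep
      intro j
      -- Three errors `η`, `2 * η`, `η` add up to less than the separation of `z`, so the new tuple
      -- is still near the same ordering.
      have h2 : dist (z (σ j)) (z (σ₀ j)) = 0 := by
        refine hz _ _ ?_
        have a := ih j
        have b := h1 j
        have c := hstep j
        simp only [Function.comp_apply] at a b
        have e1 := dist_triangle4 (z (σ j)) (greedyPath x s (k + (n + 1)) j)
          (greedyPath x s (k + n) j) (z (σ₀ j))
        rw [dist_comm (z (σ j)) (greedyPath x s (k + (n + 1)) j),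
          dist_comm (greedyPath x s (k + (n + 1)) j) (greedyPath x s (k + n) j)] at e1
        linarith
      have := dist_triangle (greedyPath x s (k + (n + 1)) j) (z (σ j)) (z (σ₀ j))
      have := h1 j
      simp only [Function.comp_apply] at this ⊢
      linarith
  have h1 := key l le_rfl
  have := dist_triangle_right (greedyPath x s k) (greedyPath x s (k + l)) (z ∘ σ₀)
  linarith

/-- A continuous curve of unordered tuples has a continuous parameterization. -/
theorem exists_continuous_selection (x : ℝ → Fin d → E)
    (hx : ∀ t₀, ∀ ε > 0, ∀ᶠ t in 𝓝 t₀, ∃ σ : Equiv.Perm (Fin d), dist (x t) (x t₀ ∘ σ) < ε) :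
    ∃ y : ℝ → Fin d → E, Continuous y ∧ ∀ t, ∃ σ : Equiv.Perm (Fin d), y t = x t ∘ σ := by
  -- The `n`-th grid starts at `-n` with mesh `1 / (n + 1)`; `κ n t` indexes the last grid point at
  -- or before `t`, once `-n ≤ t`.
  let s : ℕ → ℕ → ℝ := fun n k => -n + k * ((n : ℝ) + 1)⁻¹
  let κ : ℕ → ℝ → ℕ := fun n t => ⌊(t + n) * (n + 1)⌋₊
  have hs : ∀ t, ∀ ε > 0, ∀ᶠ n : ℕ in atTop, s n (κ n t) ≤ t ∧ t - ε < s n (κ n t) := by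
    intro t ε hε
    have h1 : ∀ᶠ n : ℕ in atTop, -t ≤ (n : ℝ) := (tendsto_natCast_atTop_atTop).eventually_ge_atTop _
    have h2 : ∀ᶠ n : ℕ in atTop, ε⁻¹ ≤ (n : ℝ) := (tendsto_natCast_atTop_atTop).eventually_ge_atTop _
    filter_upwards [h1, h2] with n h1 h2
    have hn : (0 : ℝ) < n + 1 := by positivity
    have h3 : 0 ≤ (t + n) * (n + 1) := mul_nonneg (by linarith) hn.le
    have h4 := Nat.floor_le h3
    have h5 := Nat.lt_floor_add_one ((t + n) * (n + 1))
    have h6 : (κ n t : ℝ) * ((n : ℝ) + 1)⁻¹ ≤ t + n := by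
      rw [← div_eq_mul_inv, div_le_iff₀ hn]; exact h4
    have h7 : t + n < (κ n t : ℝ) * ((n : ℝ) + 1)⁻¹ + ((n : ℝ) + 1)⁻¹ := by
      rw [← add_one_mul, ← div_eq_mul_inv, lt_div_iff₀ hn]; exact h5
    have h8 : ((n : ℝ) + 1)⁻¹ ≤ ε := inv_le_of_inv_le₀ hε (by linarith)
    exact ⟨by simp only [s]; linarith, by simp only [s]; linarith⟩
  let Y : ℕ → ℝ → Fin d → E := fun n t => greedyPath x (s n) (κ n t)
  -- There are finitely many permutations, so along an ultrafilter the matching at `t` is constant.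
  -- This replaces a choice of subsequences and works for all `t` at once.
  have hρ : ∀ t, ∃ ρ : Equiv.Perm (Fin d), ∀ᶠ n in (hyperfilter ℕ : Filter ℕ),
      bestMatch (Y n t) (x t) = ρ := fun t =>
    (Ultrafilter.eventually_exists_iff).mp (Eventually.of_forall fun n => ⟨_, rfl⟩)
  choose ρ hρ using hρ
  have hlim : ∀ t, ∀ ε > 0, ∀ᶠ n in (hyperfilter ℕ : Filter ℕ), dist (Y n t) (x t ∘ ρ t) < ε := by
    intro t ε hε
    obtain ⟨δ, hδ, h⟩ := Metric.eventually_nhds_iff.mp (hx t ε hε)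
    filter_upwards [hρ t, (hs t δ hδ).filter_mono Nat.hyperfilter_le_atTop] with n h1 h2
    rw [← h1]
    obtain ⟨σ, hσ⟩ := h (y := s n (κ n t)) (by
      rw [Real.dist_eq, abs_lt]; constructor <;> linarith [h2.1, h2.2])
    obtain ⟨τ, hτ⟩ := exists_greedyPath_eq x (s n) (κ n t)
    refine (dist_bestMatch_le _ _ (σ * τ)).trans_lt ?_
    simp only [Y]
    rw [hτ, dist_pi_lt_iff hε]
    exact fun j => (dist_le_pi_dist (x (s n (κ n t))) (x t ∘ σ) (τ j)).trans_lt hσ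
  refine ⟨fun t => x t ∘ ρ t, continuous_iff_continuousAt.mpr fun t₀ => ?_, fun t => ⟨ρ t, rfl⟩⟩
  rw [ContinuousAt, Metric.tendsto_nhds]
  intro ε hε
  obtain ⟨μ, hμ, hsep⟩ := exists_separation (x t₀)
  set η := min (ε / 8) (μ / 8) with hη
  have hη0 : 0 < η := by positivity
  have hη1 : 8 * η ≤ ε := by linarith [min_le_left (ε / 8) (μ / 8)]
  have hη2 : 8 * η ≤ μ := by linarith [min_le_right (ε / 8) (μ / 8)]
  obtain ⟨δ, hδ, h⟩ := Metric.eventually_nhds_iff.mp (hx t₀ η hη0)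
  have hmono : ∀ n, Monotone (s n) := fun n i j hij => by
    simp only [s]
    have : (i : ℝ) ≤ j := by exact_mod_cast hij
    gcongr
  -- Between the grid points of `t` and `t'` the greedy path moves by less than `2 * η`, and each
  -- endpoint contributes less than `η`.
  have hpath : ∀ t t', |t - t₀| < δ / 2 → |t' - t₀| < δ / 2 → t ≤ t' →
      dist (x t ∘ ρ t) (x t' ∘ ρ t') < ε := by
    intro t t' ht ht' htt
    have hh : ∀ᶠ n in (hyperfilter ℕ : Filter ℕ), dist (x t ∘ ρ t) (x t' ∘ ρ t') < ε := by
      filter_upwards [hlim t η hη0, hlim t' η hη0,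
        (hs t (δ / 2) (by positivity)).filter_mono Nat.hyperfilter_le_atTop,
        (hs t' (δ / 2) (by positivity)).filter_mono Nat.hyperfilter_le_atTop] with n h1 h2 h3 h4
      rw [abs_lt] at ht ht'
      have hκ : κ n t ≤ κ n t' := Nat.floor_mono (by gcongr)
      obtain ⟨l, hl⟩ := Nat.exists_eq_add_of_le hκ
      have := dist_greedyPath_le (x := x) (z := x t₀) hη0
        (fun i j hij => hsep i j (hij.trans_le hη2)) (s := s n) (k := κ n t) (l := l)
        (fun i hi hi' => h (by
          have a := hmono n hi
          have b := hmono n (hi'.trans hl.ge)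
          rw [Real.dist_eq, abs_lt]; constructor <;> linarith))
      rw [← hl] at this
      have e := dist_triangle4 (x t ∘ ρ t) (Y n t) (Y n t') (x t' ∘ ρ t')
      rw [dist_comm (x t ∘ ρ t) (Y n t)] at e
      simp only [Y] at e h1 h2
      linarith
    exact hh.exists.choose_spec
  filter_upwards [Metric.ball_mem_nhds t₀ (half_pos hδ)] with t ht
  rw [Metric.mem_ball, Real.dist_eq] at ht
  rcases le_total t t₀ with h | h
  · exact hpath t t₀ ht (by simpa using half_pos hδ) h
  · rw [dist_comm]
    exact hpath t₀ t (by simpa using half_pos hδ) ht h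

end PathLifting

/-! ### Existence of a `C¹` system for a `C¹` curve -/

section Existence

open Matrix Filter Topology

variable {d : ℕ} {A A' : ℝ → Matrix (Fin d) (Fin d) ℂ}

/-- The parameterization is applied to pairs (eigenvalue, compressed derivative), not to eigenvalues
alone: continuity of the second component makes branches cross with matching slopes. -/
theorem exists_contDiff_system (hH : ∀ t, (A t).IsHermitian) (hH' : ∀ t, (A' t).IsHermitian)
    (hA : ∀ t i j, HasDerivAt (fun s => A s i j) (A' t i j) t)
    (hA' : ∀ i j, Continuous (fun t => A' t i j)) :
    ∃ ev : Fin d → ℝ → ℝ, (∀ t, IsEigenvalueTuple (A t) (fun j => ev j t)) ∧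
      ∀ j, ContDiff ℝ 1 (ev j) := by
  choose U v m hU using fun t => exists_diagonalizesJet (hH t) (hH' t)
  let x : ℝ → Fin d → ℝ × ℝ := fun t j => (v t j, m t j)
  -- One permutation must give both closeness of the pairs and the first order expansion. If this
  -- failed frequently, an ultrafilter on the bad set would contradict the limit theorem and the
  -- uniqueness of the jet at `t₀`.
  have hx : ∀ t₀, ∀ ε > 0, ∀ᶠ t in 𝓝 t₀, ∃ σ : Equiv.Perm (Fin d), dist (x t) (x t₀ ∘ σ) < ε ∧
      ∀ j, |v t j - v t₀ (σ j) - m t₀ (σ j) * (t - t₀)| ≤ ε * |t - t₀| := by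
    intro t₀ ε hε
    rw [← nhdsNE_sup_pure, eventually_sup, eventually_pure]
    refine ⟨?_, 1, by simpa using hε, by simp⟩
    by_contra hcon
    rw [not_eventually] at hcon
    have hne := frequently_iff_neBot.mp hcon
    obtain ⟨G, hG⟩ := @Ultrafilter.exists_le _ _ hne
    have hG1 : (G : Filter ℝ) ≤ 𝓝[≠] t₀ := hG.trans inf_le_left
    have hG0 : (G : Filter ℝ) ≤ 𝓝 t₀ := hG1.trans nhdsWithin_le_nhds
    have hG2 := hG.trans inf_le_right
    rw [le_principal_iff] at hG2
    obtain ⟨U₀, c, μ, h, hl, hc, hm⟩ := exists_limit_diagonalizesJet (hA t₀) G hG1 (U := U)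
      (v := v) (Eventually.of_forall fun t => (hU t).1)
    obtain ⟨σ, hσ⟩ := (hU t₀).exists_perm h
    have hAl : Tendsto A' G (𝓝 (A' t₀)) := matrix_tendsto_of_entries fun i j =>
      ((hA' i j).tendsto t₀).mono_left hG0
    have hml : ∀ j, Tendsto (fun t => m t j) G (𝓝 (μ j)) := fun j => by
      have hlim := (Complex.continuous_re.tendsto _).comp (matrix_tendsto_entry
        (matrix_tendsto_mul (matrix_tendsto_mul (matrix_tendsto_conjTranspose hl) hAl) hl) j j)
      rw [h.re_diag] at hlim
      exact hlim.congr fun t => (hU t).re_diag j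
    have h1 : ∀ᶠ t in (G : Filter ℝ), ∀ j, dist (v t j) (v t₀ (σ j)) < ε :=
      eventually_all.mpr fun j => by
        rw [← (hσ j).1]; exact (hc j).eventually (Metric.ball_mem_nhds _ hε)
    have h2 : ∀ᶠ t in (G : Filter ℝ), ∀ j, dist (m t j) (m t₀ (σ j)) < ε :=
      eventually_all.mpr fun j => by
        rw [← (hσ j).2]; exact (hml j).eventually (Metric.ball_mem_nhds _ hε)
    have h3 : ∀ᶠ t in (G : Filter ℝ), ∀ j,
        dist ((v t j - v t₀ (σ j)) / (t - t₀)) (m t₀ (σ j)) < ε :=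
      eventually_all.mpr fun j => by
        rw [← (hσ j).1, ← (hσ j).2]; exact (hm j).eventually (Metric.ball_mem_nhds _ hε)
    have h4 : ∀ᶠ t in (G : Filter ℝ), t ≠ t₀ := hG1 self_mem_nhdsWithin
    have h0 : ∀ᶠ t in (G : Filter ℝ), ¬ ∃ σ : Equiv.Perm (Fin d), dist (x t) (x t₀ ∘ σ) < ε ∧
        ∀ j, |v t j - v t₀ (σ j) - m t₀ (σ j) * (t - t₀)| ≤ ε * |t - t₀| := hG2
    obtain ⟨t, h0, h1, h2, h3, h4⟩ := (h0.and (h1.and (h2.and (h3.and h4)))).exists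
    refine h0 ⟨σ, ?_, fun j => ?_⟩
    · rw [dist_pi_lt_iff hε]
      exact fun j => max_lt (h1 j) (h2 j)
    · have h5 : t - t₀ ≠ 0 := sub_ne_zero.mpr h4
      have e : v t j - v t₀ (σ j) - m t₀ (σ j) * (t - t₀) =
          ((v t j - v t₀ (σ j)) / (t - t₀) - m t₀ (σ j)) * (t - t₀) := by
        field_simp
      rw [e, abs_mul]
      exact mul_le_mul_of_nonneg_right (h3 j).le (abs_nonneg _)
  obtain ⟨y, hy, hxy⟩ := exists_continuous_selection x
    fun t₀ ε hε => (hx t₀ ε hε).mono fun t ⟨σ, h, _⟩ => ⟨σ, h⟩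
  have hder : ∀ j t₀, HasDerivAt (fun t => (y t j).1) (y t₀ j).2 t₀ := by
    intro j t₀
    rw [hasDerivAt_iff_isLittleO, Asymptotics.isLittleO_iff]
    intro ε hε
    obtain ⟨δ, hδ, hsep⟩ := exists_separation (y t₀)
    have hη : 0 < min ε (δ / 2) := by positivity
    have hyc : ∀ᶠ t in 𝓝 t₀, dist (y t) (y t₀) < δ / 2 :=
      (hy.tendsto t₀).eventually (Metric.ball_mem_nhds _ (half_pos hδ))
    filter_upwards [hx t₀ _ hη, hyc] with t ⟨σ, h1, h2⟩ h3
    obtain ⟨ρ, hρ⟩ := hxy t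
    obtain ⟨ρ₀, hρ₀⟩ := hxy t₀
    -- The selected branch and the branch matched by `σ` give pairs at `t₀` closer than the
    -- separation, hence the same pair; so the expansion applies to the selected branch.
    have hz : y t₀ j = x t₀ (σ (ρ j)) := by
      have e : x t₀ (σ (ρ j)) = y t₀ (ρ₀⁻¹ (σ (ρ j))) := by rw [hρ₀]; simp
      rw [e]
      refine dist_eq_zero.mp (hsep _ _ ?_)
      rw [← e]
      have a := (dist_le_pi_dist (y t) (y t₀) j).trans_lt h3
      have b := (dist_le_pi_dist (x t) (x t₀ ∘ σ) (ρ j)).trans_lt h1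
      have c : y t j = x t (ρ j) := by rw [hρ]; rfl
      rw [← c] at b
      have := dist_triangle_left (y t₀ j) (x t₀ (σ (ρ j))) (y t j)
      have := min_le_right ε (δ / 2)
      simp only [Function.comp_apply] at b
      linarith
    have h4 := h2 (ρ j)
    have c : y t j = x t (ρ j) := by rw [hρ]; rfl
    rw [c, hz, Real.norm_eq_abs, Real.norm_eq_abs, smul_eq_mul, mul_comm (t - t₀)]
    exact h4.trans (mul_le_mul_of_nonneg_right (min_le_left _ _) (abs_nonneg _))
  refine ⟨fun j t => (y t j).1, fun t => ?_, fun j => ?_⟩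
  · obtain ⟨σ, hσ⟩ := hxy t
    have := ((hU t).1.comp_perm σ).isEigenvalueTuple
    convert this using 2 with j
    simp only [hσ]; rfl
  · rw [contDiff_one_iff_deriv]
    refine ⟨fun t => (hder j t).differentiableAt, ?_⟩
    have : deriv (fun t => (y t j).1) = fun t => (y t j).2 := funext fun t => (hder j t).deriv
    rw [this]
    exact continuous_snd.comp ((continuous_apply j).comp hy)

end Existence

/-! ### Convexity, null sets and absolute continuity on the line -/

section RealAnalysis

open Set Filter Topology MeasureTheory

theorem LocallyIntegrable.intervalIntegrable_real {W : ℝ → ℝ} (hW : LocallyIntegrable W) (a b : ℝ) :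
    IntervalIntegrable W volume a b :=
  intervalIntegrable_iff.mpr
    ((hW.integrableOn_isCompact isCompact_uIcc).mono_set uIoc_subset_uIcc)

theorem continuous_primitive_real {W : ℝ → ℝ} (hW : LocallyIntegrable W) :
    Continuous fun t => ∫ x in (0 : ℝ)..t, W x :=
  intervalIntegral.continuous_primitive
    (fun a b => LocallyIntegrable.intervalIntegrable_real hW a b) 0

/-- A continuous function on an open interval with a local line of support at each point is
convex. -/
theorem convexOn_of_local_support {Ω : Set ℝ} (hΩ : Convex ℝ Ω) {f : ℝ → ℝ}
    (hf : ContinuousOn f Ω)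
    (h : ∀ t₀ ∈ Ω, ∃ p, ∀ᶠ t in 𝓝 t₀, f t₀ + p * (t - t₀) ≤ f t) : ConvexOn ℝ Ω f := by
  refine convexOn_of_slope_mono_adjacent hΩ fun {x y z} hx hz hxy hyz => ?_
  by_contra! hcon
  have hsub : Icc x z ⊆ Ω := hΩ.ordConnected.out hx hz
  set q := (f z - f x) / (z - x) with hq
  -- If convexity fails, `f` minus its chord has a positive interior maximum. At the leftmost
  -- maximum point the support line must be horizontal, so points slightly to the left are maxima
  -- too.
  let g : ℝ → ℝ := fun t => f t - f x - q * (t - x)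
  have hgc : ContinuousOn g (Icc x z) :=
    ((hf.mono hsub).sub continuousOn_const).sub (by fun_prop)
  have hgx : g x = 0 := by simp [g]
  have hgz : g z = 0 := by
    have : z - x ≠ 0 := by linarith
    simp only [g, hq]; field_simp; ring
  have hgy : 0 < g y := by
    rw [div_lt_div_iff₀ (by linarith) (by linarith)] at hcon
    have h1 : 0 < z - x := by linarith
    have : g y * (z - x) = (f y - f x) * (z - x) - (f z - f x) * (y - x) := by
      simp only [g, hq]; field_simp
    have h2 : 0 < g y * (z - x) := by rw [this]; nlinarith
    exact pos_of_mul_pos_left h2 h1.le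
  obtain ⟨c, hc, hmax⟩ := isCompact_Icc.exists_isMaxOn (nonempty_Icc.mpr (hxy.trans hyz).le) hgc
  have hgc0 : 0 < g c := hgy.trans_le (hmax (show y ∈ Icc x z from ⟨hxy.le, hyz.le⟩))
  let M : Set ℝ := Icc x z ∩ g ⁻¹' {g c}
  have hM : IsCompact M :=
    isCompact_Icc.of_isClosed_subset (hgc.preimage_isClosed_of_isClosed isClosed_Icc
      isClosed_singleton) inter_subset_left
  obtain ⟨m, ⟨hm1, hm2⟩, hmin⟩ := hM.exists_isLeast ⟨c, hc, rfl⟩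
  have hm2 : g m = g c := hm2
  have hxm : x < m := lt_of_le_of_ne hm1.1 fun e => by rw [← e, hgx] at hm2; linarith
  have hmz : m < z := lt_of_le_of_ne hm1.2 fun e => by rw [e, hgz] at hm2; linarith
  obtain ⟨p, hp⟩ := h m (hsub hm1)
  have hp' : ∀ᶠ t in 𝓝 m, g m + (p - q) * (t - m) ≤ g t ∧ t ∈ Ioo x z := by
    filter_upwards [hp, Ioo_mem_nhds hxm hmz] with t ht ht'
    refine ⟨?_, ht'⟩
    simp only [g]; nlinarith
  obtain ⟨ε, hε, hball⟩ := Metric.eventually_nhds_iff.mp hp'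
  have h1 := hball (y := m - ε / 2) (by rw [Real.dist_eq, abs_lt]; constructor <;> linarith)
  have h2 := hball (y := m + ε / 2) (by rw [Real.dist_eq, abs_lt]; constructor <;> linarith)
  have h3 : g (m - ε / 2) ≤ g c := hmax (Ioo_subset_Icc_self h1.2)
  have h4 : g (m + ε / 2) ≤ g c := hmax (Ioo_subset_Icc_self h2.2)
  have h5 : m - ε / 2 ∈ M := by
    refine ⟨Ioo_subset_Icc_self h1.2, le_antisymm h3 ?_⟩
    have := h1.1
    have := h2.1
    show g c ≤ g (m - ε / 2)
    nlinarith
  have := hmin h5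
  linarith

/-- A first order Taylor estimate with a monotone majorant of the derivative. -/
theorem abs_taylor_le {Ω : Set ℝ} (hΩ : Convex ℝ Ω) {f f' Ψ ψ : ℝ → ℝ}
    (hf : ∀ t ∈ Ω, HasDerivAt f (f' t) t) (hΨ : ∀ t ∈ Ω, HasDerivAt Ψ (ψ t) t)
    (h : ∀ s ∈ Ω, ∀ t ∈ Ω, s ≤ t → |f' t - f' s| ≤ ψ t - ψ s) {s t : ℝ} (hs : s ∈ Ω) (ht : t ∈ Ω) :
    |f t - f s - f' s * (t - s)| ≤ Ψ t - Ψ s - ψ s * (t - s) := by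
  have key : ∀ g g' : ℝ → ℝ, (∀ t ∈ Ω, HasDerivAt g (g' t) t) →
      (∀ s ∈ Ω, ∀ t ∈ Ω, s ≤ t → g' s ≤ g' t) → 0 ≤ g t - g s - g' s * (t - s) := by
    intro g g' hg hm
    rcases lt_trichotomy s t with hst | rfl | hst
    · have hsub : Icc s t ⊆ Ω := hΩ.ordConnected.out hs ht
      obtain ⟨ξ, hξ, e⟩ := exists_hasDerivAt_eq_slope g g' hst
        (fun x hx => (hg x (hsub hx)).continuousAt.continuousWithinAt)
        (fun x hx => hg x (hsub (Ioo_subset_Icc_self hx)))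
      have := hm s hs ξ (hsub (Ioo_subset_Icc_self hξ)) hξ.1.le
      have hpos : 0 < t - s := sub_pos.mpr hst
      rw [eq_div_iff hpos.ne'] at e
      nlinarith
    · simp
    · have hsub : Icc t s ⊆ Ω := hΩ.ordConnected.out ht hs
      obtain ⟨ξ, hξ, e⟩ := exists_hasDerivAt_eq_slope g g' hst
        (fun x hx => (hg x (hsub hx)).continuousAt.continuousWithinAt)
        (fun x hx => hg x (hsub (Ioo_subset_Icc_self hx)))
      have := hm ξ (hsub (Ioo_subset_Icc_self hξ)) s hs hξ.2.le
      have hpos : 0 < s - t := sub_pos.mpr hst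
      rw [eq_div_iff hpos.ne'] at e
      nlinarith
  -- Both `Ψ - f` and `Ψ + f` have monotone derivatives, hence lie above their tangents.
  have h1 := key (fun x => Ψ x - f x) (fun x => ψ x - f' x)
    (fun x hx => (hΨ x hx).sub (hf x hx)) fun x hx y hy hxy => by
      have := (abs_le.mp (h x hx y hy hxy)).2; linarith
  have h2 := key (fun x => Ψ x + f x) (fun x => ψ x + f' x)
    (fun x hx => (hΨ x hx).add (hf x hx)) fun x hx y hy hxy => by
      have := (abs_le.mp (h x hx y hy hxy)).1; linarith
  rw [abs_le]
  constructor <;> nlinarith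

/-- The primitive of a positive locally integrable function maps null sets to null sets. -/
theorem volume_image_primitive_eq_zero {W : ℝ → ℝ} (hW : LocallyIntegrable W) (h0 : ∀ x, 0 < W x)
    {N : Set ℝ} (hN : volume N = 0) : volume ((fun t => ∫ x in (0 : ℝ)..t, W x) '' N) = 0 := by
  set Θ : ℝ → ℝ := fun t => ∫ x in (0 : ℝ)..t, W x with hΘ
  have hint := LocallyIntegrable.intervalIntegrable_real hW
  have hc : Continuous Θ := continuous_primitive_real hW
  have hsub : ∀ s t, Θ t - Θ s = ∫ x in s..t, W x := fun s t =>
    intervalIntegral.integral_interval_sub_left (hint _ _) (hint _ _)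
  have hmono : StrictMono Θ := fun s t hst => by
    rw [← sub_pos, hsub]
    exact intervalIntegral.intervalIntegral_pos_of_pos (hint _ _) h0 hst
  have hemb : MeasurableEmbedding Θ := hc.measurableEmbedding hmono.injective
  have himage : ∀ a b, a < b → Θ '' Ioc a b = Ioc (Θ a) (Θ b) := fun a b hab => by
    apply Subset.antisymm
    · rintro _ ⟨t, ht, rfl⟩
      exact ⟨hmono ht.1, hmono.monotone ht.2⟩
    · exact intermediate_value_Ioc hab.le hc.continuousOn
  -- The pullback of Lebesgue measure under `Θ` has density `W`: both measures agree on half-open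
  -- intervals.
  have heq : volume.withDensity (fun x => ENNReal.ofReal (W x)) = volume.comap Θ := by
    refine Measure.ext_of_Ioc' _ _ (fun a b hab => ?_) fun a b hab => ?_
    all_goals
      have e : volume.withDensity (fun x => ENNReal.ofReal (W x)) (Ioc a b) =
          ENNReal.ofReal (Θ b - Θ a) := by
        rw [withDensity_apply _ measurableSet_Ioc, hsub, intervalIntegral.integral_of_le hab.le,
          ofReal_integral_eq_lintegral_ofReal
            ((intervalIntegrable_iff_integrableOn_Ioc_of_le hab.le).mp (hint a b))
            (Eventually.of_forall fun x => (h0 x).le)]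
    · rw [e]; exact ENNReal.ofReal_ne_top
    · rw [e, hemb.comap_apply, himage a b hab, Real.volume_Ioc]
  have h1 : volume.comap Θ N = 0 := by
    rw [← heq]; exact withDensity_absolutelyContinuous _ _ hN
  rwa [hemb.comap_apply] at h1

/-- On `S` the function factors as a 1-Lipschitz map after a primitive, and both factors preserve
null sets. The domination is needed only between points of `S`. -/
theorem volume_image_eq_zero_of_dominated {f : ℝ → ℝ} {W : ℝ → ℝ} (hW : LocallyIntegrable W)
    (h0 : ∀ x, 0 ≤ W x) {S : Set ℝ}
    (hf : ∀ s ∈ S, ∀ t ∈ S, s ≤ t → |f t - f s| ≤ ∫ x in s..t, W x) (hS : volume S = 0) :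
    volume (f '' S) = 0 := by
  -- Adding `1` makes the primitive strictly increasing, so it can be inverted on `S`.
  have hW1 : LocallyIntegrable (fun x => W x + 1) := hW.add (locallyIntegrable_const 1)
  have hint := LocallyIntegrable.intervalIntegrable_real hW
  have hint1 := LocallyIntegrable.intervalIntegrable_real hW1
  have hpos : ∀ x, 0 < W x + 1 := fun x => by linarith [h0 x]
  set Θ : ℝ → ℝ := fun t => ∫ x in (0 : ℝ)..t, (W x + 1) with hΘ
  have hsub : ∀ s t, Θ t - Θ s = (∫ x in s..t, W x) + (t - s) := fun s t => by
    rw [hΘ]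
    dsimp only
    rw [intervalIntegral.integral_interval_sub_left (hint1 _ _) (hint1 _ _),
      intervalIntegral.integral_add (hint _ _) intervalIntegrable_const]
    simp
  have hdom : ∀ s ∈ S, ∀ t ∈ S, s ≤ t → |f t - f s| ≤ Θ t - Θ s := fun s hs t ht hst => by
    rw [hsub]; linarith [hf s hs t ht hst]
  have hdom' : ∀ s ∈ S, ∀ t ∈ S, dist (f s) (f t) ≤ dist (Θ s) (Θ t) := fun s hs t ht => by
    rw [Real.dist_eq, Real.dist_eq]
    rcases le_total s t with h | h
    · rw [abs_sub_comm, abs_sub_comm (Θ s)]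
      exact (hdom s hs t ht h).trans (le_abs_self _)
    · exact (hdom t ht s hs h).trans (le_abs_self _)
  have hinj : InjOn Θ S := fun s hs t ht e => by
    by_contra hne
    have key : ∀ s t, s < t → Θ s ≠ Θ t := fun s t h e => by
      have h1 := hsub s t
      have h2 := intervalIntegral.integral_nonneg (μ := volume) h.le fun x _ => h0 x
      rw [e] at h1
      linarith
    rcases lt_or_gt_of_ne hne with h | h
    · exact key s t h e
    · exact key t s h e.symm
  have hlip : LipschitzOnWith 1 (f ∘ Function.invFunOn Θ S) (Θ '' S) := by
    refine LipschitzOnWith.of_dist_le_mul ?_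
    rintro _ ⟨s, hs, rfl⟩ _ ⟨t, ht, rfl⟩
    simp only [Function.comp_apply, hinj.leftInvOn_invFunOn hs, hinj.leftInvOn_invFunOn ht,
      NNReal.coe_one, one_mul]
    exact hdom' s hs t ht
  have h1 := hlip.hausdorffMeasure_image_le (d := 1) zero_le_one
  rw [hausdorffMeasure_real, volume_image_primitive_eq_zero hW1 hpos hS, mul_zero] at h1
  rw [← nonpos_iff_eq_zero]
  refine (measure_mono ?_).trans h1
  rintro _ ⟨s, hs, rfl⟩
  exact ⟨Θ s, ⟨s, hs, rfl⟩, by simp [hinj.leftInvOn_invFunOn hs]⟩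

/-- By the Lindelöf property countably many of the relative neighborhoods cover `S`. -/
theorem volume_image_eq_zero_of_local {f : ℝ → ℝ} {S : Set ℝ}
    (h : ∀ t ∈ S, ∃ u ∈ 𝓝[S] t, volume (f '' u) = 0) : volume (f '' S) = 0 := by
  choose! u hu hu0 using h
  obtain ⟨C, hCS, hC, hcov⟩ := TopologicalSpace.countable_cover_nhdsWithin hu
  refine measure_mono_null (image_mono hcov) ?_
  rw [image_iUnion₂]
  exact (measure_biUnion_null_iff hC).mpr fun t ht => hu0 t (hCS ht)

theorem absolutelyContinuous_of_dominated {f W : ℝ → ℝ} {a b : ℝ} (hab : a ≤ b)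
    (hW : IntervalIntegrable W volume a b)
    (h : ∀ s ∈ Icc a b, ∀ t ∈ Icc a b, s ≤ t → |f t - f s| ≤ ∫ x in s..t, W x) :
    AbsolutelyContinuousOnInterval f a b := by
  have hF := hW.absolutelyContinuousOnInterval_intervalIntegral (c := a) left_mem_uIcc
  have hint : ∀ s ∈ Icc a b, ∀ t ∈ Icc a b, IntervalIntegrable W volume s t := fun s hs t ht =>
    hW.mono_set (by
      rw [uIcc_of_le hab]
      exact Icc_subset_Icc (le_min hs.1 ht.1) (sup_le hs.2 ht.2))
  have ha : a ∈ Icc a b := ⟨le_rfl, hab⟩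
  have hdom : ∀ s ∈ Icc a b, ∀ t ∈ Icc a b,
      dist (f s) (f t) ≤ dist (∫ x in a..s, W x) (∫ x in a..t, W x) := fun s hs t ht => by
    rw [Real.dist_eq, Real.dist_eq]
    rcases le_total s t with hst | hst
    · rw [abs_sub_comm, abs_sub_comm (∫ x in a..s, W x),
        intervalIntegral.integral_interval_sub_left (hint a ha t ht) (hint a ha s hs)]
      exact (h s hs t ht hst).trans (le_abs_self _)
    · rw [intervalIntegral.integral_interval_sub_left (hint a ha s hs) (hint a ha t ht)]
      exact (h t ht s hs hst).trans (le_abs_self _)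
  rw [absolutelyContinuousOnInterval_iff] at hF ⊢
  intro ε hε
  obtain ⟨δ, hδ, H⟩ := hF ε hε
  refine ⟨δ, hδ, fun E hE hE' => (Finset.sum_le_sum fun i hi => ?_).trans_lt (H E hE hE')⟩
  have := hE.1 i hi
  rw [uIcc_of_le hab] at this
  exact hdom _ this.1 _ this.2

/-- The Banach-Zarecki theorem: a continuous function with a monotone majorant which maps null
sets to null sets is the integral of its derivative. -/
theorem absolutelyContinuous_of_luzin {f K : ℝ → ℝ} {a b : ℝ} (hab : a ≤ b)
    (hf : ContinuousOn f (Icc a b)) (hK : ∀ s ∈ Icc a b, ∀ t ∈ Icc a b, s ≤ t →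
      |f t - f s| ≤ K t - K s)
    (hN : ∀ N ⊆ Icc a b, volume N = 0 → volume (f '' N) = 0) :
    AbsolutelyContinuousOnInterval f a b := by
  -- The majorant splits `f` into a difference of monotone functions, so `f` is differentiable
  -- almost everywhere with integrable derivative.
  have hK1 : MonotoneOn (fun t => (K t + f t) / 2) (Icc a b) := fun s hs t ht hst => by
    have := abs_le.mp (hK s hs t ht hst); dsimp only; linarith
  have hK2 : MonotoneOn (fun t => (K t - f t) / 2) (Icc a b) := fun s hs t ht hst => by
    have := abs_le.mp (hK s hs t ht hst); dsimp only; linarith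
  have hdec : f = fun t => (K t + f t) / 2 - (K t - f t) / 2 := by funext t; ring
  have hd : ∀ᵐ t, t ∈ Icc a b → DifferentiableWithinAt ℝ f (Icc a b) t := by
    filter_upwards [hK1.ae_differentiableWithinAt_of_mem, hK2.ae_differentiableWithinAt_of_mem]
      with t h1 h2 ht
    rw [hdec]
    exact (h1 ht).sub (h2 ht)
  have hint : IntervalIntegrable (deriv f) volume a b := by
    rw [← uIcc_of_le hab] at hK1 hK2
    refine (hK1.intervalIntegrable_deriv.sub hK2.intervalIntegrable_deriv).congr_ae ?_
    rw [EventuallyEq, ae_restrict_iff' measurableSet_uIoc]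
    filter_upwards [hK1.ae_differentiableWithinAt_of_mem, hK2.ae_differentiableWithinAt_of_mem,
      Measure.ae_ne volume b] with t h1 h2 h3 ht
    rw [uIoc_of_le hab] at ht
    rw [uIcc_of_le hab] at h1 h2
    have hn : Icc a b ∈ 𝓝 t := Icc_mem_nhds ht.1 (lt_of_le_of_ne ht.2 h3)
    have ht := Ioc_subset_Icc_self ht
    have := ((h1 ht).differentiableAt hn).hasDerivAt.sub ((h2 ht).differentiableAt hn).hasDerivAt
    have e : f = (fun t => (K t + f t) / 2) - fun t => (K t - f t) / 2 := hdec
    rw [← e] at this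
    exact this.deriv.symm
  refine absolutelyContinuous_of_dominated hab hint.abs fun s hs t ht hst => ?_
  have hsub : Icc s t ⊆ Icc a b := Icc_subset_Icc hs.1 ht.2
  -- By the intermediate value theorem `|f t - f s|` is at most the measure of the image of `[s,
  -- t]`. The image of `D` is controlled by the integral of `|f'|`, and its null complement has null
  -- image.
  let D : Set ℝ := Ioo s t ∩ {x | DifferentiableAt ℝ f x}
  have hD : MeasurableSet D := measurableSet_Ioo.inter (measurableSet_of_differentiableAt ℝ f)
  have h1 : volume (f '' (Icc s t \ D)) = 0 := by
    refine hN _ (sdiff_subset.trans hsub) ?_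
    have hne : ∀ᵐ x : ℝ, x ≠ s ∧ x ≠ t :=
      (Measure.ae_ne volume s).and (Measure.ae_ne volume t)
    rw [measure_eq_zero_iff_ae_notMem]
    filter_upwards [hd, hne] with x hx hx' hmem
    have h2 : x ∈ Ioo s t := ⟨lt_of_le_of_ne hmem.1.1 hx'.1.symm, lt_of_le_of_ne hmem.1.2 hx'.2⟩
    exact hmem.2 ⟨h2, (hx (hsub hmem.1)).differentiableAt
      (mem_of_superset (Icc_mem_nhds h2.1 h2.2) hsub)⟩
  have h2 : volume (f '' D) ≤ ∫⁻ x in D, ENNReal.ofReal |deriv f x| := by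
    have := addHaar_image_le_lintegral_abs_det_fderiv volume hD (f := f)
      (f' := fun x => ContinuousLinearMap.toSpanSingleton ℝ (deriv f x))
      fun x hx => hx.2.hasDerivAt.hasFDerivAt.hasFDerivWithinAt
    simpa only [ContinuousLinearMap.det_toSpanSingleton] using this
  have hint' : IntegrableOn (fun x => |deriv f x|) (Ioc s t) :=
    ((intervalIntegrable_iff_integrableOn_Ioc_of_le hab).mp hint.abs).mono_set
      (Ioc_subset_Ioc hs.1 ht.2)
  have h3 : ENNReal.ofReal |f t - f s| ≤ ENNReal.ofReal (∫ x in s..t, |deriv f x|) := by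
    calc ENNReal.ofReal |f t - f s| = volume (uIcc (f s) (f t)) := by
          rw [Real.volume_interval]
      _ ≤ volume (f '' (Icc s t)) := by
          refine measure_mono ?_
          have := intermediate_value_uIcc (a := s) (b := t) (f := f)
            (by rw [uIcc_of_le hst]; exact hf.mono hsub)
          rwa [uIcc_of_le hst] at this
      _ ≤ volume (f '' D) + volume (f '' (Icc s t \ D)) := by
          refine (measure_mono ?_).trans (measure_union_le _ _)
          rw [← image_union]
          exact image_mono fun x hx => by
            by_cases h : x ∈ D
            · exact Or.inl h
            · exact Or.inr ⟨hx, h⟩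
      _ ≤ ∫⁻ x in D, ENNReal.ofReal |deriv f x| := by rw [h1, add_zero]; exact h2
      _ ≤ ∫⁻ x in Ioc s t, ENNReal.ofReal |deriv f x| :=
          lintegral_mono_set (inter_subset_left.trans Ioo_subset_Ioc_self)
      _ = _ := by
          rw [intervalIntegral.integral_of_le hst,
            ofReal_integral_eq_lintegral_ofReal hint' (Eventually.of_forall fun x => abs_nonneg _)]
  exact (ENNReal.ofReal_le_ofReal_iff
    (intervalIntegral.integral_nonneg hst fun x _ => abs_nonneg _)).mp h3

/-- The integral of `|g|` is at most the oscillation of a monotone majorant of a primitive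
of `g`. -/
theorem lintegral_enorm_le_of_monotone_majorant {f g K : ℝ → ℝ} {a b C : ℝ}
    (hg : ∀ s ∈ Ioo a b, ∀ t ∈ Ioo a b, IntervalIntegrable g volume s t)
    (hfg : ∀ s ∈ Ioo a b, ∀ t ∈ Ioo a b, f t - f s = ∫ x in s..t, g x)
    (hK : ∀ s ∈ Ioo a b, ∀ t ∈ Ioo a b, s ≤ t → |f t - f s| ≤ K t - K s)
    (hC : ∀ s ∈ Ioo a b, ∀ t ∈ Ioo a b, s ≤ t → K t - K s ≤ C) :
    ∫⁻ x in Ioo a b, ‖g x‖ₑ ≤ ENNReal.ofReal C := by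
  have key : ∀ s ∈ Ioo a b, ∀ t ∈ Ioo a b, s ≤ t →
      ∫⁻ x in Ioc s t, ‖g x‖ₑ ≤ ENNReal.ofReal C := by
    intro s hs t ht hst
    have hsub : Icc s t ⊆ Ioo a b := fun x hx => ⟨hs.1.trans_le hx.1, hx.2.trans_lt ht.2⟩
    have hKm : MonotoneOn K (uIcc s t) := by
      rw [uIcc_of_le hst]
      intro x hx y hy hxy
      have := (abs_nonneg _).trans (hK x (hsub hx) y (hsub hy) hxy)
      linarith
    have hKi := hKm.intervalIntegrable_deriv
    have hKd := hKm.intervalIntegral_deriv_mem_uIcc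
    rw [uIcc_of_le (by have := (abs_nonneg _).trans (hK s hs t ht hst); linarith)] at hKd
    -- By Lebesgue differentiation `g` is the derivative of `f` almost everywhere, and difference
    -- quotients of `f` are dominated by those of `K`. A singular part of `K` does no harm: the
    -- integral of `K'` is at most the increment of `K`.
    have hae : ∀ᵐ x, x ∈ Ioc s t → ‖g x‖ₑ ≤ ENNReal.ofReal (deriv K x) := by
      filter_upwards [hKm.ae_differentiableWithinAt_of_mem, (hg s hs t ht).ae_hasDerivAt_integral,
        Measure.ae_ne volume t] with x h1 h2 h3 hx
      have hx' : x ∈ Icc s t := Ioc_subset_Icc_self hx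
      rw [uIcc_of_le hst] at h1 h2
      have hxn : Icc s t ∈ 𝓝 x := Icc_mem_nhds hx.1 (lt_of_le_of_ne hx.2 h3)
      have hKx := ((h1 hx').differentiableAt hxn).hasDerivAt
      have hfx : HasDerivAt f (g x) x := by
        refine ((h2 hx' s ⟨le_rfl, hst⟩).add_const (f s)).congr_of_eventuallyEq ?_
        filter_upwards [hxn] with y hy
        rw [← hfg s hs y (hsub hy)]; ring
      have hle : |g x| ≤ deriv K x := by
        have l1 := (hasDerivAt_iff_tendsto_slope.mp hfx).abs.mono_left
          (nhdsWithin_mono x (fun y (hy : y ∈ Ioi x) => ne_of_gt hy))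
        have l2 := (hasDerivAt_iff_tendsto_slope.mp hKx).mono_left
          (nhdsWithin_mono x (fun y (hy : y ∈ Ioi x) => ne_of_gt hy))
        refine le_of_tendsto_of_tendsto l1 l2 ?_
        filter_upwards [self_mem_nhdsWithin, mem_nhdsWithin_of_mem_nhds hxn] with y hy hy'
        have hy : x < y := hy
        rw [slope_def_field, slope_def_field, abs_div, abs_of_pos (sub_pos.mpr hy)]
        exact div_le_div_of_nonneg_right (hK x (hsub hx') y (hsub hy') hy.le)
          (sub_pos.mpr hy).le
      rw [Real.enorm_eq_ofReal_abs]
      exact ENNReal.ofReal_le_ofReal hle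
    have h0 : 0 ≤ᵐ[volume.restrict (Ioc s t)] deriv K := by
      rw [EventuallyLE, ae_restrict_iff' measurableSet_Ioc]
      filter_upwards [Measure.ae_ne volume t] with x h3 hx
      rw [← derivWithin_of_mem_nhds (Icc_mem_nhds hx.1 (lt_of_le_of_ne hx.2 h3))]
      rw [uIcc_of_le hst] at hKm
      exact hKm.derivWithin_nonneg
    calc ∫⁻ x in Ioc s t, ‖g x‖ₑ ≤ ∫⁻ x in Ioc s t, ENNReal.ofReal (deriv K x) :=
          setLIntegral_mono_ae' measurableSet_Ioc hae
      _ = ENNReal.ofReal (∫ x in s..t, deriv K x) := by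
          rw [intervalIntegral.integral_of_le hst, ofReal_integral_eq_lintegral_ofReal
            ((intervalIntegrable_iff_integrableOn_Ioc_of_le hst).mp hKi) h0]
      _ ≤ _ := ENNReal.ofReal_le_ofReal (hKd.2.trans (hC s hs t ht hst))
  rcases le_or_gt b a with hab | hab
  · simp [Ioo_eq_empty hab.not_gt]
  obtain ⟨u, hu1, hu2, hu3⟩ := exists_seq_strictAnti_tendsto' hab
  obtain ⟨v, hv1, hv2, hv3⟩ := exists_seq_strictMono_tendsto' hab
  have hun : Ioo a b = ⋃ n, Ioc (u n) (v n) := by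
    ext x
    simp only [mem_iUnion]
    constructor
    · intro hx
      obtain ⟨n, h1, h2⟩ := ((hu3.eventually (gt_mem_nhds hx.1)).and
        (hv3.eventually (lt_mem_nhds hx.2))).exists
      exact ⟨n, h1, h2.le⟩
    · rintro ⟨n, h1, h2⟩
      exact ⟨(hu2 n).1.trans h1, h2.trans_lt (hv2 n).2⟩
  rw [hun, setLIntegral_iUnion_of_directed]
  · refine iSup_le fun n => ?_
    rcases le_total (u n) (v n) with h | h
    · exact key _ (hu2 n) _ (hv2 n) h
    · simp [Ioc_eq_empty h.not_gt]
  · exact directed_of_isDirected_le fun m n hmn =>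
      Ioc_subset_Ioc (hu1.antitone hmn) (hv1.monotone hmn)

end RealAnalysis

/-! ### Diagonal entries versus eigenvalues -/

section Rearrangement

open Matrix

variable {d : ℕ} {U V A M : Matrix (Fin d) (Fin d) ℂ} {v w : Fin d → ℝ}

theorem norm_conj_apply_le (hV : Vᴴ * V = 1) (hU : Uᴴ * U = 1) (M : Matrix (Fin d) (Fin d) ℂ)
    (i j : Fin d) : ‖(Vᴴ * M * U) i j‖ ≤ ∑ k, ∑ l, ‖M k l‖ := by
  rw [Matrix.mul_apply]
  simp only [Matrix.mul_apply, Finset.sum_mul]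
  rw [Finset.sum_comm]
  refine (norm_sum_le _ _).trans (Finset.sum_le_sum fun k _ => (norm_sum_le _ _).trans
    (Finset.sum_le_sum fun l _ => ?_))
  rw [norm_mul, norm_mul, conjTranspose_apply, norm_star]
  calc _ ≤ 1 * ‖M k l‖ * 1 := by
        gcongr
        · exact norm_entry_le_one hV k i
        · exact norm_entry_le_one hU l j
    _ = _ := by ring

/-- Expanding the basis `V` in the eigenbasis `U` shows the diagonal entries to be averages of
eigenvalues with weights the squared overlaps. -/
theorem Diagonalizes.re_conj_diag (h : Diagonalizes U A v) (V : Matrix (Fin d) (Fin d) ℂ)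
    (i : Fin d) : ((Vᴴ * A * V) i i).re = ∑ l, Complex.normSq ((Vᴴ * U) i l) * v l := by
  have e : Vᴴ * A * V = Vᴴ * U * diagonal (fun j => (v j : ℂ)) * (Vᴴ * U)ᴴ := by
    rw [Matrix.conjTranspose_mul, conjTranspose_conjTranspose, Matrix.mul_assoc Vᴴ U, ← h.2]
    calc _ = Vᴴ * A * (U * Uᴴ) * V := by rw [h.mul_conjTranspose, Matrix.mul_one]
      _ = _ := by simp only [Matrix.mul_assoc]
  rw [e, Matrix.mul_apply, Complex.re_sum]
  refine Finset.sum_congr rfl fun l _ => ?_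
  rw [mul_diagonal, conjTranspose_apply, mul_right_comm, Complex.star_def, Complex.mul_conj,
    ← Complex.ofReal_mul, Complex.ofReal_re]

theorem normSq_mem_doublyStochastic (hU : Uᴴ * U = 1) :
    Matrix.of (fun i j => Complex.normSq (U i j)) ∈ doublyStochastic ℝ (Fin d) := by
  rw [mem_doublyStochastic_iff_sum]
  refine ⟨fun i j => Complex.normSq_nonneg _, fun i => ?_, fun j => ?_⟩
  · have hU' : U * Uᴴ = 1 := mul_eq_one_comm.mp hU
    have := congrFun (congrFun hU' i) i
    rw [Matrix.mul_apply, one_apply_eq] at this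
    simp only [conjTranspose_apply, Complex.star_def, Complex.mul_conj] at this
    exact_mod_cast this
  · have := congrFun (congrFun hU j) j
    rw [Matrix.mul_apply, one_apply_eq] at this
    simp only [conjTranspose_apply, Complex.star_def, mul_comm, Complex.mul_conj] at this
    exact_mod_cast this

/-- Weighted sums of diagonal entries are at most the sums of the eigenvalues with the same
weights, if the weights are ordered as the eigenvalues. -/
theorem Diagonalizes.sum_re_diag_le (h : Diagonalizes U A v) (hV : Vᴴ * V = 1)
    (hw : Monovary w v) : ∑ i, w i * ((Vᴴ * A * V) i i).re ≤ ∑ i, w i * v i := by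
  have hVU : (Vᴴ * U)ᴴ * (Vᴴ * U) = 1 := by
    rw [Matrix.conjTranspose_mul, conjTranspose_conjTranspose]
    calc _ = Uᴴ * (V * Vᴴ) * U := by simp only [Matrix.mul_assoc]
      _ = 1 := by rw [mul_eq_one_comm.mp hV, Matrix.mul_one, h.1]
  -- Birkhoff: the squared overlaps are a convex combination of permutation matrices. The
  -- rearrangement inequality then applies to each permutation.
  obtain ⟨c, hc0, hc1, hc⟩ := exists_eq_sum_perm_of_mem_doublyStochastic
    (normSq_mem_doublyStochastic hVU)
  have hP : ∀ i l, Complex.normSq ((Vᴴ * U) i l) =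
      ∑ σ : Equiv.Perm (Fin d), c σ * (σ.permMatrix ℝ) i l := fun i l => by
    have := congrFun (congrFun hc i) l
    rw [Matrix.sum_apply] at this
    exact this.symm
  calc ∑ i, w i * ((Vᴴ * A * V) i i).re
      = ∑ i, ∑ σ : Equiv.Perm (Fin d), c σ * (w i * v (σ i)) := by
        refine Finset.sum_congr rfl fun i _ => ?_
        rw [h.re_conj_diag]
        simp only [hP, Finset.sum_mul]
        rw [Finset.sum_comm, Finset.mul_sum]
        refine Finset.sum_congr rfl fun σ _ => ?_
        rw [Finset.sum_eq_single (σ i)]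
        · simp [Equiv.Perm.permMatrix, PEquiv.toMatrix_apply]; ring
        · intro l _ hl
          simp [Equiv.Perm.permMatrix, PEquiv.toMatrix_apply, hl.symm]
        · simp
    _ = ∑ σ : Equiv.Perm (Fin d), c σ * ∑ i, w i * v (σ i) := by
        rw [Finset.sum_comm]; simp only [Finset.mul_sum]
    _ ≤ ∑ σ : Equiv.Perm (Fin d), c σ * ∑ i, w i * v i :=
        Finset.sum_le_sum fun σ _ => mul_le_mul_of_nonneg_left hw.sum_mul_comp_perm_le_sum_mul
          (hc0 σ)
    _ = _ := by rw [← Finset.sum_mul, hc1, one_mul]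

end Rearrangement

/-! ### Convexity of the spread and DC regularity -/

section RegularSystems

open Matrix Set Filter Topology MeasureTheory

variable {d : ℕ}

/-- A differentiable system `ev` of eigenvalues, with derivatives `ev'`, of a curve `A` of matrices
with derivative `A'`, the variation of which is bounded by the integral of `W`. -/
structure IsRegularSystem (Ω : Set ℝ) (A A' : ℝ → Matrix (Fin d) (Fin d) ℂ) (W : ℝ → ℝ)
    (ev ev' : Fin d → ℝ → ℝ) : Prop where
  isOpen : IsOpen Ω
  convex : Convex ℝ Ω
  locallyIntegrable : LocallyIntegrable W
  nonneg : ∀ x, 0 ≤ W x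
  hasDerivAt_matrix : ∀ t ∈ Ω, ∀ i j, HasDerivAt (fun s => A s i j) (A' t i j) t
  majorant : ∀ s ∈ Ω, ∀ t ∈ Ω, s ≤ t → ∑ i, ∑ j, ‖A' t i j - A' s i j‖ ≤ ∫ x in s..t, W x
  jet : ∀ t ∈ Ω, ∃ U, DiagonalizesJet U (A t) (A' t) (fun j => ev j t) (fun j => ev' j t)
  hasDerivAt : ∀ t ∈ Ω, ∀ j, HasDerivAt (ev j) (ev' j t) t

/-- The primitive of `W` which vanishes at `0`. -/
noncomputable def primitive (W : ℝ → ℝ) (t : ℝ) : ℝ := ∫ x in (0 : ℝ)..t, W x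

namespace IsRegularSystem

variable {Ω : Set ℝ} {A A' : ℝ → Matrix (Fin d) (Fin d) ℂ} {W : ℝ → ℝ} {ev ev' : Fin d → ℝ → ℝ}

theorem primitive_sub (h : IsRegularSystem Ω A A' W ev ev') (s t : ℝ) :
    primitive W t - primitive W s = ∫ x in s..t, W x :=
  intervalIntegral.integral_interval_sub_left
    (LocallyIntegrable.intervalIntegrable_real h.locallyIntegrable _ _)
    (LocallyIntegrable.intervalIntegrable_real h.locallyIntegrable _ _)

theorem continuous_primitive (h : IsRegularSystem Ω A A' W ev ev') : Continuous (primitive W) :=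
  continuous_primitive_real h.locallyIntegrable

theorem hasDerivAt_primitive (h : IsRegularSystem Ω A A' W ev ev') (t : ℝ) :
    HasDerivAt (primitive (primitive W)) (primitive W t) t :=
  intervalIntegral.integral_hasDerivAt_right (h.continuous_primitive.intervalIntegrable _ _)
    (h.continuous_primitive.stronglyMeasurableAtFilter _ _) h.continuous_primitive.continuousAt

theorem continuousAt_matrix' (h : IsRegularSystem Ω A A' W ev ev') {t : ℝ} (ht : t ∈ Ω)
    (i j : Fin d) : ContinuousAt (fun s => A' s i j) t := by
  rw [ContinuousAt, tendsto_iff_dist_tendsto_zero]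
  have h1 : Tendsto (fun s => |primitive W s - primitive W t|) (𝓝 t) (𝓝 0) := by
    have := ((h.continuous_primitive.tendsto t).sub_const (primitive W t)).abs
    simpa using this
  refine squeeze_zero' (Eventually.of_forall fun s => dist_nonneg) ?_ h1
  filter_upwards [h.isOpen.mem_nhds ht] with s hs
  have hle : ∀ s t, ‖A' s i j - A' t i j‖ ≤ ∑ k, ∑ l, ‖A' s k l - A' t k l‖ := fun s t =>
    (Finset.single_le_sum (f := fun l => ‖A' s i l - A' t i l‖) (fun _ _ => norm_nonneg _)
      (Finset.mem_univ j)).trans (Finset.single_le_sum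
      (f := fun k => ∑ l, ‖A' s k l - A' t k l‖)
      (fun _ _ => Finset.sum_nonneg fun _ _ => norm_nonneg _) (Finset.mem_univ i))
  rcases le_total s t with hst | hst
  · rw [dist_comm, dist_eq_norm, abs_sub_comm, h.primitive_sub]
    exact ((hle t s).trans (h.majorant s hs t ht hst)).trans (le_abs_self _)
  · rw [dist_eq_norm, h.primitive_sub]
    exact ((hle s t).trans (h.majorant t ht s hs hst)).trans (le_abs_self _)

theorem continuousAt_deriv (h : IsRegularSystem Ω A A' W ev ev') {t : ℝ} (ht : t ∈ Ω)
    (j : Fin d) : ContinuousAt (ev' j) t :=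
  continuousAt_deriv_of_diagonalizesJet (h.hasDerivAt_matrix t ht)
    (h.continuousAt_matrix' ht)
    (by filter_upwards [h.isOpen.mem_nhds ht] with s hs using h.jet s hs)
    (h.hasDerivAt t ht) j

/-- The remainder of the first order Taylor expansion at `s` of the second primitive of `W`. -/
noncomputable def remainder (W : ℝ → ℝ) (s t : ℝ) : ℝ :=
  primitive (primitive W) t - primitive (primitive W) s - primitive W s * (t - s)

theorem hasDerivAt_re_conj (h : IsRegularSystem Ω A A' W ev ev') {t : ℝ} (ht : t ∈ Ω)
    (V : Matrix (Fin d) (Fin d) ℂ) (i : Fin d) :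
    HasDerivAt (fun t => ((Vᴴ * A t * V) i i).re) ((Vᴴ * A' t * V) i i).re t := by
  have : HasDerivAt (fun t => (Vᴴ * A t * V) i i) ((Vᴴ * A' t * V) i i) t := by
    simp only [Matrix.mul_apply]
    refine HasDerivAt.fun_sum fun l _ => HasDerivAt.mul_const (HasDerivAt.fun_sum fun k _ => ?_) _
    exact (h.hasDerivAt_matrix t ht k l).const_mul _
  exact (Complex.reCLM.hasFDerivAt.comp_hasDerivAt t this)

/-- The diagonal entries of `A` with respect to an eigenbasis at `s` are close to the first order
Taylor polynomials of the eigenvalues. -/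
theorem abs_re_conj_sub_le (h : IsRegularSystem Ω A A' W ev ev') {s t : ℝ} (hs : s ∈ Ω)
    (ht : t ∈ Ω) {V : Matrix (Fin d) (Fin d) ℂ}
    (hV : DiagonalizesJet V (A s) (A' s) (fun j => ev j s) (fun j => ev' j s)) (i : Fin d) :
    |((Vᴴ * A t * V) i i).re - ev i s - ev' i s * (t - s)| ≤ remainder W s t := by
  have h1 := abs_taylor_le h.convex (f := fun t => ((Vᴴ * A t * V) i i).re)
    (f' := fun t => ((Vᴴ * A' t * V) i i).re) (Ψ := primitive (primitive W)) (ψ := primitive W)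
    (fun t ht => h.hasDerivAt_re_conj ht V i) (fun t _ => h.hasDerivAt_primitive t)
    (fun x hx y hy hxy => ?_) hs ht
  · have e1 : ((Vᴴ * A s * V) i i).re = ev i s := by rw [hV.1.conjTranspose_mul_mul]; simp
    rw [e1, hV.re_diag] at h1
    exact h1
  · have e : ((Vᴴ * A' y * V) i i).re - ((Vᴴ * A' x * V) i i).re =
        ((Vᴴ * (A' y - A' x) * V) i i).re := by
      rw [Matrix.mul_sub, Matrix.sub_mul]; simp
    rw [e, h.primitive_sub]
    exact ((Complex.abs_re_le_norm _).trans (norm_conj_apply_le hV.1.1 hV.1.1 _ i i)).trans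
      (h.majorant x hx y hy hxy)

/-- The sum of all the distances between the eigenvalues. -/
noncomputable def spread (ev : Fin d → ℝ → ℝ) (t : ℝ) : ℝ := ∑ i, ∑ l, |ev i t - ev l t|

/-- A multiple of the second primitive of `W` which makes the spread convex. -/
noncomputable def convexifier (d : ℕ) (W : ℝ → ℝ) (t : ℝ) : ℝ :=
  (d * (2 * d + 1) : ℝ) * primitive (primitive W) t

/-- The sign is odd, so exchanging the two indices turns the sum over pairs into a weighted sum over
single indices. -/
theorem sum_sign_mul (x y : Fin d → ℝ) :
    ∑ i, (2 * ∑ l, (SignType.sign (y i - y l) : ℝ)) * x i =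
      ∑ i, ∑ l, (SignType.sign (y i - y l) : ℝ) * (x i - x l) := by
  have h1 : ∑ i, ∑ l, (SignType.sign (y i - y l) : ℝ) * x l =
      -∑ i, ∑ l, (SignType.sign (y i - y l) : ℝ) * x i := by
    rw [Finset.sum_comm, ← Finset.sum_neg_distrib]
    refine Finset.sum_congr rfl fun i _ => ?_
    rw [← Finset.sum_neg_distrib]
    refine Finset.sum_congr rfl fun l _ => ?_
    rw [← neg_sub, Left.sign_neg]; simp
  simp only [mul_sub, Finset.sum_sub_distrib]
  rw [h1, sub_neg_eq_add, ← two_mul, Finset.mul_sum]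
  refine Finset.sum_congr rfl fun i _ => ?_
  rw [mul_assoc, Finset.sum_mul]

/-- Distinct values of `y` have weights from the sign sums at least `2` apart, so a perturbation of
one weight by `|e| ≤ 1` cannot destroy the order. -/
theorem monovary_sign (y : Fin d → ℝ) (j : Fin d) {e : ℝ} (he : |e| ≤ 1) :
    Monovary (fun i => 2 * ∑ l, (SignType.sign (y i - y l) : ℝ) + if i = j then e else 0) y := by
  have hmono : ∀ a b : ℝ, a ≤ b → (SignType.sign a : ℝ) ≤ SignType.sign b := fun a b hab => by
    rcases lt_trichotomy a 0 with ha | rfl | ha <;> rcases lt_trichotomy b 0 with hb | rfl | hb <;>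
      simp [*] <;> linarith
  intro i k hik
  have h1 : ∑ l, (SignType.sign (y i - y l) : ℝ) + 1 ≤ ∑ l, (SignType.sign (y k - y l) : ℝ) := by
    rw [← Finset.add_sum_erase _ _ (Finset.mem_univ i),
      ← Finset.add_sum_erase _ (fun l => (SignType.sign (y k - y l) : ℝ)) (Finset.mem_univ i)]
    have : ∑ l ∈ Finset.univ.erase i, (SignType.sign (y i - y l) : ℝ) ≤
        ∑ l ∈ Finset.univ.erase i, (SignType.sign (y k - y l) : ℝ) :=
      Finset.sum_le_sum fun l _ => hmono _ _ (by linarith)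
    rw [sign_pos (sub_pos.mpr hik), sub_self, sign_zero]
    simp only [SignType.coe_zero, SignType.coe_one]
    linarith
  have h2 := abs_le.mp he
  dsimp only
  split_ifs <;> linarith

theorem abs_weight_le (y : Fin d → ℝ) (i j : Fin d) {e : ℝ} (he : |e| ≤ 1) :
    |2 * ∑ l, (SignType.sign (y i - y l) : ℝ) + if i = j then e else 0| ≤ 2 * d + 1 := by
  have h1 : |∑ l, (SignType.sign (y i - y l) : ℝ)| ≤ d := by
    refine (Finset.abs_sum_le_sum_abs _ _).trans ?_
    calc _ ≤ ∑ _l : Fin d, (1 : ℝ) := Finset.sum_le_sum fun l _ => by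
          rcases lt_trichotomy (y i - y l) 0 with h | h | h <;> simp [h]
      _ = d := by simp
  refine (abs_add_le _ _).trans (add_le_add ?_ ?_)
  · rw [abs_mul, abs_two]; linarith
  · split_ifs
    · exact he
    · simp

/-- The spread together with an eigenvalue and the convexifier is convex. -/
theorem convexOn_spread_add (h : IsRegularSystem Ω A A' W ev ev') (j : Fin d) {e : ℝ}
    (he : |e| ≤ 1) :
    ConvexOn ℝ Ω (fun t => spread ev t + e * ev j t + convexifier d W t) := by
  have hcont : ∀ i, ContinuousOn (ev i) Ω := fun i t ht =>
    (h.hasDerivAt t ht i).continuousAt.continuousWithinAt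
  have hΨ : Continuous (primitive (primitive W)) :=
    continuous_iff_continuousAt.mpr fun t => (h.hasDerivAt_primitive t).continuousAt
  refine convexOn_of_local_support h.convex ?_ fun t₀ ht₀ => ?_
  · refine (ContinuousOn.add ?_ (continuousOn_const.mul (hcont j))).add
      (continuous_const.mul hΨ).continuousOn
    exact continuousOn_finsetSum _ fun i _ => continuousOn_finsetSum _ fun l _ =>
      ((hcont i).sub (hcont l)).abs
  obtain ⟨V, hV⟩ := h.jet t₀ ht₀
  let s : Fin d → Fin d → ℝ := fun i l => SignType.sign (ev i t₀ - ev l t₀)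
  let ℓ : Fin d → ℝ → ℝ := fun i t => ev i t₀ + ev' i t₀ * (t - t₀)
  -- Signs at `t` are compared with signs at `t₀`. Distinct eigenvalues keep their order near `t₀`.
  -- For eigenvalues that coincide at `t₀` the left side is `0`, and the right side is nonnegative:
  -- either the tangents coincide, or the order at `t` is that of the tangents.
  have hsign : ∀ᶠ t in 𝓝 t₀, ∀ i l, s i l * (ℓ i t - ℓ l t) ≤
      (SignType.sign (ev i t - ev l t) : ℝ) * (ℓ i t - ℓ l t) := by
    refine eventually_all.mpr fun i => eventually_all.mpr fun l => ?_
    have hder : HasDerivAt (fun t => ev i t - ev l t) (ev' i t₀ - ev' l t₀) t₀ :=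
      (h.hasDerivAt t₀ ht₀ i).sub (h.hasDerivAt t₀ ht₀ l)
    rcases lt_trichotomy (ev i t₀ - ev l t₀) 0 with h0 | h0 | h0
    · filter_upwards [hder.continuousAt.eventually_lt_const h0] with t ht
      simp only [s, sign_neg h0, sign_neg ht, le_refl]
    · simp only [s, h0, sign_zero, SignType.coe_zero, zero_mul]
      by_cases hμ : ev' i t₀ - ev' l t₀ = 0
      · refine Eventually.of_forall fun t => ?_
        have : ℓ i t - ℓ l t = 0 := by
          simp only [ℓ]; linear_combination h0 + (t - t₀) * hμ
        rw [this, mul_zero]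
      · have hlo := (hasDerivAt_iff_isLittleO.mp hder).def
          (half_pos (abs_pos.mpr hμ))
        filter_upwards [hlo] with t ht
        have e1 : ℓ i t - ℓ l t = (ev' i t₀ - ev' l t₀) * (t - t₀) := by
          simp only [ℓ]; linear_combination h0
        rw [h0, sub_zero, smul_eq_mul, Real.norm_eq_abs, Real.norm_eq_abs] at ht
        rw [e1]
        set μ := ev' i t₀ - ev' l t₀
        set D := ev i t - ev l t
        have h2 : |D - (t - t₀) * μ| ≤ |μ * (t - t₀)| / 2 := by
          rw [abs_mul]; linarith
        rcases lt_trichotomy (μ * (t - t₀)) 0 with h3 | h3 | h3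
        · rw [abs_of_neg h3, abs_le] at h2
          have : D < 0 := by nlinarith
          rw [sign_neg this]; simp; linarith
        · rw [h3, mul_zero]
        · rw [abs_of_pos h3, abs_le] at h2
          have : 0 < D := by nlinarith
          rw [sign_pos this]; simp; linarith
    · filter_upwards [hder.continuousAt.eventually_const_lt h0] with t ht
      simp only [s, sign_pos h0, sign_pos ht, le_refl]
  -- The slope of the support line comes from the tangents with signs frozen at `t₀`, plus the
  -- derivative of the convexifier there.
  refine ⟨(∑ i, ∑ l, s i l * (ev' i t₀ - ev' l t₀)) + e * ev' j t₀ +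
    (d * (2 * d + 1) : ℝ) * primitive W t₀, ?_⟩
  filter_upwards [hsign, h.isOpen.mem_nhds ht₀] with t hst ht
  obtain ⟨U, hU⟩ := h.jet t ht
  -- The weights use the order at `t`, not at `t₀`, because the rearrangement bound is applied to `A
  -- t`.
  set w : Fin d → ℝ := fun i => 2 * ∑ l, (SignType.sign (ev i t - ev l t) : ℝ) +
    if i = j then e else 0 with hw
  have hsum : ∀ x : Fin d → ℝ, ∑ i, w i * x i =
      (∑ i, ∑ l, (SignType.sign (ev i t - ev l t) : ℝ) * (x i - x l)) + e * x j := fun x => by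
    simp only [hw, add_mul, Finset.sum_add_distrib]
    rw [sum_sign_mul x (fun i => ev i t)]
    simp
  have h1 : spread ev t + e * ev j t = ∑ i, w i * ev i t := by
    rw [hsum]
    simp only [spread, sign_mul_self]
  have h2 : ∑ i, w i * ((Vᴴ * A t * V) i i).re ≤ ∑ i, w i * ev i t :=
    hU.1.sum_re_diag_le hV.1.1 (monovary_sign (fun i => ev i t) j he)
  -- Each of the `d` weights is at most `2 * d + 1` in absolute value. This is the origin of the
  -- constant in `convexifier`, which cancels the error.
  have h3 : ∑ i, w i * ℓ i t - (d * (2 * d + 1) : ℝ) * remainder W t₀ t ≤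
      ∑ i, w i * ((Vᴴ * A t * V) i i).re := by
    have e1 : (d * (2 * d + 1) : ℝ) * remainder W t₀ t =
        ∑ _i : Fin d, (2 * d + 1 : ℝ) * remainder W t₀ t := by
      simp; ring
    rw [e1, ← Finset.sum_sub_distrib]
    refine Finset.sum_le_sum fun i _ => ?_
    have e2 := h.abs_re_conj_sub_le ht₀ ht hV i
    have e3 := abs_weight_le (fun i => ev i t) i j he
    have e4 : |w i * (((Vᴴ * A t * V) i i).re - ℓ i t)| ≤ (2 * d + 1 : ℝ) * remainder W t₀ t := by
      rw [abs_mul]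
      refine mul_le_mul e3 ?_ (abs_nonneg _) (by positivity)
      rw [← sub_sub] 
      exact e2
    have := (abs_le.mp e4).1
    linarith
  have h4 : (∑ i, ∑ l, s i l * (ℓ i t - ℓ l t)) + e * ℓ j t ≤ ∑ i, w i * ℓ i t := by
    rw [hsum]
    exact add_le_add_left (Finset.sum_le_sum fun i _ => Finset.sum_le_sum fun l _ => hst i l) _
  have h5 : ∑ i, ∑ l, s i l * (ℓ i t - ℓ l t) =
      spread ev t₀ + (∑ i, ∑ l, s i l * (ev' i t₀ - ev' l t₀)) * (t - t₀) := by
    simp only [spread, Finset.sum_mul, ← Finset.sum_add_distrib]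
    refine Finset.sum_congr rfl fun i _ => Finset.sum_congr rfl fun l _ => ?_
    rw [← sign_mul_self (ev i t₀ - ev l t₀)]
    simp only [s, ℓ]; ring
  rw [h5] at h4
  simp only [convexifier, remainder, ℓ] at h3 h4 ⊢
  rw [h1]
  nlinarith

/-- The spread and the convexifier cancel in half the difference of the convex functions for `e = 1`
and `e = -1`. -/
theorem dcOn (h : IsRegularSystem Ω A A' W ev ev') (j : Fin d) : DCOn Ω (ev j) := by
  have h1 := h.convexOn_spread_add j (e := 1) (by simp)
  have h2 := h.convexOn_spread_add j (e := -1) (by simp)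
  have h3 := h1.smul (c := 1 / 2) (by norm_num)
  have h4 := h2.smul (c := 1 / 2) (by norm_num)
  refine ⟨_, _, h3.continuousOn h.isOpen, h3, h4.continuousOn h.isOpen, h4, fun x _ => ?_⟩
  · simp only [smul_eq_mul]; ring

/-- A common monotone majorant of the derivatives of the eigenvalues. -/
theorem exists_majorant (h : IsRegularSystem Ω A A' W ev ev') :
    ∃ K : ℝ → ℝ, (∀ j, ∀ s ∈ Ω, ∀ t ∈ Ω, s ≤ t → |ev' j t - ev' j s| ≤ K t - K s) ∧
      ∀ M, (∀ t ∈ Ω, ∀ j, |ev' j t| ≤ M) → ∀ s ∈ Ω, ∀ t ∈ Ω, s ≤ t →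
        K t - K s ≤ 4 * d * d * M + (d * (2 * d + 1)) * ∫ x in s..t, W x := by
  rcases Nat.eq_zero_or_pos d with rfl | hd
  · exact ⟨0, fun j => j.elim0, by simp⟩
  set c : ℝ → ℝ := fun t => spread ev t + convexifier d W t with hc
  have hcc : ConvexOn ℝ Ω c := by
    have := h.convexOn_spread_add ⟨0, hd⟩ (e := 0) (by simp)
    simpa using this
  set K : ℝ → ℝ := fun t => derivWithin c (Ioi t) t with hK
  have hint : interior Ω = Ω := h.isOpen.interior_eq
  have hKd : ∀ t ∈ Ω, HasDerivWithinAt c (K t) (Ioi t) t := fun t ht =>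
    hcc.hasDerivWithinAt_rightDeriv_of_mem_interior (hint.symm ▸ ht)
  refine ⟨K, fun j s hs t ht hst => ?_, fun M hM s hs t ht hst => ?_⟩
  · have key : ∀ e : ℝ, |e| ≤ 1 → K s + e * ev' j s ≤ K t + e * ev' j t := fun e he => by
      have hm := (h.convexOn_spread_add j he).monotoneOn_rightDeriv
      rw [hint] at hm
      have hder : ∀ t ∈ Ω, derivWithin (fun t => spread ev t + e * ev j t + convexifier d W t)
          (Ioi t) t = K t + e * ev' j t := fun t ht => by
        have h1 := (hKd t ht).add (((h.hasDerivAt t ht j).const_mul e).hasDerivWithinAt)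
        rw [← h1.derivWithin (uniqueDiffWithinAt_Ioi t)]
        congr 1
        funext x; simp [hc]; ring
      have := hm hs ht hst
      dsimp only at this
      rwa [hder s hs, hder t ht] at this
    have h1 := key 1 (by simp)
    have h2 := key (-1) (by simp)
    rw [abs_le]; constructor <;> linarith
  · have hlip : ∀ x ∈ Ω, ∀ y ∈ Ω, ∀ i, |ev i y - ev i x| ≤ M * |y - x| := fun x hx y hy i => by
      have := h.convex.norm_image_sub_le_of_norm_hasDerivWithin_le (f := ev i) (f' := ev' i)
        (C := M) (fun t ht => (h.hasDerivAt t ht i).hasDerivWithinAt) (fun t ht => hM t ht i) hx hy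
      exact this
    have hspread : ∀ x ∈ Ω, ∀ y ∈ Ω, |spread ev y - spread ev x| ≤ 2 * d * d * M * |y - x| := by
      intro x hx y hy
      simp only [spread, ← Finset.sum_sub_distrib]
      refine (Finset.abs_sum_le_sum_abs _ _).trans ((Finset.sum_le_sum
        (g := fun _ => ∑ _l : Fin d, 2 * M * |y - x|) fun i _ =>
        (Finset.abs_sum_le_sum_abs _ _).trans (Finset.sum_le_sum fun l _ =>
          (abs_abs_sub_abs_le_abs_sub _ _).trans ?_)).trans_eq ?_)
      · have h1 := hlip x hx y hy i
        have h2 := hlip x hx y hy l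
        rw [show ev i y - ev l y - (ev i x - ev l x) = (ev i y - ev i x) - (ev l y - ev l x) by ring]
        refine (abs_sub _ _).trans ?_
        linarith
      · simp; ring
    -- What remains of `K` is the right derivative of the spread, bounded by its Lipschitz constant.
    have hKb : ∀ x ∈ Ω, |K x - (d * (2 * d + 1)) * primitive W x| ≤ 2 * d * d * M := fun x hx => by
      have hs : HasDerivWithinAt (spread ev) (K x - (d * (2 * d + 1)) * primitive W x) (Ioi x) x := by
        have := (hKd x hx).sub (((h.hasDerivAt_primitive x).const_mul
          (d * (2 * d + 1) : ℝ)).hasDerivWithinAt)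
        refine this.congr_of_eventuallyEq (Eventually.of_forall fun y => ?_) ?_ <;>
          simp [hc, convexifier]
      have hl := (hasDerivWithinAt_iff_tendsto_slope' (by simp)).mp hs
      refine le_of_tendsto hl.abs ?_
      filter_upwards [self_mem_nhdsWithin, mem_nhdsWithin_of_mem_nhds (h.isOpen.mem_nhds hx)]
        with y hy hyΩ
      have hy : x < y := hy
      rw [slope_def_field, abs_div, div_le_iff₀ (abs_pos.mpr (sub_pos.mpr hy).ne')]
      exact hspread x hx y hyΩ
    have h1 := (abs_le.mp (hKb s hs)).1
    have h2 := (abs_le.mp (hKb t ht)).2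
    rw [← h.primitive_sub]
    linarith

end IsRegularSystem

end RegularSystems

/-! ### Null sets under the derivatives and absolute continuity -/

section Luzin

open Matrix Set Filter Topology MeasureTheory

variable {d : ℕ}

/-- If the eigenvalues with indices in `S` are separated from the others, then the difference of
their sum and the trace of the compression to the span of the eigenvectors of a nearby matrix is
quadratically small. -/
theorem abs_sum_re_conj_diag_sub_le {A B U V : Matrix (Fin d) (Fin d) ℂ} {v w : Fin d → ℝ}
    (hV : Diagonalizes V A v) (hU : Diagonalizes U B w) (S : Finset (Fin d)) {δ Λ ε : ℝ}
    (hδ : 0 < δ) (hsep : ∀ i l, (i ∈ S ↔ l ∉ S) → δ ≤ |w l - v i|) (hΛ : ∀ i, |w i| ≤ Λ)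
    (hε : ∑ i, ∑ j, ‖(B - A) i j‖ ≤ ε) :
    |∑ i ∈ S, ((Vᴴ * B * V) i i).re - ∑ i ∈ S, w i| ≤ 2 * d * d * (Λ * (ε / δ) ^ 2) := by
  classical
  set P : Fin d → Fin d → ℝ := fun i l => Complex.normSq ((Vᴴ * U) i l) with hP
  have hVU : (Vᴴ * U)ᴴ * (Vᴴ * U) = 1 := by
    rw [Matrix.conjTranspose_mul, conjTranspose_conjTranspose]
    calc _ = Uᴴ * (V * Vᴴ) * U := by simp only [Matrix.mul_assoc]
      _ = 1 := by rw [hV.mul_conjTranspose, Matrix.mul_one, hU.1]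
  have hds := mem_doublyStochastic_iff_sum.mp (normSq_mem_doublyStochastic hVU)
  have hcol : ∀ l, ∑ i, P i l = 1 := hds.2.2
  have hoff : ∀ i l, (i ∈ S ↔ l ∉ S) → P i l * |w l| ≤ Λ * (ε / δ) ^ 2 := by
    intro i l hil
    have e : Vᴴ * (B - A) * U = Vᴴ * U * diagonal (fun j => (w j : ℂ)) -
        diagonal (fun j => (v j : ℂ)) * (Vᴴ * U) := by
      rw [Matrix.mul_sub, Matrix.sub_mul, hV.conjTranspose_mul, Matrix.mul_assoc, hU.2,
        Matrix.mul_assoc, Matrix.mul_assoc]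
    have e1 : (Vᴴ * (B - A) * U) i l = (Vᴴ * U) i l * ((w l - v i : ℝ) : ℂ) := by
      rw [e, Matrix.sub_apply, mul_diagonal, diagonal_mul]; push_cast; ring
    have h1 := (norm_conj_apply_le hV.1 hU.1 (B - A) i l).trans hε
    rw [e1, norm_mul, Complex.norm_real, Real.norm_eq_abs] at h1
    -- A gap `δ` forces the overlap across the two groups to be of first order in `B - A`; its
    -- square makes the final error quadratic.
    have h2 : ‖(Vᴴ * U) i l‖ ≤ ε / δ := by
      rw [le_div_iff₀ hδ]
      exact (mul_le_mul_of_nonneg_left (hsep i l hil) (norm_nonneg _)).trans h1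
    have h3 : P i l ≤ (ε / δ) ^ 2 := by
      rw [hP]
      dsimp only
      rw [Complex.normSq_eq_norm_sq]
      gcongr
    rw [mul_comm Λ]
    exact mul_le_mul h3 (hΛ l) (abs_nonneg _) (sq_nonneg _)
  -- The contributions inside the group `S` cancel, as the overlap weights sum to `1`; only terms
  -- across the groups survive.
  have hid : ∑ i ∈ S, ((Vᴴ * B * V) i i).re - ∑ i ∈ S, w i =
      ∑ i ∈ S, ∑ l ∈ Sᶜ, P i l * w l - ∑ l ∈ S, ∑ i ∈ Sᶜ, P i l * w l := by
    have h1 : ∑ i ∈ S, ((Vᴴ * B * V) i i).re =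
        ∑ i ∈ S, ∑ l ∈ S, P i l * w l + ∑ i ∈ S, ∑ l ∈ Sᶜ, P i l * w l := by
      rw [← Finset.sum_add_distrib]
      refine Finset.sum_congr rfl fun i _ => ?_
      rw [hU.re_conj_diag, Finset.sum_add_sum_compl]
    have h2 : ∑ l ∈ S, w l =
        ∑ l ∈ S, ∑ i ∈ S, P i l * w l + ∑ l ∈ S, ∑ i ∈ Sᶜ, P i l * w l := by
      rw [← Finset.sum_add_distrib]
      refine Finset.sum_congr rfl fun l _ => ?_
      rw [Finset.sum_add_sum_compl, ← Finset.sum_mul, hcol, one_mul]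
    rw [h1, h2, Finset.sum_comm (s := S) (t := S)]
    ring
  have hbound : ∀ f : Fin d → Fin d → ℝ, (∀ i ∈ S, ∀ l ∈ Sᶜ, |f i l| ≤ Λ * (ε / δ) ^ 2) →
      |∑ i ∈ S, ∑ l ∈ Sᶜ, f i l| ≤ d * d * (Λ * (ε / δ) ^ 2) := by
    intro f hf
    have hcard : ∀ T : Finset (Fin d), T.card ≤ d := fun T =>
      (Finset.card_le_univ T).trans_eq (Fintype.card_fin d)
    calc _ ≤ ∑ i ∈ S, ∑ l ∈ Sᶜ, |f i l| := (Finset.abs_sum_le_sum_abs _ _).trans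
          (Finset.sum_le_sum fun i _ => Finset.abs_sum_le_sum_abs _ _)
      _ ≤ ∑ i ∈ S, ∑ l ∈ Sᶜ, Λ * (ε / δ) ^ 2 :=
          Finset.sum_le_sum fun i hi => Finset.sum_le_sum fun l hl => hf i hi l hl
      _ = (S.card : ℝ) * (Sᶜ.card : ℝ) * (Λ * (ε / δ) ^ 2) := by simp; ring
      _ ≤ _ := by
          rcases S.eq_empty_or_nonempty with rfl | ⟨i, hi⟩
          · simp only [Finset.card_empty, Nat.cast_zero, zero_mul]
            rcases Nat.eq_zero_or_pos d with rfl | hd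
            · simp
            · have := (abs_nonneg _).trans (hΛ ⟨0, hd⟩)
              positivity
          · have := (abs_nonneg _).trans (hΛ i)
            gcongr <;> exact hcard _
  rw [hid]
  have b1 := hbound (fun i l => P i l * w l) fun i hi l hl => by
    rw [abs_mul, abs_of_nonneg (Complex.normSq_nonneg _)]
    exact hoff i l (iff_of_true hi (Finset.mem_compl.mp hl))
  have b2 := hbound (fun l i => P i l * w l) fun l hl i hi => by
    rw [abs_mul, abs_of_nonneg (Complex.normSq_nonneg _)]
    exact hoff i l (iff_of_false (Finset.mem_compl.mp hi) (not_not_intro hl))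
  refine (abs_sub _ _).trans ?_
  linarith

namespace IsRegularSystem

variable {Ω : Set ℝ} {A A' : ℝ → Matrix (Fin d) (Fin d) ℂ} {W : ℝ → ℝ} {ev ev' : Fin d → ℝ → ℝ}

theorem exists_locally_lipschitz (h : IsRegularSystem Ω A A' W ev ev') {t₀ : ℝ} (ht₀ : t₀ ∈ Ω) :
    ∃ L, 0 ≤ L ∧ ∃ ρ > 0, Metric.ball t₀ ρ ⊆ Ω ∧ ∀ s ∈ Metric.ball t₀ ρ, ∀ t ∈ Metric.ball t₀ ρ,
      ∑ i, ∑ j, ‖(A t - A s) i j‖ ≤ L * |t - s| := by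
  have hev : ∀ᶠ t in 𝓝 t₀, t ∈ Ω ∧ ∀ i j, ‖A' t i j‖ < ‖A' t₀ i j‖ + 1 :=
    (h.isOpen.eventually_mem ht₀).and (eventually_all.mpr fun i => eventually_all.mpr fun j =>
      (h.continuousAt_matrix' ht₀ i j).norm.eventually_lt_const (lt_add_one _))
  obtain ⟨ρ, hρ, hball⟩ := Metric.eventually_nhds_iff_ball.mp hev
  refine ⟨∑ i, ∑ j, (‖A' t₀ i j‖ + 1), by positivity, ρ, hρ, fun t ht => (hball t ht).1,
    fun s hs t ht => ?_⟩
  rw [Finset.sum_mul]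
  refine Finset.sum_le_sum fun i _ => ?_
  rw [Finset.sum_mul]
  refine Finset.sum_le_sum fun j _ => ?_
  have := (convex_ball t₀ ρ).norm_image_sub_le_of_norm_hasDerivWithin_le
    (f := fun t => A t i j) (f' := fun t => A' t i j) (C := ‖A' t₀ i j‖ + 1)
    (fun t ht => (h.hasDerivAt_matrix t (hball t ht).1 i j).hasDerivWithinAt)
    (fun t ht => ((hball t ht).2 i j).le) hs ht
  exact this

/-- Near a point, the derivative of the sum of the eigenvalues which coincide at the point has an
absolutely continuous majorant. -/
theorem exists_local_domination (h : IsRegularSystem Ω A A' W ev ev') {t₀ : ℝ} (ht₀ : t₀ ∈ Ω)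
    {S : Finset (Fin d)} (hS : ∀ i l, (i ∈ S ↔ l ∉ S) → ev i t₀ ≠ ev l t₀) :
    ∃ u ∈ 𝓝 t₀, ∃ C, 0 ≤ C ∧ ∀ s ∈ u, ∀ t ∈ u, s ≤ t →
      |∑ i ∈ S, ev' i t - ∑ i ∈ S, ev' i s| ≤ ∫ x in s..t, (d * W x + C) := by
  obtain ⟨L, hL, ρ, hρ, hρΩ, hlip⟩ := h.exists_locally_lipschitz ht₀
  obtain ⟨δ, hδ, hsep⟩ := exists_separation (fun i => ev i t₀)
  have hev : ∀ᶠ t in 𝓝 t₀, ∀ i, |ev i t - ev i t₀| < δ / 4 := eventually_all.mpr fun i =>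
    (h.hasDerivAt t₀ ht₀ i).continuousAt.eventually
      (Metric.ball_mem_nhds (ev i t₀) (show 0 < δ / 4 by positivity))
  set Λ := ∑ i, |ev i t₀| + δ / 4 with hΛ
  -- Half of the separation `δ` remains after each of the two eigenvalues has moved by less than `δ
  -- / 4`; `L` bounds the speed of `A` and `Λ` the eigenvalues.
  set C₂ := 2 * d * d * (Λ * (L / (δ / 2)) ^ 2) with hC₂
  have hΛ0 : 0 ≤ Λ := by positivity
  have hC₂0 : 0 ≤ C₂ := by positivity
  refine ⟨Metric.ball t₀ ρ ∩ {t | ∀ i, |ev i t - ev i t₀| < δ / 4},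
    inter_mem (Metric.ball_mem_nhds _ hρ) hev, 2 * C₂, by positivity, ?_⟩
  have key : ∀ s ∈ Metric.ball t₀ ρ ∩ {t | ∀ i, |ev i t - ev i t₀| < δ / 4},
      ∀ t ∈ Metric.ball t₀ ρ ∩ {t | ∀ i, |ev i t - ev i t₀| < δ / 4},
      |∑ i ∈ S, ev i t - ∑ i ∈ S, ev i s - (∑ i ∈ S, ev' i s) * (t - s)| ≤
        d * remainder W s t + C₂ * (t - s) ^ 2 := by
    rintro s ⟨hs, hs'⟩ t ⟨ht, ht'⟩
    obtain ⟨V, hV⟩ := h.jet s (hρΩ hs)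
    obtain ⟨U, hU⟩ := h.jet t (hρΩ ht)
    have h1 := abs_sum_re_conj_diag_sub_le hV.1 hU.1 S (half_pos hδ) (Λ := Λ)
      (ε := L * |t - s|) (fun i l hil => ?_) (fun i => ?_) (hlip s hs t ht)
    · have h2 : |∑ i ∈ S, ((Vᴴ * A t * V) i i).re - ∑ i ∈ S, ev i s -
          (∑ i ∈ S, ev' i s) * (t - s)| ≤ d * remainder W s t := by
        rw [Finset.sum_mul, ← Finset.sum_sub_distrib, ← Finset.sum_sub_distrib]
        refine (Finset.abs_sum_le_sum_abs _ _).trans ?_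
        calc _ ≤ ∑ i ∈ S, remainder W s t := Finset.sum_le_sum fun i _ =>
              h.abs_re_conj_sub_le (hρΩ hs) (hρΩ ht) hV i
          _ ≤ ∑ _i : Fin d, remainder W s t :=
              Finset.sum_le_sum_of_subset_of_nonneg (Finset.subset_univ _) fun i _ _ =>
                (abs_nonneg _).trans (h.abs_re_conj_sub_le (hρΩ hs) (hρΩ ht) hV i)
          _ = _ := by simp
      have h3 : 2 * d * d * (Λ * (L * |t - s| / (δ / 2)) ^ 2) = C₂ * (t - s) ^ 2 := by
        rw [hC₂, mul_div_right_comm, mul_pow, sq_abs]; ring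
      rw [h3] at h1
      rw [abs_le] at h1 h2 ⊢
      constructor <;> linarith [h1.1, h1.2, h2.1, h2.2]
    · have h2 : δ ≤ |ev l t₀ - ev i t₀| := by
        by_contra! hlt
        exact hS i l hil (dist_eq_zero.mp (hsep l i hlt)).symm
      have h3 := hs' i
      have h4 := ht' l
      have h5 : |ev l t₀ - ev i t₀| ≤ |ev l t - ev i s| + |ev l t - ev l t₀| +
          |ev i s - ev i t₀| := by
        calc _ = |(ev l t - ev i s) - (ev l t - ev l t₀) + (ev i s - ev i t₀)| := by
              congr 1; ring
          _ ≤ _ := (abs_add_le _ _).trans (add_le_add_left (abs_sub _ _) _)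
      linarith
    · have h2 := ht' i
      have h3 := Finset.single_le_sum (f := fun i => |ev i t₀|) (fun _ _ => abs_nonneg _)
        (Finset.mem_univ i)
      have h4 := abs_sub_abs_le_abs_sub (ev i t) (ev i t₀)
      linarith
  intro s hs t ht hst
  rcases hst.eq_or_lt with rfl | hst
  · simp
  -- Taylor's estimate based at `s` and at `t` is added. The function values cancel, and the two
  -- remainders sum to `(t - s)` times the increment of `primitive W`.
  have h1 := key s hs t ht
  have h2 := key t ht s hs
  have e : ∫ x in s..t, (d * W x + 2 * C₂) =
      d * (primitive W t - primitive W s) + 2 * C₂ * (t - s) := by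
    rw [intervalIntegral.integral_add
      ((LocallyIntegrable.intervalIntegrable_real h.locallyIntegrable _ _).const_mul _)
      intervalIntegrable_const, intervalIntegral.integral_const_mul, h.primitive_sub]
    simp; ring
  rw [e]
  have hpos : 0 < t - s := sub_pos.mpr hst
  refine le_of_mul_le_mul_right ?_ hpos
  rw [← abs_of_pos hpos, ← abs_mul, abs_of_pos hpos]
  simp only [remainder] at h1 h2
  rw [abs_le] at h1 h2 ⊢
  constructor <;> nlinarith [h1.1, h1.2, h2.1, h2.2]

/-- A single `ev' j` has no evident dominating integral near a multiple eigenvalue, but the sum over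
the cluster has. It suffices to identify `ev' j` with the cluster mean, off countably many points of
each class. -/
theorem volume_image_deriv_eq_zero (h : IsRegularSystem Ω A A' W ev ev') (j : Fin d) {N : Set ℝ}
    (hN : N ⊆ Ω) (hN0 : volume N = 0) : volume (ev' j '' N) = 0 := by
  classical
  let σ : ℝ → Finset (Fin d) := fun t => Finset.univ.filter fun i => ev i t = ev j t
  have hcover : ev' j '' N = ⋃ S : Finset (Fin d), ev' j '' (N ∩ σ ⁻¹' {S}) := by
    rw [← image_iUnion, ← inter_iUnion]
    congr 1
    ext t; simp
  rw [hcover, measure_iUnion_null_iff]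
  intro S
  set E := N ∩ σ ⁻¹' {S} with hE
  have hES : ∀ t ∈ E, ∀ i, i ∈ S ↔ ev i t = ev j t := fun t ht i => by
    have : σ t = S := ht.2
    rw [← this]; simp [σ]
  -- Isolated points of `E` are covered by relatively open singletons, so their image is null
  -- without any estimate.
  let I : Set ℝ := {t ∈ E | 𝓝[E \ {t}] t = ⊥}
  let Acc : Set ℝ := {t ∈ E | (𝓝[E \ {t}] t).NeBot}
  have hEu : E ⊆ I ∪ Acc := fun t ht => by
    by_cases hb : 𝓝[E \ {t}] t = ⊥
    · exact Or.inl ⟨ht, hb⟩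
    · exact Or.inr ⟨ht, ⟨hb⟩⟩
  refine measure_mono_null (image_mono hEu) ?_
  rw [image_union]
  refine measure_union_null (volume_image_eq_zero_of_local fun t ht => ?_)
    (volume_image_eq_zero_of_local fun t ht => ?_)
  · refine ⟨{t}, ?_, by simp⟩
    have h1 : 𝓝[insert t (E \ {t})] t = pure t := by rw [nhdsWithin_insert, ht.2, sup_bot_eq]
    have h2 : 𝓝[I] t ≤ pure t := by
      rw [← h1]
      refine nhdsWithin_mono t fun x hx => ?_
      by_cases hxt : x = t
      · exact Or.inl hxt
      · exact Or.inr ⟨hx.1, hxt⟩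
    exact h2 (mem_pure.mpr rfl)
  · have hAcc : ∀ s ∈ Acc, ∑ i ∈ S, ev' i s = S.card * ev' j s := by
      rintro s ⟨hs, hne⟩
      rw [← nsmul_eq_mul, ← Finset.sum_const]
      refine Finset.sum_congr rfl fun i hi => ?_
      have hd : HasDerivAt (fun t => ev i t - ev j t) (ev' i s - ev' j s) s :=
        (h.hasDerivAt s (hN hs.1) i).sub (h.hasDerivAt s (hN hs.1) j)
      have h1 := (hasDerivAt_iff_tendsto_slope.mp hd).mono_left
        (nhdsWithin_mono s (fun x (hx : x ∈ E \ {s}) => hx.2))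
      have h2 : Tendsto (slope (fun t => ev i t - ev j t) s) (𝓝[E \ {s}] s) (𝓝 0) := by
        refine tendsto_const_nhds.congr' ?_
        filter_upwards [self_mem_nhdsWithin] with x hx
        rw [slope_def_field, (hES s hs i).mp hi, (hES x hx.1 i).mp hi]
        simp
      exact sub_eq_zero.mp (tendsto_nhds_unique h1 h2)
    have hcard : ∀ s ∈ Acc, 1 ≤ (S.card : ℝ) := fun s hs => by
      have : j ∈ S := (hES s hs.1 j).mpr rfl
      exact_mod_cast Finset.card_pos.mpr ⟨j, this⟩
    obtain ⟨u, hu, C, hC, hdom⟩ := h.exists_local_domination (hN ht.1.1) (S := S)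
      fun i l hil heq => by
        have h1 := hES t ht.1 i
        have h2 := hES t ht.1 l
        rw [heq] at h1
        tauto
    refine ⟨u ∩ Acc, inter_mem (mem_nhdsWithin_of_mem_nhds hu) self_mem_nhdsWithin, ?_⟩
    refine volume_image_eq_zero_of_dominated (W := fun x => d * W x + C) ?_
      (fun x => add_nonneg (mul_nonneg (Nat.cast_nonneg _) (h.nonneg x)) hC)
      (fun x hx y hy hxy => ?_)
      (measure_mono_null (fun x hx => hx.2.1.1) hN0)
    · exact (h.locallyIntegrable.smul (d : ℝ)).add (locallyIntegrable_const C)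
    · refine le_trans ?_ (hdom x hx.1 y hy.1 hxy)
      rw [hAcc x hx.2, hAcc y hy.2, ← mul_sub, abs_mul, Nat.abs_cast]
      exact le_mul_of_one_le_left (abs_nonneg _) (hcard x hx.2)

/-- Banach-Zarecki: continuity, the monotone majorant and the null set property are all available.
-/
theorem absolutelyContinuous_deriv (h : IsRegularSystem Ω A A' W ev ev') (j : Fin d) {a b : ℝ}
    (ha : a ∈ Ω) (hb : b ∈ Ω) (hab : a ≤ b) : AbsolutelyContinuousOnInterval (ev' j) a b := by
  have hsub : Icc a b ⊆ Ω := h.convex.ordConnected.out ha hb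
  obtain ⟨K, hK, -⟩ := h.exists_majorant
  exact absolutelyContinuous_of_luzin hab
    (fun t ht => (h.continuousAt_deriv (hsub ht) j).continuousWithinAt)
    (fun s hs t ht hst => hK j s (hsub hs) t (hsub ht) hst)
    fun N hN hN0 => h.volume_image_deriv_eq_zero j (hN.trans hsub) hN0

theorem intervalIntegrable_deriv_deriv (h : IsRegularSystem Ω A A' W ev ev') (j : Fin d) {a b : ℝ}
    (ha : a ∈ Ω) (hb : b ∈ Ω) : IntervalIntegrable (deriv (ev' j)) volume a b := by
  rcases le_total a b with hab | hab
  · exact (h.absolutelyContinuous_deriv j ha hb hab).intervalIntegrable_deriv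
  · exact (h.absolutelyContinuous_deriv j hb ha hab).intervalIntegrable_deriv.symm

theorem deriv_sub_eq_integral (h : IsRegularSystem Ω A A' W ev ev') (j : Fin d) {a b : ℝ}
    (ha : a ∈ Ω) (hb : b ∈ Ω) : ev' j b - ev' j a = ∫ x in a..b, deriv (ev' j) x := by
  rcases le_total a b with hab | hab
  · exact (h.absolutelyContinuous_deriv j ha hb hab).integral_deriv_eq_sub.symm
  · rw [intervalIntegral.integral_symm,
      (h.absolutelyContinuous_deriv j hb ha hab).integral_deriv_eq_sub, neg_sub]

theorem lintegral_enorm_deriv_deriv_le {a b M D : ℝ}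
    (h : IsRegularSystem (Ioo a b) A A' W ev ev') (j : Fin d)
    (hM : ∀ t ∈ Ioo a b, ∀ j, |ev' j t| ≤ M)
    (hD : ∀ s ∈ Ioo a b, ∀ t ∈ Ioo a b, s ≤ t → ∫ x in s..t, W x ≤ D) :
    ∫⁻ x in Ioo a b, ‖deriv (ev' j) x‖ₑ ≤
      ENNReal.ofReal (4 * d * d * M + (d * (2 * d + 1)) * D) := by
  obtain ⟨K, hK, hKb⟩ := h.exists_majorant
  refine lintegral_enorm_le_of_monotone_majorant (f := ev' j) (K := K)
    (fun s hs t ht => h.intervalIntegrable_deriv_deriv j hs ht)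
    (fun s hs t ht => h.deriv_sub_eq_integral j hs ht) (hK j) fun s hs t ht hst => ?_
  have := hD s hs t ht hst
  exact (hKb M hM s hs t ht hst).trans (by gcongr)

end IsRegularSystem

end Luzin

/-! ### Weak derivatives on intervals -/

section WeakDerivatives

open Set Filter Topology MeasureTheory

variable {Ω : Set ℝ}

theorem exists_Ioo_superset (hΩ : IsOpen Ω) {x₀ : ℝ} (hx₀ : x₀ ∈ Ω) {K : Set ℝ}
    (hK : IsCompact K) (hKΩ : K ⊆ Ω) : ∃ s ∈ Ω, ∃ t ∈ Ω, s < x₀ ∧ x₀ < t ∧ K ⊆ Ioo s t := by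
  have hK' : IsCompact (insert x₀ K) := hK.insert x₀
  have hKΩ' : insert x₀ K ⊆ Ω := insert_subset hx₀ hKΩ
  obtain ⟨m, hm, hmin⟩ := hK'.exists_isLeast ⟨x₀, mem_insert _ _⟩
  obtain ⟨M, hM, hmax⟩ := hK'.exists_isGreatest ⟨x₀, mem_insert _ _⟩
  obtain ⟨s, hs, hsm⟩ := ((hΩ.eventually_mem (hKΩ' hm)).filter_mono nhdsWithin_le_nhds
    |>.and (self_mem_nhdsWithin (s := Iio m))).exists
  obtain ⟨t, ht, htM⟩ := ((hΩ.eventually_mem (hKΩ' hM)).filter_mono nhdsWithin_le_nhds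
    |>.and (self_mem_nhdsWithin (s := Ioi M))).exists
  exact ⟨s, hs, t, ht, lt_of_lt_of_le hsm (hmin (mem_insert _ _)),
    lt_of_le_of_lt (hmax (mem_insert _ _)) htM, fun x hx =>
    ⟨lt_of_lt_of_le hsm (hmin (mem_insert_of_mem _ hx)),
      lt_of_le_of_lt (hmax (mem_insert_of_mem _ hx)) htM⟩⟩

theorem absolutelyContinuous_of_integral {u v : ℝ → ℝ} {a b : ℝ} (hab : a ≤ b)
    (hv : IntervalIntegrable v volume a b)
    (h : ∀ s ∈ Icc a b, ∀ t ∈ Icc a b, u t - u s = ∫ x in s..t, v x) :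
    AbsolutelyContinuousOnInterval u a b :=
  absolutelyContinuous_of_dominated hab hv.abs fun s hs t ht hst => by
    rw [h s hs t ht]
    exact intervalIntegral.abs_integral_le_integral_abs hst

theorem integrable_mul_of_tsupport_subset {g φ : ℝ → ℝ} (hg : LocallyIntegrableOn g Ω)
    (hφ : Continuous φ) (hc : HasCompactSupport φ) (hs : tsupport φ ⊆ Ω) :
    Integrable (fun x => g x * φ x) := by
  rw [← integrableOn_iff_integrable_of_support_subset (s := tsupport φ)]
  · exact (hg.integrableOn_compact_subset hs hc).mul_continuousOn hφ.continuousOn hc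
  · exact fun x hx => subset_tsupport φ fun h0 => hx (by simp [h0])

theorem locallyIntegrableOn_of_intervalIntegrable (hΩ : IsOpen Ω) {v : ℝ → ℝ}
    (hv : ∀ s ∈ Ω, ∀ t ∈ Ω, IntervalIntegrable v volume s t) : LocallyIntegrableOn v Ω := by
  intro x hx
  obtain ⟨s, hs, t, ht, hsx, hxt, -⟩ := exists_Ioo_superset hΩ hx isCompact_empty (empty_subset _)
  refine ⟨Ioc s t, mem_nhdsWithin_of_mem_nhds (Ioc_mem_nhds hsx hxt), ?_⟩
  exact (intervalIntegrable_iff_integrableOn_Ioc_of_le (hsx.trans hxt).le).mp (hv s hs t ht)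

theorem continuousOn_of_integral (hΩ : IsOpen Ω) {u v : ℝ → ℝ}
    (hv : ∀ s ∈ Ω, ∀ t ∈ Ω, IntervalIntegrable v volume s t)
    (huv : ∀ s ∈ Ω, ∀ t ∈ Ω, u t - u s = ∫ x in s..t, v x) (hΩc : Convex ℝ Ω) :
    ContinuousOn u Ω := by
  intro x hx
  obtain ⟨s, hs, t, ht, hsx, hxt, -⟩ := exists_Ioo_superset hΩ hx isCompact_empty (empty_subset _)
  have hsub : Icc s t ⊆ Ω := hΩc.ordConnected.out hs ht
  have hac := absolutelyContinuous_of_integral (hsx.trans hxt).le (hv s hs t ht)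
    fun y hy z hz => huv y (hsub hy) z (hsub hz)
  have := hac.continuousOn
  rw [uIcc_of_le (hsx.trans hxt).le] at this
  exact (this.continuousAt (Icc_mem_nhds hsx hxt)).continuousWithinAt

/-- A primitive has a weak derivative. -/
theorem hasWeakDeriv_one_of_integral (hΩ : IsOpen Ω) (hΩc : Convex ℝ Ω) {u v : ℝ → ℝ}
    (hv : ∀ s ∈ Ω, ∀ t ∈ Ω, IntervalIntegrable v volume s t)
    (huv : ∀ s ∈ Ω, ∀ t ∈ Ω, u t - u s = ∫ x in s..t, v x) : HasWeakDeriv 1 Ω u v := by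
  refine ⟨(continuousOn_of_integral hΩ hv huv hΩc).locallyIntegrableOn hΩ.measurableSet,
    locallyIntegrableOn_of_intervalIntegrable hΩ hv, fun φ hφ hc hs => ?_⟩
  rcases Ω.eq_empty_or_nonempty with rfl | ⟨x₀, hx₀⟩
  · simp
  obtain ⟨s, hs', t, ht', hsx, hxt, hK⟩ := exists_Ioo_superset hΩ hx₀ hc hs
  have hst : s ≤ t := (hsx.trans hxt).le
  have hsub : Icc s t ⊆ Ω := hΩc.ordConnected.out hs' ht'
  have hred : ∀ f : ℝ → ℝ, (∀ x, x ∉ tsupport φ → f x = 0) →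
      ∫ x in Ω, f x = ∫ x in s..t, f x := fun f hf => by
    rw [intervalIntegral.integral_of_le hst]
    refine setIntegral_eq_of_subset_of_forall_sdiff_eq_zero hΩ.measurableSet
      (Ioc_subset_Icc_self.trans hsub) fun x hx => hf x fun h => hx.2 (Ioo_subset_Ioc_self (hK h))
  have hφd : Differentiable ℝ φ := hφ.differentiable (by simp)
  have hφc : Continuous (deriv φ) := hφ.continuous_deriv (by simp)
  have hac := absolutelyContinuous_of_integral hst (hv s hs' t ht')
    fun y hy z hz => huv y (hsub hy) z (hsub hz)
  have hacφ : AbsolutelyContinuousOnInterval φ s t :=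
    absolutelyContinuous_of_integral hst (hφc.intervalIntegrable _ _) fun y _ z _ =>
      (intervalIntegral.integral_deriv_eq_sub (fun x _ => hφd x)
        (hφc.intervalIntegrable _ _)).symm
  have hφ0 : ∀ x, x ∉ tsupport φ → φ x = 0 := fun x hx => image_eq_zero_of_notMem_tsupport hx
  have hs0 : φ s = 0 := hφ0 s fun h => (hK h).1.ne rfl
  have ht0 : φ t = 0 := hφ0 t fun h => (hK h).2.ne rfl
  -- Integration by parts for absolutely continuous functions; the boundary terms vanish since the
  -- support lies strictly between `s` and `t`.
  rw [iteratedDeriv_one, hred, hred, hac.integral_mul_deriv_eq_deriv_mul hacφ, hs0, ht0]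
  · have : ∫ x in s..t, deriv u x * φ x = ∫ x in s..t, v x * φ x := by
      refine intervalIntegral.integral_congr_ae ?_
      filter_upwards [(hv s hs' t ht').ae_hasDerivAt_integral, Measure.ae_ne volume t]
        with x hx hxt' hx'
      rw [uIoc_of_le hst] at hx'
      have hxI := Ioc_subset_Icc_self hx'
      rw [uIcc_of_le hst] at hx
      have : HasDerivAt u (v x) x := by
        refine ((hx hxI s ⟨le_rfl, hst⟩).add_const (u s)).congr_of_eventuallyEq ?_
        filter_upwards [Icc_mem_nhds hx'.1 (lt_of_le_of_ne hx'.2 hxt')] with y hy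
        rw [← huv s hs' y (hsub hy)]; ring
      rw [this.deriv]
    rw [this]; ring
  · intro x hx; rw [hφ0 x hx, mul_zero]
  · intro x hx
    rw [image_eq_zero_of_notMem_tsupport fun h => hx (tsupport_deriv_subset h), mul_zero]

theorem HasWeakDeriv.two_of_one {u v w : ℝ → ℝ} (h1 : HasWeakDeriv 1 Ω u v)
    (h2 : HasWeakDeriv 1 Ω v w) : HasWeakDeriv 2 Ω u w := by
  refine ⟨h1.1, h2.2.1, fun φ hφ hc hs => ?_⟩
  have hφ' : ContDiff ℝ ∞ (deriv φ) := (contDiff_infty_iff_deriv.mp hφ).2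
  have e1 := h1.2.2 (deriv φ) hφ' hc.deriv (tsupport_deriv_subset.trans hs)
  have e2 := h2.2.2 φ hφ hc hs
  rw [iteratedDeriv_succ', e1, ← iteratedDeriv_one, e2]
  ring

theorem HasWeakDeriv.one_of_two {u v w : ℝ → ℝ} (h1 : HasWeakDeriv 1 Ω u v)
    (h2 : HasWeakDeriv 2 Ω u w) : HasWeakDeriv 1 Ω v w := by
  refine ⟨h1.2.1, h2.2.1, fun φ hφ hc hs => ?_⟩
  have hφ' : ContDiff ℝ ∞ (deriv φ) := (contDiff_infty_iff_deriv.mp hφ).2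
  have e1 := h1.2.2 (deriv φ) hφ' hc.deriv (tsupport_deriv_subset.trans hs)
  have e2 := h2.2.2 φ hφ hc hs
  rw [iteratedDeriv_succ', e1, ← iteratedDeriv_one] at e2
  linarith

/-- The lemma of du Bois-Reymond. -/
theorem HasWeakDeriv.ae_eq_const (hΩ : IsOpen Ω) (hΩc : Convex ℝ Ω) {g : ℝ → ℝ}
    (h : HasWeakDeriv 1 Ω g 0) : ∃ c, ∀ᵐ x, x ∈ Ω → g x = c := by
  rcases Ω.eq_empty_or_nonempty with rfl | ⟨x₀, hx₀⟩
  · exact ⟨0, by simp⟩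
  obtain ⟨r, hr, hrΩ⟩ := Metric.isOpen_iff.mp hΩ x₀ hx₀
  let β : ContDiffBump x₀ := ⟨r / 3, r / 2, by positivity, by linarith⟩
  let η : ℝ → ℝ := β.normed volume
  have hη : ContDiff ℝ ∞ η := β.contDiff_normed
  have hηc : HasCompactSupport η := β.hasCompactSupport_normed
  have hηs : tsupport η ⊆ Ω := by
    rw [β.tsupport_normed_eq]
    exact (Metric.closedBall_subset_ball (show r / 2 < r by linarith)).trans hrΩ
  have hη1 : ∫ x, η x = 1 := β.integral_normed
  refine ⟨∫ x in Ω, g x * η x, ?_⟩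
  set c := ∫ x in Ω, g x * η x with hc
  have hloc : LocallyIntegrableOn (fun x => g x - c) Ω :=
    h.1.sub ((locallyIntegrable_const c).locallyIntegrableOn Ω)
  have key := hΩ.ae_eq_zero_of_integral_contDiff_smul_eq_zero hloc fun ψ hψ hψc hψs => ?_
  · filter_upwards [key] with x hx hxΩ
    linarith [hx hxΩ]
  set I := ∫ x, ψ x with hI
  -- Subtracting a multiple of the normalized bump gives mean zero, so the primitive `φ` of `θ` is
  -- again compactly supported in `Ω` and is a legitimate test function.
  let θ : ℝ → ℝ := fun x => ψ x - I * η x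
  have hθ : ContDiff ℝ ∞ θ := hψ.sub (contDiff_const.mul hη)
  obtain ⟨s, hs, t, ht, hsx, hxt, hK⟩ := exists_Ioo_superset hΩ hx₀ (hψc.isCompact.union hηc)
    (union_subset hψs hηs)
  have hst : s ≤ t := (hsx.trans hxt).le
  have hsub : Icc s t ⊆ Ω := hΩc.ordConnected.out hs ht
  have hθ0 : ∀ x, x ∉ Ioo s t → θ x = 0 := fun x hx => by
    have h1 : ψ x = 0 := image_eq_zero_of_notMem_tsupport fun h => hx (hK (Or.inl h))
    have h2 : η x = 0 := image_eq_zero_of_notMem_tsupport fun h => hx (hK (Or.inr h))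
    simp [θ, h1, h2]
  have hψi : Integrable ψ := hψ.continuous.integrable_of_hasCompactSupport hψc
  have hηi : Integrable η := hη.continuous.integrable_of_hasCompactSupport hηc
  have hθi : ∫ x, θ x = 0 := by
    rw [integral_sub hψi (hηi.const_mul I), integral_const_mul, hη1, hI]; ring
  let φ : ℝ → ℝ := fun y => ∫ x in s..y, θ x
  have hφd : ∀ y, HasDerivAt φ (θ y) y := fun y =>
    intervalIntegral.integral_hasDerivAt_right (hθ.continuous.intervalIntegrable _ _)
      (hθ.continuous.stronglyMeasurableAtFilter _ _) hθ.continuous.continuousAt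
  have hφ' : deriv φ = θ := funext fun y => (hφd y).deriv
  have hφ : ContDiff ℝ ∞ φ := contDiff_infty_iff_deriv.mpr
    ⟨fun y => (hφd y).differentiableAt, by rw [hφ']; exact hθ⟩
  have hint : ∀ y, t ≤ y → φ y = 0 := fun y hy => by
    simp only [φ]
    rw [intervalIntegral.integral_of_le (hst.trans hy),
      setIntegral_eq_integral_of_forall_compl_eq_zero, hθi]
    exact fun x hx => hθ0 x fun h => hx ⟨h.1, h.2.le.trans hy⟩
  have hφ0 : ∀ y, y ∉ Icc s t → φ y = 0 := fun y hy => by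
    rcases lt_or_ge y s with h | h
    · simp only [φ]
      rw [intervalIntegral.integral_symm, intervalIntegral.integral_of_le h.le,
        setIntegral_eq_zero_of_forall_eq_zero, neg_zero]
      exact fun x hx => hθ0 x fun h' => absurd h'.1 (not_lt.mpr hx.2)
    · exact hint y (le_of_lt (not_le.mp fun h' => hy ⟨h, h'⟩))
  have hφs : tsupport φ ⊆ Icc s t := closure_minimal
    (fun x hx => by_contra fun h => hx (hφ0 x h)) isClosed_Icc
  have hφc : HasCompactSupport φ := isCompact_Icc.of_isClosed_subset (isClosed_tsupport _) hφs
  have e := h.2.2 φ hφ hφc (hφs.trans hsub)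
  rw [iteratedDeriv_one, hφ'] at e
  have i1 := integrable_mul_of_tsupport_subset h.1 hψ.continuous hψc hψs
  have i2 := integrable_mul_of_tsupport_subset h.1 hη.continuous hηc hηs
  have e1 : ∫ x in Ω, g x * θ x = (∫ x in Ω, g x * ψ x) - I * c := by
    rw [hc, ← integral_const_mul, ← integral_sub i1.integrableOn (i2.const_mul I).integrableOn]
    congr 1; funext x; simp only [θ]; ring
  have e2 : ∫ x in Ω, g x * ψ x = ∫ x, g x * ψ x :=
    setIntegral_eq_integral_of_forall_compl_eq_zero fun x hx => by
      rw [image_eq_zero_of_notMem_tsupport fun h => hx (hψs h), mul_zero]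
  have e3 : ∫ x, ψ x • (g x - c) = (∫ x, g x * ψ x) - I * c := by
    rw [hI, ← integral_mul_const, ← integral_sub i1 (hψi.mul_const c)]
    congr 1; funext x; rw [smul_eq_mul]; ring
  rw [e3, ← e2, ← e1, e]
  simp

/-- A function with a weak derivative agrees almost everywhere with a primitive of it. -/
theorem HasWeakDeriv.exists_ae_eq (hΩ : IsOpen Ω) (hΩc : Convex ℝ Ω) {u v : ℝ → ℝ}
    (h : HasWeakDeriv 1 Ω u v) {x₀ : ℝ} (hx₀ : x₀ ∈ Ω) :
    ∃ c, ∀ᵐ t, t ∈ Ω → u t = c + ∫ x in x₀..t, v x := by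
  have hv : ∀ s ∈ Ω, ∀ t ∈ Ω, IntervalIntegrable v volume s t := fun s hs t ht =>
    intervalIntegrable_iff.mpr ((h.2.1.integrableOn_compact_subset
      (hΩc.ordConnected.uIcc_subset hs ht) isCompact_uIcc).mono_set uIoc_subset_uIcc)
  have hp : HasWeakDeriv 1 Ω (fun t => ∫ x in x₀..t, v x) v :=
    hasWeakDeriv_one_of_integral hΩ hΩc hv fun s hs t ht =>
      intervalIntegral.integral_interval_sub_left (hv _ hx₀ _ ht) (hv _ hx₀ _ hs)
  have hg : HasWeakDeriv 1 Ω (fun t => u t - ∫ x in x₀..t, v x) 0 := by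
    refine ⟨h.1.sub hp.1, (locallyIntegrable_const 0).locallyIntegrableOn Ω,
      fun φ hφ hc hs => ?_⟩
    have hφc : Continuous (deriv φ) := hφ.continuous_deriv (by simp)
    have i1 := integrable_mul_of_tsupport_subset h.1 hφc hc.deriv (tsupport_deriv_subset.trans hs)
    have i2 := integrable_mul_of_tsupport_subset hp.1 hφc hc.deriv
      (tsupport_deriv_subset.trans hs)
    have e1 := h.2.2 φ hφ hc hs
    have e2 := hp.2.2 φ hφ hc hs
    rw [iteratedDeriv_one] at e1 e2 ⊢
    simp only [sub_mul]
    rw [integral_sub i1.integrableOn i2.integrableOn, e1, e2]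
    simp
  obtain ⟨c, hc⟩ := hg.ae_eq_const hΩ hΩc
  exact ⟨c, by filter_upwards [hc] with t ht htΩ; linarith [ht htΩ]⟩

theorem eqOn_of_ae_eq (hΩ : IsOpen Ω) {f g : ℝ → ℝ} (hf : ContinuousOn f Ω)
    (hg : ContinuousOn g Ω) (h : ∀ᵐ t, t ∈ Ω → f t = g t) : EqOn f g Ω :=
  Measure.eqOn_open_of_ae_eq (μ := volume) ((ae_restrict_iff' hΩ.measurableSet).mpr h) hΩ hf hg

/-- A continuous function with weak derivatives up to order two is differentiable, and its
derivative is a primitive of the second weak derivative. -/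
theorem exists_hasDerivAt_of_hasWeakDeriv (hΩ : IsOpen Ω) (hΩc : Convex ℝ Ω) {u v w : ℝ → ℝ}
    (hu : ContinuousOn u Ω) (h1 : HasWeakDeriv 1 Ω u v) (h2 : HasWeakDeriv 2 Ω u w) :
    ∃ u' : ℝ → ℝ, (∀ t ∈ Ω, HasDerivAt u (u' t) t) ∧
      ∀ s ∈ Ω, ∀ t ∈ Ω, IntervalIntegrable w volume s t ∧ u' t - u' s = ∫ x in s..t, w x := by
  rcases Ω.eq_empty_or_nonempty with rfl | ⟨x₀, hx₀⟩
  · exact ⟨0, by simp, by simp⟩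
  have hw : ∀ s ∈ Ω, ∀ t ∈ Ω, IntervalIntegrable w volume s t := fun s hs t ht =>
    intervalIntegrable_iff.mpr ((h2.2.1.integrableOn_compact_subset
      (hΩc.ordConnected.uIcc_subset hs ht) isCompact_uIcc).mono_set uIoc_subset_uIcc)
  obtain ⟨c, hc⟩ := (h1.one_of_two h2).exists_ae_eq hΩ hΩc hx₀
  obtain ⟨c', hc'⟩ := h1.exists_ae_eq hΩ hΩc hx₀
  set u' : ℝ → ℝ := fun t => c + ∫ x in x₀..t, w x with hu'
  have hu'i : ∀ s ∈ Ω, ∀ t ∈ Ω, u' t - u' s = ∫ x in s..t, w x := fun s hs t ht => by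
    rw [← intervalIntegral.integral_interval_sub_left (hw _ hx₀ _ ht) (hw _ hx₀ _ hs), hu']
    ring
  have hu'c : ContinuousOn u' Ω := continuousOn_of_integral hΩ hw hu'i hΩc
  have hu'ii : ∀ s ∈ Ω, ∀ t ∈ Ω, IntervalIntegrable u' volume s t := fun s hs t ht =>
    (hu'c.mono (hΩc.ordConnected.uIcc_subset hs ht)).intervalIntegrable
  have hpc : ContinuousOn (fun t => c' + ∫ x in x₀..t, u' x) Ω :=
    continuousOn_of_integral hΩ hu'ii (fun s hs t ht => by
      rw [← intervalIntegral.integral_interval_sub_left (hu'ii _ hx₀ _ ht) (hu'ii _ hx₀ _ hs)]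
      ring) hΩc
  -- Equality almost everywhere becomes equality because both sides are continuous; here continuity
  -- of `u` is essential.
  have heq : EqOn u (fun t => c' + ∫ x in x₀..t, u' x) Ω := by
    refine eqOn_of_ae_eq hΩ hu hpc ?_
    filter_upwards [hc'] with t ht htΩ
    rw [ht htΩ]
    congr 1
    refine intervalIntegral.integral_congr_ae ?_
    filter_upwards [hc] with x hx hxt
    exact hx (hΩc.ordConnected.uIcc_subset hx₀ htΩ (uIoc_subset_uIcc hxt))
  refine ⟨u', fun t ht => ?_, fun s hs t ht => ⟨hw s hs t ht, hu'i s hs t ht⟩⟩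
  have : HasDerivAt (fun t => c' + ∫ x in x₀..t, u' x) (u' t) t :=
    (intervalIntegral.integral_hasDerivAt_right (hu'ii _ hx₀ _ ht)
      (hu'c.stronglyMeasurableAtFilter hΩ t ht) (hu'c.continuousAt (hΩ.mem_nhds ht))).const_add c'
  refine this.congr_of_eventuallyEq ?_
  filter_upwards [hΩ.mem_nhds ht] with y hy using heq hy

end WeakDerivatives

/-! ### From Sobolev curves to regular systems -/

section RegularSystemsFromWeakDerivatives

open Matrix Set Filter Topology MeasureTheory

variable {d : ℕ} {Ω : Set ℝ}

theorem isHermitian_of_hasDerivAt {A : ℝ → Matrix (Fin d) (Fin d) ℂ}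
    {B : Matrix (Fin d) (Fin d) ℂ} {t : ℝ} (hH : ∀ᶠ s in 𝓝 t, (A s).IsHermitian)
    (hA : ∀ i j, HasDerivAt (fun s => A s i j) (B i j) t) : B.IsHermitian := by
  refine IsHermitian.ext fun i j => ?_
  have h1 : HasDerivAt (fun s => star (A s j i)) (star (B j i)) t := (hA j i).star
  refine (h1.congr_of_eventuallyEq ?_).unique (hA i j)
  filter_upwards [hH] with s hs using (hs.apply i j).symm

theorem hasDerivAt_entry {A : ℝ → Matrix (Fin d) (Fin d) ℂ} {x y t : ℝ} {i j : Fin d}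
    (hre : HasDerivAt (fun s => (A s i j).re) x t) (him : HasDerivAt (fun s => (A s i j).im) y t) :
    HasDerivAt (fun s => A s i j) (x + y * Complex.I) t := by
  have := hre.ofReal_comp.add (him.ofReal_comp.mul_const Complex.I)
  refine this.congr_of_eventuallyEq (Eventually.of_forall fun s => ?_)
  exact (Complex.re_add_im _).symm

/-- The sum of the absolute second derivatives of all components dominates the variation of the
derivative, and the jets come from a limit of eigenbases. The densities are locally integrable on
the whole line because primitives are based at `0`, which may lie outside `Ω`. -/
theorem isRegularSystem_of_primitives (hΩ : IsOpen Ω) (hΩc : Convex ℝ Ω)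
    {A : ℝ → Matrix (Fin d) (Fin d) ℂ} (hH : ∀ t ∈ Ω, (A t).IsHermitian)
    {ev ev' : Fin d → ℝ → ℝ} (hev : ∀ t ∈ Ω, IsEigenvalueTuple (A t) (fun j => ev j t))
    (hev' : ∀ t ∈ Ω, ∀ j, HasDerivAt (ev j) (ev' j t) t)
    {re' im' wr wi : Fin d → Fin d → ℝ → ℝ}
    (hre : ∀ i j, ∀ t ∈ Ω, HasDerivAt (fun s => (A s i j).re) (re' i j t) t)
    (him : ∀ i j, ∀ t ∈ Ω, HasDerivAt (fun s => (A s i j).im) (im' i j t) t)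
    (hwr : ∀ i j, ∀ s ∈ Ω, ∀ t ∈ Ω, re' i j t - re' i j s = ∫ x in s..t, wr i j x)
    (hwi : ∀ i j, ∀ s ∈ Ω, ∀ t ∈ Ω, im' i j t - im' i j s = ∫ x in s..t, wi i j x)
    (hlr : ∀ i j, LocallyIntegrable (wr i j)) (hli : ∀ i j, LocallyIntegrable (wi i j)) :
    IsRegularSystem Ω A (fun t => Matrix.of fun i j => (re' i j t : ℂ) + im' i j t * Complex.I)
      (fun x => ∑ i, ∑ j, (|wr i j x| + |wi i j x|)) ev ev' := by
  have hA : ∀ t ∈ Ω, ∀ i j, HasDerivAt (fun s => A s i j)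
      ((Matrix.of fun i j => (re' i j t : ℂ) + im' i j t * Complex.I) i j) t :=
    fun t ht i j => hasDerivAt_entry (hre i j t ht) (him i j t ht)
  have hir := fun i j s t => (LocallyIntegrable.intervalIntegrable_real (hlr i j) s t).abs
  have hii := fun i j s t => (LocallyIntegrable.intervalIntegrable_real (hli i j) s t).abs
  refine ⟨hΩ, hΩc, ?_, fun x => by positivity, hA, fun s hs t ht hst => ?_, fun t ht => ?_, hev'⟩
  · have h1 : ∀ i j, LocallyIntegrable (fun x => |wr i j x| + |wi i j x|) := fun i j x => by
      obtain ⟨u, hu, hiu⟩ := hlr i j x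
      obtain ⟨v, hv, hiv⟩ := hli i j x
      exact ⟨u ∩ v, inter_mem hu hv, (hiu.mono_set inter_subset_left).abs.add
        (hiv.mono_set inter_subset_right).abs⟩
    have h2 := locallyIntegrable_finsetSum Finset.univ fun i (_ : i ∈ Finset.univ) =>
      locallyIntegrable_finsetSum (μ := volume) Finset.univ fun j (_ : j ∈ Finset.univ) => h1 i j
    simpa only using h2
  · rw [intervalIntegral.integral_finsetSum fun i _ => ?_]
    · refine Finset.sum_le_sum fun i _ => ?_
      rw [intervalIntegral.integral_finsetSum fun j _ => (hir i j s t).add (hii i j s t)]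
      refine Finset.sum_le_sum fun j _ => ?_
      rw [intervalIntegral.integral_add (hir i j s t) (hii i j s t)]
      have e : (Matrix.of fun i j => (re' i j t : ℂ) + im' i j t * Complex.I) i j -
          (Matrix.of fun i j => (re' i j s : ℂ) + im' i j s * Complex.I) i j =
          ((re' i j t - re' i j s : ℝ) : ℂ) + ((im' i j t - im' i j s : ℝ) : ℂ) * Complex.I := by
        simp only [Matrix.of_apply]; push_cast; ring
      rw [e]
      refine (norm_add_le _ _).trans (add_le_add ?_ ?_)
      · rw [Complex.norm_real, hwr i j s hs t ht]
        exact intervalIntegral.abs_integral_le_integral_abs hst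
      · rw [norm_mul, Complex.norm_I, mul_one, Complex.norm_real, hwi i j s hs t ht]
        exact intervalIntegral.abs_integral_le_integral_abs hst
    · have := IntervalIntegrable.sum (μ := volume) (a := s) (b := t) Finset.univ
        (f := fun j x => |wr i j x| + |wi i j x|) fun j _ => (hir i j s t).add (hii i j s t)
      have e : (fun x => ∑ j, (|wr i j x| + |wi i j x|)) =
          ∑ j, fun x => |wr i j x| + |wi i j x| := by
        funext x; simp only [Finset.sum_apply]
      rw [e]; exact this
  · refine exists_diagonalizesJet_of_hasDerivAt (hA t ht) ?_ (hev' t ht)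
    filter_upwards [hΩ.mem_nhds ht] with s hs using (hev s hs).exists_diagonalizes (hH s hs)

namespace IsRegularSystem

variable {A A' : ℝ → Matrix (Fin d) (Fin d) ℂ} {W : ℝ → ℝ} {ev ev' : Fin d → ℝ → ℝ}

theorem hasWeakDeriv (h : IsRegularSystem Ω A A' W ev ev') (j : Fin d) :
    HasWeakDeriv 1 Ω (ev j) (ev' j) ∧ HasWeakDeriv 2 Ω (ev j) (deriv (ev' j)) := by
  have hc : ContinuousOn (ev' j) Ω := fun t ht =>
    (h.continuousAt_deriv ht j).continuousWithinAt
  have hi : ∀ s ∈ Ω, ∀ t ∈ Ω, IntervalIntegrable (ev' j) volume s t := fun s hs t ht =>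
    (hc.mono (h.convex.ordConnected.uIcc_subset hs ht)).intervalIntegrable
  have h1 : HasWeakDeriv 1 Ω (ev j) (ev' j) :=
    hasWeakDeriv_one_of_integral h.isOpen h.convex hi fun s hs t ht =>
      (intervalIntegral.integral_eq_sub_of_hasDerivAt (fun x hx => h.hasDerivAt x
        (h.convex.ordConnected.uIcc_subset hs ht hx) j) (hi s hs t ht)).symm
  exact ⟨h1, h1.two_of_one (hasWeakDeriv_one_of_integral h.isOpen h.convex
    (fun s hs t ht => h.intervalIntegrable_deriv_deriv j hs ht)
    fun s hs t ht => h.deriv_sub_eq_integral j hs ht)⟩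

theorem abs_deriv_le (h : IsRegularSystem Ω A A' W ev ev') {t : ℝ} (ht : t ∈ Ω) (j : Fin d) :
    |ev' j t| ≤ ∑ i, ∑ l, ‖A' t i l‖ := by
  obtain ⟨U, hU⟩ := h.jet t ht
  rw [← hU.re_diag j]
  exact (Complex.abs_re_le_norm _).trans (norm_conj_apply_le hU.1.1 hU.1.1 _ j j)

end IsRegularSystem

theorem IsEigenvalueTuple.abs_le {A : Matrix (Fin d) (Fin d) ℂ} {v : Fin d → ℝ}
    (hv : IsEigenvalueTuple A v) (hA : A.IsHermitian) (j : Fin d) :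
    |v j| ≤ ∑ i, ∑ l, ‖A i l‖ := by
  obtain ⟨U, hU⟩ := hv.exists_diagonalizes hA
  have e : v j = ((Uᴴ * A * U) j j).re := by rw [hU.conjTranspose_mul_mul]; simp
  rw [e]
  exact (Complex.abs_re_le_norm _).trans (norm_conj_apply_le hU.1 hU.1 _ j j)

theorem DCOn.continuousOn {E : Type*} [AddCommGroup E] [Module ℝ E] [TopologicalSpace E]
    {U : Set E} {f : E → ℝ} (h : DCOn U f) : ContinuousOn f U := by
  obtain ⟨g, k, hg, -, hk, -, e⟩ := h
  exact (hg.sub hk).congr e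

/-- The DC property of the curve enters through continuity, which singles out the `C¹`
representative of the Sobolev class. -/
theorem regularity_of_differentiable_system {A : ℝ → Matrix (Fin d) (Fin d) ℂ}
    (hH : ∀ t, (A t).IsHermitian) (hDC : Componentwise (DCOn univ) A)
    (hW : Componentwise (MemW21Loc univ) A) {ev : Fin d → ℝ → ℝ}
    (hev : ∀ t, IsEigenvalueTuple (A t) (fun j => ev j t)) (hd : ∀ j, Differentiable ℝ (ev j))
    (j : Fin d) : ContDiff ℝ 1 (ev j) ∧ DCOn univ (ev j) ∧ MemW21Loc univ (ev j) := by
  choose vr wr hr using fun i j => (hW i j).1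
  choose vi wi hi using fun i j => (hW i j).2
  choose re' hre hre' using fun i j => exists_hasDerivAt_of_hasWeakDeriv isOpen_univ convex_univ
    (hDC i j).1.continuousOn (hr i j).1 (hr i j).2
  choose im' him him' using fun i j => exists_hasDerivAt_of_hasWeakDeriv isOpen_univ convex_univ
    (hDC i j).2.continuousOn (hi i j).1 (hi i j).2
  have h := isRegularSystem_of_primitives isOpen_univ convex_univ (A := A) (fun t _ => hH t)
    (ev := ev) (ev' := fun j => deriv (ev j)) (fun t _ => hev t)
    (fun t _ j => (hd j t).hasDerivAt) hre him
    (fun i j s hs t ht => (hre' i j s hs t ht).2) (fun i j s hs t ht => (him' i j s hs t ht).2)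
    (fun i j => locallyIntegrableOn_univ.mp (hr i j).2.2.1)
    (fun i j => locallyIntegrableOn_univ.mp (hi i j).2.2.1)
  refine ⟨?_, h.dcOn j, _, _, h.hasWeakDeriv j⟩
  rw [contDiff_one_iff_deriv]
  exact ⟨hd j, continuous_iff_continuousAt.mpr fun t => h.continuousAt_deriv (mem_univ t) j⟩

theorem exists_contDiff_system_of_contDiff {A : ℝ → Matrix (Fin d) (Fin d) ℂ}
    (hH : ∀ t, (A t).IsHermitian) (hA : Componentwise (ContDiff ℝ 1) A) :
    ∃ ev : Fin d → ℝ → ℝ, (∀ t, IsEigenvalueTuple (A t) (fun j => ev j t)) ∧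
      ∀ j, ContDiff ℝ 1 (ev j) := by
  have hre := fun i j => contDiff_one_iff_deriv.mp (hA i j).1
  have him := fun i j => contDiff_one_iff_deriv.mp (hA i j).2
  have hd : ∀ t i j, HasDerivAt (fun s => A s i j)
      ((Matrix.of fun i j => ((deriv (fun s => (A s i j).re) t : ℝ) : ℂ) +
        (deriv (fun s => (A s i j).im) t : ℝ) * Complex.I) i j) t := fun t i j =>
    hasDerivAt_entry ((hre i j).1 t).hasDerivAt ((him i j).1 t).hasDerivAt
  refine exists_contDiff_system hH
    (fun t => isHermitian_of_hasDerivAt (Eventually.of_forall hH) (hd t)) hd fun i j => ?_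
  exact (Complex.continuous_ofReal.comp (hre i j).2).add
    ((Complex.continuous_ofReal.comp (him i j).2).mul continuous_const)

end RegularSystemsFromWeakDerivatives

/-! ### Uniform bounds for slices of locally DC functions -/

section UniformBounds

open Set Filter Topology MeasureTheory

/-- Bounds for the derivatives of a difference of two Lipschitz convex functions. -/
theorem bounds_of_dc {α β L : ℝ} {f g h f' w : ℝ → ℝ} (hg : ConvexOn ℝ (Ioo α β) g)
    (hh : ConvexOn ℝ (Ioo α β) h) (hgL : ∀ x ∈ Ioo α β, ∀ y ∈ Ioo α β, |g y - g x| ≤ L * |y - x|)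
    (hhL : ∀ x ∈ Ioo α β, ∀ y ∈ Ioo α β, |h y - h x| ≤ L * |y - x|)
    (hf : ∀ x ∈ Ioo α β, f x = g x - h x) (hf' : ∀ t ∈ Ioo α β, HasDerivAt f (f' t) t)
    (hw : ∀ s ∈ Ioo α β, ∀ t ∈ Ioo α β,
      IntervalIntegrable w volume s t ∧ f' t - f' s = ∫ x in s..t, w x) :
    (∀ t ∈ Ioo α β, |f' t| ≤ 4 * L) ∧ ∫⁻ x in Ioo α β, ‖w x‖ₑ ≤ ENNReal.ofReal (4 * L) := by
  have key : ∀ g : ℝ → ℝ, ConvexOn ℝ (Ioo α β) g →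
      (∀ x ∈ Ioo α β, ∀ y ∈ Ioo α β, |g y - g x| ≤ L * |y - x|) →
      ∃ g' : ℝ → ℝ, MonotoneOn g' (Ioo α β) ∧ ∀ t ∈ Ioo α β, HasDerivWithinAt g (g' t) (Ioi t) t ∧
        |g' t| ≤ L := by
    intro g hg hL
    have hmono := hg.monotoneOn_rightDeriv
    rw [interior_Ioo] at hmono
    refine ⟨_, hmono, fun t ht => ?_⟩
    have hd := hg.hasDerivWithinAt_rightDeriv_of_mem_interior (x := t) (by rwa [interior_Ioo])
    refine ⟨hd, ?_⟩
    have hl := (hasDerivWithinAt_iff_tendsto_slope' (by simp)).mp hd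
    refine le_of_tendsto hl.abs ?_
    filter_upwards [self_mem_nhdsWithin, mem_nhdsWithin_of_mem_nhds (isOpen_Ioo.mem_nhds ht)]
      with y hy hy'
    have hy : t < y := hy
    rw [slope_def_field, abs_div, div_le_iff₀ (abs_pos.mpr (sub_pos.mpr hy).ne')]
    exact hL t ht y hy'
  obtain ⟨g', hgm, hg'⟩ := key g hg hgL
  obtain ⟨h', hhm, hh'⟩ := key h hh hhL
  -- The right derivatives `g'`, `h'` are monotone and bounded by `L`, so `g' + h'` is a monotone
  -- majorant of `f'` with oscillation at most `4 * L`.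
  have e : ∀ t ∈ Ioo α β, f' t = g' t - h' t := fun t ht => by
    have h1 := (hg' t ht).1.sub (hh' t ht).1
    have h2 : HasDerivWithinAt f (g' t - h' t) (Ioi t) t := by
      refine h1.congr_of_eventuallyEq ?_ (hf t ht)
      filter_upwards [mem_nhdsWithin_of_mem_nhds (isOpen_Ioo.mem_nhds ht)] with y hy using hf y hy
    exact (uniqueDiffWithinAt_Ioi t).eq_deriv _ (hf' t ht).hasDerivWithinAt h2
  refine ⟨fun t ht => ?_, lintegral_enorm_le_of_monotone_majorant (f := f')
    (K := fun t => g' t + h' t) (fun s hs t ht => (hw s hs t ht).1)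
    (fun s hs t ht => (hw s hs t ht).2) (fun s hs t ht hst => ?_) fun s hs t ht hst => ?_⟩
  · have h1 := abs_le.mp (hg' t ht).2
    have h2 := abs_le.mp (hh' t ht).2
    rw [e t ht, abs_le]; constructor <;> linarith
  · have h1 := hgm hs ht hst
    have h2 := hhm hs ht hst
    rw [e s hs, e t ht, abs_le]; constructor <;> linarith
  · have h1 := abs_le.mp (hg' t ht).2
    have h2 := abs_le.mp (hh' t ht).2
    have h3 := abs_le.mp (hg' s hs).2
    have h4 := abs_le.mp (hh' s hs).2
    linarith

/-- The function `u` and its first derivative are bounded by `C`, and its second derivative is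
bounded by `C` in `L¹`, provided that these derivatives exist. -/
structure HasJetBound (a b C : ℝ) (u : ℝ → ℝ) : Prop where
  abs_le : ∀ t ∈ Icc a b, |u t| ≤ C
  deriv_bounds : ∀ u' w : ℝ → ℝ, (∀ t ∈ Ioo a b, HasDerivAt u (u' t) t) →
    (∀ s ∈ Ioo a b, ∀ t ∈ Ioo a b,
      IntervalIntegrable w volume s t ∧ u' t - u' s = ∫ x in s..t, w x) →
    (∀ t ∈ Ioo a b, |u' t| ≤ C) ∧ ∫⁻ x in Ioo a b, ‖w x‖ₑ ≤ ENNReal.ofReal C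

theorem HasJetBound.mono {a b C D : ℝ} {u : ℝ → ℝ} (h : HasJetBound a b C u) (hCD : C ≤ D) :
    HasJetBound a b D u :=
  ⟨fun t ht => (h.abs_le t ht).trans hCD, fun u' w h1 h2 =>
    ⟨fun t ht => ((h.deriv_bounds u' w h1 h2).1 t ht).trans hCD,
      (h.deriv_bounds u' w h1 h2).2.trans (ENNReal.ofReal_le_ofReal hCD)⟩⟩

variable {k : ℕ} {U : Set (ℝ × (Fin k → ℝ))} {f : ℝ × (Fin k → ℝ) → ℝ}

theorem ConvexOn.exists_lipschitz_ball {E : Type*} [NormedAddCommGroup E] [NormedSpace ℝ E]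
    [FiniteDimensional ℝ E] {g : E → ℝ} {p : E} {ρ : ℝ} (hρ : 0 < ρ)
    (hg : ConvexOn ℝ (Metric.ball p ρ) g) :
    ∃ r > 0, r ≤ ρ ∧ ∃ L : ℝ, ∀ x ∈ Metric.ball p r, ∀ y ∈ Metric.ball p r,
      |g y - g x| ≤ L * ‖y - x‖ := by
  obtain ⟨L, u, hu, hL⟩ := hg.locallyLipschitzOn Metric.isOpen_ball (Metric.mem_ball_self hρ)
  rw [Metric.isOpen_ball.nhdsWithin_eq (Metric.mem_ball_self hρ)] at hu
  obtain ⟨r, hr, hru⟩ := Metric.mem_nhds_iff.mp hu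
  refine ⟨min r ρ, by positivity, min_le_right _ _, L, fun x hx y hy => ?_⟩
  have := hL.norm_sub_le (hru (Metric.ball_subset_ball (min_le_left _ _) hy))
    (hru (Metric.ball_subset_ball (min_le_left _ _) hx))
  exact this

/-- Convex functions in finite dimension are locally Lipschitz; a smaller ball serves both parts of
the decomposition. -/
theorem LocallyDCOn.exists_ball (hU : IsOpen U) (hf : LocallyDCOn U f)
    {p : ℝ × (Fin k → ℝ)} (hp : p ∈ U) :
    ∃ ρ > 0, ∃ L : ℝ, ∃ g h : ℝ × (Fin k → ℝ) → ℝ, ConvexOn ℝ (Metric.ball p ρ) g ∧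
      ConvexOn ℝ (Metric.ball p ρ) h ∧
      (∀ x ∈ Metric.ball p ρ, ∀ y ∈ Metric.ball p ρ, |g y - g x| ≤ L * ‖y - x‖) ∧
      (∀ x ∈ Metric.ball p ρ, ∀ y ∈ Metric.ball p ρ, |h y - h x| ≤ L * ‖y - x‖) ∧
      ∀ x ∈ Metric.ball p ρ, f x = g x - h x := by
  obtain ⟨V, hV, -, -, g, h, -, hg, -, hh, e⟩ := hf p hp
  rw [hU.nhdsWithin_eq hp] at hV
  obtain ⟨ρ, hρ, hball⟩ := Metric.mem_nhds_iff.mp hV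
  have hgb := hg.subset hball (convex_ball p ρ)
  have hhb := hh.subset hball (convex_ball p ρ)
  obtain ⟨r₁, hr₁, hrρ₁, L₁, hL₁⟩ := ConvexOn.exists_lipschitz_ball hρ hgb
  obtain ⟨r₂, hr₂, hrρ₂, L₂, hL₂⟩ := ConvexOn.exists_lipschitz_ball hρ hhb
  have h1 : Metric.ball p (min r₁ r₂) ⊆ Metric.ball p r₁ :=
    Metric.ball_subset_ball (min_le_left _ _)
  have h2 : Metric.ball p (min r₁ r₂) ⊆ Metric.ball p r₂ :=
    Metric.ball_subset_ball (min_le_right _ _)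
  have h3 := h1.trans (Metric.ball_subset_ball hrρ₁)
  refine ⟨min r₁ r₂, by positivity, max L₁ L₂, g, h, hgb.subset h3 (convex_ball _ _),
    hhb.subset h3 (convex_ball _ _), fun x hx y hy => ?_, fun x hx y hy => ?_,
    fun x hx => e x (hball (h3 hx))⟩
  · exact (hL₁ x (h1 hx) y (h1 hy)).trans
      (mul_le_mul_of_nonneg_right (le_max_left _ _) (norm_nonneg _))
  · exact (hL₂ x (h2 hx) y (h2 hy)).trans
      (mul_le_mul_of_nonneg_right (le_max_right _ _) (norm_nonneg _))

theorem ConvexOn.slice {g : ℝ × (Fin k → ℝ) → ℝ} {S : Set (ℝ × (Fin k → ℝ))}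
    (hg : ConvexOn ℝ S g) {J : Set ℝ} (hJ : Convex ℝ J) (r : Fin k → ℝ)
    (hJS : ∀ t ∈ J, (t, r) ∈ S) : ConvexOn ℝ J (fun t => g (t, r)) := by
  refine ⟨hJ, fun x hx y hy a b ha hb hab => ?_⟩
  have := hg.2 (hJS x hx) (hJS y hy) ha hb hab
  have e : a • (x, r) + b • (y, r) = (a • x + b • y, r) := by
    rw [Prod.smul_mk, Prod.smul_mk, Prod.mk_add_mk, ← add_smul, hab, one_smul]
  rwa [e] at this

/-- The slices of a locally DC function over a compact set have uniformly bounded derivatives, and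
the second derivatives are uniformly bounded in `L¹`. -/
theorem LocallyDCOn.exists_slice_bound {a b : ℝ} (hU : IsOpen U)
    (hKU : Icc a b ×ˢ univ.pi (fun _ => Icc a b) ⊆ U) (hf : LocallyDCOn U f) :
    ∃ C, 0 ≤ C ∧ ∀ r ∈ univ.pi (fun _ : Fin k => Icc a b),
      HasJetBound a b C (fun t => f (t, r)) := by
  -- The bounds are localized to `S` so that they are monotone and additive in `S`; compactness then
  -- reduces them to small balls.
  let P : Set (ℝ × (Fin k → ℝ)) → Prop := fun S => ∃ C, 0 ≤ C ∧
    ∀ r ∈ univ.pi (fun _ : Fin k => Icc a b), (∀ t ∈ Icc a b, (t, r) ∈ S → |f (t, r)| ≤ C) ∧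
      ∀ f' w : ℝ → ℝ, (∀ t ∈ Ioo a b, HasDerivAt (fun s => f (s, r)) (f' t) t) →
        (∀ s ∈ Ioo a b, ∀ t ∈ Ioo a b,
          IntervalIntegrable w volume s t ∧ f' t - f' s = ∫ x in s..t, w x) →
        (∀ t ∈ Ioo a b, (t, r) ∈ S → |f' t| ≤ C) ∧
          ∫⁻ x in Ioo a b ∩ {t | (t, r) ∈ S}, ‖w x‖ₑ ≤ ENNReal.ofReal C
  have hK : IsCompact (Icc a b ×ˢ univ.pi (fun _ : Fin k => Icc a b)) :=
    isCompact_Icc.prod (isCompact_univ_pi fun _ => isCompact_Icc)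
  have main : P (Icc a b ×ˢ univ.pi (fun _ => Icc a b)) := by
    refine hK.induction_on (p := P) ?_ ?_ ?_ ?_
    · exact ⟨0, le_rfl, fun r _ => ⟨by simp, fun f' w _ _ => ⟨by simp, by simp⟩⟩⟩
    · rintro S T hST ⟨C, hC, h⟩
      refine ⟨C, hC, fun r hr => ⟨fun t ht hS => (h r hr).1 t ht (hST hS), fun f' w h1 h2 => ?_⟩⟩
      obtain ⟨h3, h4⟩ := (h r hr).2 f' w h1 h2
      have hsub : Ioo a b ∩ {t | (t, r) ∈ S} ⊆ Ioo a b ∩ {t | (t, r) ∈ T} :=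
        fun t ht => ⟨ht.1, hST ht.2⟩
      exact ⟨fun t ht hS => h3 t ht (hST hS), (lintegral_mono_set hsub).trans h4⟩
    · rintro S T ⟨C, hC, h⟩ ⟨D, hD, h'⟩
      refine ⟨C + D, by positivity, fun r hr => ⟨fun t ht hS => ?_, fun f' w h1 h2 => ?_⟩⟩
      · rcases hS with hS | hS
        · exact ((h r hr).1 t ht hS).trans (by linarith)
        · exact ((h' r hr).1 t ht hS).trans (by linarith)
      · obtain ⟨h3, h4⟩ := (h r hr).2 f' w h1 h2
        obtain ⟨h5, h6⟩ := (h' r hr).2 f' w h1 h2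
        refine ⟨fun t ht hS => ?_, ?_⟩
        · rcases hS with hS | hS
          · exact (h3 t ht hS).trans (by linarith)
          · exact (h5 t ht hS).trans (by linarith)
        · rw [ENNReal.ofReal_add hC hD]
          refine le_trans ?_ (add_le_add h4 h6)
          refine (lintegral_mono_set ?_).trans (lintegral_union_le _ _ _)
          rintro t ⟨h1, h2⟩
          exact h2.imp (fun h => ⟨h1, h⟩) fun h => ⟨h1, h⟩
    · intro p hp
      obtain ⟨ρ, hρ, L, g, h, hg, hh, hgL, hhL, e⟩ := hf.exists_ball hU (hKU hp)
      refine ⟨Metric.ball p ρ, mem_nhdsWithin_of_mem_nhds (Metric.ball_mem_nhds _ hρ),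
        max (|f p| + 2 * |L| * ρ) (4 * L), le_max_of_le_left (by positivity), fun r hr =>
        ⟨fun t ht hS => le_max_of_le_left ?_, fun f' w h1 h2 => ?_⟩⟩
      · have hp' : p ∈ Metric.ball p ρ := Metric.mem_ball_self hρ
        have hd : ‖(t, r) - p‖ ≤ ρ := by rw [← dist_eq_norm]; exact (Metric.mem_ball.mp hS).le
        have e1 := hgL p hp' _ hS
        have e2 := hhL p hp' _ hS
        have e3 : L * ‖(t, r) - p‖ ≤ |L| * ρ :=
          mul_le_mul (le_abs_self L) hd (norm_nonneg _) (abs_nonneg _)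
        have e4 : |f (t, r) - f p| ≤ 2 * |L| * ρ := by
          rw [e _ hS, e _ hp', abs_le]
          rw [abs_le] at e1 e2
          constructor <;> linarith [e1.1, e1.2, e2.1, e2.2]
        have := abs_sub_abs_le_abs_sub (f (t, r)) (f p)
        linarith
      -- In the sup norm a ball is a product, so each slice is an interval or empty.
      · have hball : ∀ t, (t, r) ∈ Metric.ball p ρ ↔
            t ∈ Ioo (p.1 - ρ) (p.1 + ρ) ∧ dist r p.2 < ρ := fun t => by
          rw [Metric.mem_ball, Prod.dist_eq, max_lt_iff, ← Real.ball_eq_Ioo, Metric.mem_ball]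
        by_cases hrp : dist r p.2 < ρ
        swap
        · refine ⟨fun t _ hS => absurd ((hball t).mp hS).2 hrp, ?_⟩
          have : Ioo a b ∩ {t | (t, r) ∈ Metric.ball p ρ} = ∅ :=
            eq_empty_of_forall_notMem fun t ht => hrp ((hball t).mp ht.2).2
          rw [this]; simp
        have hJ : Ioo a b ∩ {t | (t, r) ∈ Metric.ball p ρ} =
            Ioo (max a (p.1 - ρ)) (min b (p.1 + ρ)) := by
          rw [← Ioo_inter_Ioo]
          ext t
          simp only [mem_inter_iff, mem_ofPred_eq, hball, hrp, and_true]
        set α := max a (p.1 - ρ)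
        set β := min b (p.1 + ρ)
        have hJ1 : ∀ t ∈ Ioo α β, t ∈ Ioo a b := fun t ht => by rw [← hJ] at ht; exact ht.1
        have hJ2 : ∀ t ∈ Ioo α β, (t, r) ∈ Metric.ball p ρ := fun t ht => by
          rw [← hJ] at ht; exact ht.2
        have hnorm : ∀ x y : ℝ, ‖((y, r) : ℝ × (Fin k → ℝ)) - (x, r)‖ = |y - x| := fun x y => by
          rw [Prod.mk_sub_mk, sub_self, Prod.norm_mk]; simp
        have hb := bounds_of_dc (L := L) (f := fun s => f (s, r))
          (hg.slice (convex_Ioo α β) r hJ2) (hh.slice (convex_Ioo α β) r hJ2)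
          (fun x hx y hy => by
            have := hgL _ (hJ2 x hx) _ (hJ2 y hy); rwa [hnorm] at this)
          (fun x hx y hy => by
            have := hhL _ (hJ2 x hx) _ (hJ2 y hy); rwa [hnorm] at this)
          (fun x hx => e _ (hJ2 x hx)) (fun t ht => h1 t (hJ1 t ht))
          (fun s hs t ht => h2 s (hJ1 s hs) t (hJ1 t ht))
        refine ⟨fun t ht hS => (hb.1 t ?_).trans (le_max_right _ _), ?_⟩
        · rw [← hJ]; exact ⟨ht, hS⟩
        · rw [hJ]
          exact hb.2.trans (ENNReal.ofReal_le_ofReal (le_max_right _ _))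
  obtain ⟨C, hC, h⟩ := main
  refine ⟨C, hC, fun r hr => ⟨fun t ht => (h r hr).1 t ht ⟨ht, hr⟩, fun f' w h1 h2 => ?_⟩⟩
  obtain ⟨h3, h4⟩ := (h r hr).2 f' w h1 h2
  refine ⟨fun t ht => h3 t ht ⟨Ioo_subset_Icc_self ht, hr⟩, ?_⟩
  have : Ioo a b ∩ {t | (t, r) ∈ Icc a b ×ˢ univ.pi (fun _ : Fin k => Icc a b)} = Ioo a b :=
    inter_eq_left.mpr fun t ht => ⟨Ioo_subset_Icc_self ht, hr⟩
  rwa [this] at h4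

end UniformBounds

/-! ### Uniform bounds for eigenvalue systems -/

section UniformSystems

open Matrix Set Filter Topology MeasureTheory

variable {d : ℕ}

theorem sum_sum_le_mul {x : Fin d → Fin d → ℝ} {C : ℝ} (h : ∀ i j, x i j ≤ C) :
    ∑ i, ∑ j, x i j ≤ d * d * C := by
  calc ∑ i, ∑ j, x i j ≤ ∑ _i : Fin d, ∑ _j : Fin d, C :=
        Finset.sum_le_sum fun i _ => Finset.sum_le_sum fun j _ => h i j
    _ = d * d * C := by simp [mul_assoc]

theorem intervalIntegral_abs_le_of_lintegral_le {w : ℝ → ℝ} {a b C s t : ℝ} (hC : 0 ≤ C)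
    (hw : ∫⁻ x in Ioo a b, ‖w x‖ₑ ≤ ENNReal.ofReal C) (hs : s ∈ Ioo a b) (ht : t ∈ Ioo a b)
    (hst : s ≤ t) (hi : IntervalIntegrable w volume s t) : ∫ x in s..t, |w x| ≤ C := by
  rw [intervalIntegral.integral_of_le hst]
  have hi' := (intervalIntegrable_iff_integrableOn_Ioc_of_le hst).mp hi
  have e : ∫ x in Ioc s t, |w x| = (∫⁻ x in Ioc s t, ‖w x‖ₑ).toReal :=
    integral_norm_eq_lintegral_enorm hi'.aestronglyMeasurable
  rw [e]
  refine ENNReal.toReal_le_of_le_ofReal hC ((lintegral_mono_set fun x hx => ?_).trans hw)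
  exact ⟨hs.1.trans hx.1, hx.2.trans_lt ht.2⟩

theorem exists_isRegularSystem_of_memW21 {a b : ℝ} {A : ℝ → Matrix (Fin d) (Fin d) ℂ}
    (hH : ∀ t ∈ Icc a b, (A t).IsHermitian)
    (hA : Componentwise (fun f => ContinuousOn f (Icc a b)) A)
    (hW : Componentwise (MemW21 (Ioo a b)) A) {C : ℝ} (hC : 0 ≤ C)
    (hb : Componentwise (HasJetBound a b C) A) {ev : Fin d → ℝ → ℝ}
    (hev : ∀ t ∈ Icc a b, IsEigenvalueTuple (A t) (fun j => ev j t))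
    (hd : ∀ j, DifferentiableOn ℝ (ev j) (Ioo a b)) :
    ∃ A' W, IsRegularSystem (Ioo a b) A A' W ev (fun j => deriv (ev j)) ∧
      (∀ t ∈ Ioo a b, ∑ i, ∑ l, ‖A' t i l‖ ≤ d * d * (2 * C)) ∧
      ∀ s ∈ Ioo a b, ∀ t ∈ Ioo a b, s ≤ t → ∫ x in s..t, W x ≤ d * d * (2 * C) := by
  have hsub : Ioo a b ⊆ Icc a b := Ioo_subset_Icc_self
  choose vr wr hr using fun i j => (hW i j).1
  choose vi wi hi using fun i j => (hW i j).2
  choose re' hre hre' using fun i j => exists_hasDerivAt_of_hasWeakDeriv isOpen_Ioo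
    (convex_Ioo a b) ((hA i j).1.mono hsub) (hr i j).1 (hr i j).2.1
  choose im' him him' using fun i j => exists_hasDerivAt_of_hasWeakDeriv isOpen_Ioo
    (convex_Ioo a b) ((hA i j).2.mono hsub) (hi i j).1 (hi i j).2.1
  have br := fun i j => (hb i j).1.deriv_bounds _ _ (hre i j) (hre' i j)
  have bi := fun i j => (hb i j).2.deriv_bounds _ _ (him i j) (him' i j)
  -- Extending the second derivatives by zero makes them integrable on the line without changing
  -- integrals inside the interval.
  have hind : ∀ (w : ℝ → ℝ), ∀ s ∈ Ioo a b, ∀ t ∈ Ioo a b,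
      ∫ x in s..t, (Ioo a b).indicator w x = ∫ x in s..t, w x := fun w s hs t ht =>
    intervalIntegral.integral_congr fun x hx =>
      indicator_of_mem ((convex_Ioo a b).ordConnected.uIcc_subset hs ht hx) w
  have hloc : ∀ w : ℝ → ℝ, IntegrableOn w (Ioo a b) →
      LocallyIntegrable ((Ioo a b).indicator w) := fun w hw =>
    ((integrable_indicator_iff measurableSet_Ioo).mpr hw).locallyIntegrable
  have hlr := fun i j => hloc _ (hr i j).2.2.2.2
  have hli := fun i j => hloc _ (hi i j).2.2.2.2
  have hreg := isRegularSystem_of_primitives isOpen_Ioo (convex_Ioo a b)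
    (fun t ht => hH t (hsub ht)) (ev := ev) (ev' := fun j => deriv (ev j))
    (fun t ht => hev t (hsub ht))
    (fun t ht j => ((hd j).differentiableAt (isOpen_Ioo.mem_nhds ht)).hasDerivAt) hre him
    (wr := fun i j => (Ioo a b).indicator (wr i j)) (wi := fun i j => (Ioo a b).indicator (wi i j))
    (fun i j s hs t ht => by rw [hind _ s hs t ht]; exact (hre' i j s hs t ht).2)
    (fun i j s hs t ht => by rw [hind _ s hs t ht]; exact (him' i j s hs t ht).2) hlr hli
  refine ⟨_, _, hreg, fun t ht => sum_sum_le_mul fun i j => ?_, fun s hs t ht hst => ?_⟩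
  · refine (norm_add_le _ _).trans ?_
    rw [norm_mul, Complex.norm_I, mul_one, Complex.norm_real, Complex.norm_real]
    have h1 := (br i j).1 t ht
    have h2 := (bi i j).1 t ht
    rw [Real.norm_eq_abs, Real.norm_eq_abs]
    linarith
  · have ir := fun i j => (LocallyIntegrable.intervalIntegrable_real (hlr i j) s t).abs
    have ii := fun i j => (LocallyIntegrable.intervalIntegrable_real (hli i j) s t).abs
    have i1 := fun i j => (ir i j).add (ii i j)
    have i2 : ∀ i, IntervalIntegrable (fun x => ∑ j, (|(Ioo a b).indicator (wr i j) x| +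
        |(Ioo a b).indicator (wi i j) x|)) volume s t := fun i => by
      have := IntervalIntegrable.sum Finset.univ fun j (_ : j ∈ Finset.univ) => i1 i j
      have e : (fun x => ∑ j, (|(Ioo a b).indicator (wr i j) x| +
          |(Ioo a b).indicator (wi i j) x|)) = ∑ j, fun x => |(Ioo a b).indicator (wr i j) x| +
          |(Ioo a b).indicator (wi i j) x| := by
        funext x; simp only [Finset.sum_apply]
      rw [e]; exact this
    rw [intervalIntegral.integral_finsetSum fun i _ => i2 i]
    have e : ∀ i, ∫ x in s..t, ∑ j, (|(Ioo a b).indicator (wr i j) x| +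
        |(Ioo a b).indicator (wi i j) x|) = ∑ j, ((∫ x in s..t, |(Ioo a b).indicator (wr i j) x|) +
        ∫ x in s..t, |(Ioo a b).indicator (wi i j) x|) := fun i => by
      rw [intervalIntegral.integral_finsetSum fun j _ => i1 i j]
      exact Finset.sum_congr rfl fun j _ => intervalIntegral.integral_add (ir i j) (ii i j)
    rw [Finset.sum_congr rfl fun i _ => e i]
    have hle : ∀ w : ℝ → ℝ, ∫⁻ x in Ioo a b, ‖w x‖ₑ ≤ ENNReal.ofReal C →
        IntervalIntegrable w volume s t → ∫ x in s..t, |(Ioo a b).indicator w x| ≤ C :=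
      fun w hw hi => by
        refine le_trans (le_of_eq ?_) (intervalIntegral_abs_le_of_lintegral_le hC hw hs ht hst hi)
        refine intervalIntegral.integral_congr fun x hx => ?_
        simp only [indicator_of_mem ((convex_Ioo a b).ordConnected.uIcc_subset hs ht hx) w]
    refine sum_sum_le_mul fun i j => ?_
    have h1 := hle _ (br i j).2 (hre' i j s hs t ht).1
    have h2 := hle _ (bi i j).2 (him' i j s hs t ht).1
    linarith

theorem setLIntegral_enorm_le_of_abs_le {u : ℝ → ℝ} {a b D : ℝ} (hD : 0 ≤ D)
    (hu : ∀ t ∈ Ioo a b, |u t| ≤ D) :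
    ∫⁻ x in Ioo a b, ‖u x‖ₑ ≤ ENNReal.ofReal (D * (b - a)) := by
  calc ∫⁻ x in Ioo a b, ‖u x‖ₑ ≤ ∫⁻ _x in Ioo a b, ENNReal.ofReal D :=
        setLIntegral_mono measurable_const fun x hx => by
          rw [Real.enorm_eq_ofReal_abs]; exact ENNReal.ofReal_le_ofReal (hu x hx)
    _ = ENNReal.ofReal (D * (b - a)) := by
        rw [setLIntegral_const, Real.volume_Ioo, ENNReal.ofReal_mul hD]

/-- Bounds for the eigenvalues of a curve of Hermitian matrices in terms of bounds for its
entries. -/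
theorem system_bounds {a b : ℝ} (hab : a < b) {A : ℝ → Matrix (Fin d) (Fin d) ℂ}
    (hH : ∀ t ∈ Icc a b, (A t).IsHermitian)
    (hA : Componentwise (fun f => ContinuousOn f (Icc a b)) A)
    (hW : Componentwise (MemW21 (Ioo a b)) A) {C : ℝ} (hC : 0 ≤ C)
    (hb : Componentwise (HasJetBound a b C) A) {ev : Fin d → ℝ → ℝ}
    (hev : ∀ t ∈ Icc a b, IsEigenvalueTuple (A t) (fun j => ev j t))
    (hd : ∀ j, ContDiffOn ℝ 1 (ev j) (Icc a b)) (j : Fin d) :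
    (∀ t ∈ Icc a b, |ev j t| ≤ d * d * (2 * C)) ∧
    (∀ t ∈ Icc a b, |derivWithin (ev j) (Icc a b) t| ≤ d * d * (2 * C)) ∧
    W21norm (Ioo a b) (ev j) ≤ ENNReal.ofReal (2 * (d * d * (2 * C) * (b - a)) +
      (4 * d * d * (d * d * (2 * C)) + (d * (2 * d + 1)) * (d * d * (2 * C)))) := by
  obtain ⟨A', W, h, hA', hWi⟩ := exists_isRegularSystem_of_memW21 hH hA hW hC hb hev fun j =>
    ((hd j).differentiableOn (by simp)).mono Ioo_subset_Icc_self
  set D := d * d * (2 * C) with hDdef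
  have hD : 0 ≤ D := by positivity
  have h0 : ∀ t ∈ Icc a b, ∀ j, |ev j t| ≤ D := fun t ht j =>
    ((hev t ht).abs_le (hH t ht) j).trans <| sum_sum_le_mul fun i l => by
      have h1 := (hb i l).1.abs_le t ht
      have h2 := (hb i l).2.abs_le t ht
      have h3 := Complex.norm_le_abs_re_add_abs_im (A t i l)
      linarith
  have h1 : ∀ t ∈ Ioo a b, ∀ j, |deriv (ev j) t| ≤ D := fun t ht j =>
    (h.abs_deriv_le ht j).trans (hA' t ht)
  refine ⟨fun t ht => h0 t ht j, fun t ht => ?_, ?_⟩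
  -- The bound holds in the open interval and passes to the endpoints by continuity of the one-sided
  -- derivative.
  · have hc := (hd j).continuousOn_derivWithin (uniqueDiffOn_Icc hab) le_rfl
    rw [← closure_Ioo hab.ne] at ht
    have hm : MapsTo (derivWithin (ev j) (Icc a b)) (Ioo a b) (Icc (-D) D) := fun x hx => by
      rw [derivWithin_of_mem_nhds (Icc_mem_nhds hx.1 hx.2)]
      exact abs_le.mp (h1 x hx j)
    have := hm.closure_of_continuousOn (by rwa [closure_Ioo hab.ne]) ht
    rw [closure_Icc] at this
    exact abs_le.mpr this
  · have h2 := h.lintegral_enorm_deriv_deriv_le j h1 hWi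
    have e0 := setLIntegral_enorm_le_of_abs_le hD fun t ht => h0 t (Ioo_subset_Icc_self ht) j
    have e1 := setLIntegral_enorm_le_of_abs_le hD fun t ht => h1 t ht j
    have hD' : 0 ≤ D * (b - a) := mul_nonneg hD (sub_pos.mpr hab).le
    -- The classical derivatives are admissible in the infimum. The function and its first
    -- derivative contribute `D * (b - a)` each, and the second derivative the oscillation bound of
    -- the majorant.
    refine (iInf₂_le (deriv (ev j)) (deriv (deriv (ev j)))).trans
      ((iInf_le _ (h.hasWeakDeriv j)).trans ?_)
    rw [ENNReal.ofReal_add (by positivity) (by positivity), two_mul, ENNReal.ofReal_add hD' hD']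
    exact add_le_add (add_le_add e0 e1) h2

theorem exists_uniform_hasJetBound {k : ℕ} {a b : ℝ} {U : Set (ℝ × (Fin k → ℝ))} (hU : IsOpen U)
    (hKU : Icc a b ×ˢ univ.pi (fun _ => Icc a b) ⊆ U)
    {A : ℝ × (Fin k → ℝ) → Matrix (Fin d) (Fin d) ℂ} (hA : Componentwise (LocallyDCOn U) A) :
    ∃ C, 0 ≤ C ∧ ∀ r ∈ univ.pi (fun _ : Fin k => Icc a b),
      Componentwise (HasJetBound a b C) (fun t => A (t, r)) := by
  choose Cr hCr hr using fun i j => (hA i j).1.exists_slice_bound hU hKU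
  choose Ci hCi hi using fun i j => (hA i j).2.exists_slice_bound hU hKU
  have hle : ∀ i j, Cr i j + Ci i j ≤ ∑ i, ∑ j, (Cr i j + Ci i j) := fun i j =>
    (Finset.single_le_sum (f := fun j => Cr i j + Ci i j)
      (fun j _ => add_nonneg (hCr i j) (hCi i j)) (Finset.mem_univ j)).trans
    (Finset.single_le_sum (f := fun i => ∑ j, (Cr i j + Ci i j))
      (fun i _ => Finset.sum_nonneg fun j _ => add_nonneg (hCr i j) (hCi i j)) (Finset.mem_univ i))
  refine ⟨∑ i, ∑ j, (Cr i j + Ci i j), Finset.sum_nonneg fun i _ => Finset.sum_nonneg fun j _ =>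
    add_nonneg (hCr i j) (hCi i j), fun r hr' i j => ⟨(hr i j r hr').mono ?_,
    (hi i j r hr').mono ?_⟩⟩
  · linarith [hle i j, hCi i j]
  · linarith [hle i j, hCr i j]

end UniformSystems

/-! ### The theorem -/

theorem mainTheorem2 (d : ℕ) :
    (∀ A : ℝ → Matrix (Fin d) (Fin d) ℂ, (∀ t, (A t).IsHermitian) →
      Componentwise (DCOn Set.univ) A → Componentwise (MemW21Loc Set.univ) A →
        (∀ ev : Fin d → ℝ → ℝ, (∀ t, IsEigenvalueTuple (A t) (fun j => ev j t)) →
          (∀ j, Differentiable ℝ (ev j)) →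
            ∀ j, ContDiff ℝ 1 (ev j) ∧ DCOn Set.univ (ev j) ∧ MemW21Loc Set.univ (ev j)) ∧
        (Componentwise (ContDiff ℝ 1) A →
          ∃ ev : Fin d → ℝ → ℝ, (∀ t, IsEigenvalueTuple (A t) (fun j => ev j t)) ∧
            ∀ j, ContDiff ℝ 1 (ev j))) ∧
    (∀ (k : ℕ) (a b : ℝ), a < b →
      ∀ U : Set (ℝ × (Fin k → ℝ)), IsOpen U →
        Set.Icc a b ×ˢ Set.univ.pi (fun _ => Set.Icc a b) ⊆ U →
      ∀ A : ℝ × (Fin k → ℝ) → Matrix (Fin d) (Fin d) ℂ, (∀ p ∈ U, (A p).IsHermitian) →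
        Componentwise (LocallyDCOn U) A →
        (∀ r ∈ Set.univ.pi (fun _ : Fin k => Set.Icc a b),
          Componentwise (fun f => ContDiffOn ℝ 1 f (Set.Icc a b)) (fun t => A (t, r)) ∧
          Componentwise (MemW21 (Set.Ioo a b)) (fun t => A (t, r))) →
      ∀ ev : Fin d → ℝ → (Fin k → ℝ) → ℝ,
        (∀ r ∈ Set.univ.pi (fun _ : Fin k => Set.Icc a b),
          (∀ t ∈ Set.Icc a b, IsEigenvalueTuple (A (t, r)) (fun j => ev j t r)) ∧
          ∀ j, ContDiffOn ℝ 1 (fun t => ev j t r) (Set.Icc a b)) →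
      (∃ C : ℝ, ∀ r ∈ Set.univ.pi (fun _ : Fin k => Set.Icc a b), ∀ t ∈ Set.Icc a b, ∀ j,
        |ev j t r| ≤ C ∧ |derivWithin (fun s => ev j s r) (Set.Icc a b) t| ≤ C) ∧
      ∃ m : (Fin k → ℝ) → ℝ, (∀ r, 0 ≤ m r) ∧
        MeasureTheory.IntegrableOn m (Set.univ.pi (fun _ : Fin k => Set.Ioo a b)) ∧
        ∀ᵐ r ∂(MeasureTheory.volume.restrict (Set.univ.pi (fun _ : Fin k => Set.Ioo a b))),
          ∑ j, W21norm (Set.Ioo a b) (fun t => ev j t r) ≤ ENNReal.ofReal (m r)) := by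
  refine ⟨fun A hH hDC hW => ⟨fun ev hev hd j =>
    regularity_of_differentiable_system hH hDC hW hev hd j,
    fun hA => exists_contDiff_system_of_contDiff hH hA⟩, ?_⟩
  intro k a b hab U hU hKU A hH hDC hA ev hev
  obtain ⟨C, hC, hb⟩ := exists_uniform_hasJetBound hU hKU hDC
  have key := fun r hr j => system_bounds hab (fun t ht => hH (t, r) (hKU ⟨ht, hr⟩))
    (fun i j => ⟨((hA r hr).1 i j).1.continuousOn, ((hA r hr).1 i j).2.continuousOn⟩)
    (hA r hr).2 hC (hb r hr) (ev := fun j t => ev j t r) (hev r hr).1 (hev r hr).2 j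
  refine ⟨⟨d * d * (2 * C), fun r hr t ht j => ⟨(key r hr j).1 t ht, (key r hr j).2.1 t ht⟩⟩, ?_⟩
  have hab' : 0 ≤ b - a := (sub_pos.mpr hab).le
  -- The bound is uniform in `r`, so a constant serves as `m`: `d` times the bound for one
  -- eigenvalue, integrable over a bounded box.
  refine ⟨fun _ => d * (2 * (d * d * (2 * C) * (b - a)) +
      (4 * d * d * (d * d * (2 * C)) + (d * (2 * d + 1)) * (d * d * (2 * C)))),
    fun _ => by positivity, ?_, ?_⟩
  · refine MeasureTheory.integrableOn_const (ne_of_lt ?_)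
    rw [MeasureTheory.volume_pi_pi]
    exact ENNReal.prod_lt_top fun _ _ => by rw [Real.volume_Ioo]; exact ENNReal.ofReal_lt_top
  · refine MeasureTheory.ae_restrict_of_forall_mem
      (MeasurableSet.univ_pi fun _ => measurableSet_Ioo) fun r hr => ?_
    have hr' : r ∈ Set.univ.pi (fun _ : Fin k => Set.Icc a b) := fun i hi =>
      Set.Ioo_subset_Icc_self (hr i hi)
    refine (Finset.sum_le_sum fun j _ => (key r hr' j).2.2).trans ?_
    rw [Finset.sum_const, Finset.card_univ, Fintype.card_fin, nsmul_eq_mul,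
      ENNReal.ofReal_mul (Nat.cast_nonneg d), ENNReal.ofReal_natCast]
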